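/- Let $(M,\bar g)$ be a closed (compact, without boundary), connected smooth Riemannian surface of volume $1$ whose Gauss curvature is a negative constant, $K_{\bar g}\equiv\bar K<0$. Integrals over $M$ are taken with respect to the Riemannian measure $\mu_{\bar g}$; $H^k(M)$ denotes the completion of $C^\infty(M)$ in the norm $\|u\|_{H^k}^2=\sum_{j\le k}\|\nabla^j u\|_{L^2}^2$ ($k=1,2$); $\bar u:=\int_M u\,d\mu_{\bar g}$. For $f\in C^\infty(M)$ and $u\in H^1(M)$ put $$E_f(u)=\frac12\int_M\bigl(|\nabla u|^2+2\bar K u-f e^{2u}\bigr)\,d\mu_{\bar g},$$ and for $A>0$ let $\mathcal C_A=\{u\in H^1(M):\int_M e^{2u}\,d\mu_{\bar g}=A\}$. Let $A>0$ and $u_0\in\mathcal C_A$. There are constants $c_0,c_1>0$, $m_0\in\mathbb R$, $m_1>0$ and, for every $p\in\mathbb R$, constants $\nu_0(p),\nu_1(p)>0$, all depending only on $(M,\bar g)$ and $u_0$ (and, for the last two, on $p$), such that the following holds for all $T>0$ and all $f\in C^\infty(M)$. Let $$u\in C([0,T),H^1(M))\cap C^1((0,T),H^2(M))$$ be a solution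 of $$\partial_t u(t)=f-K_{g(t)}-\alpha(t)\ \text{ on }(0,T)\times M,\qquad u(0)=u_0,$$ where $g(t)=e^{2u(t)}\bar g$, $K_{g(t)}=e^{-2u(t)}(-\Delta_{\bar g}u(t)+\bar K)$ and $$\alpha(t)=\frac1A\Bigl(\int_M f e^{2u(t)}\,d\mu_{\bar g}-\bar K\Bigr).$$ Then: 1. $\int_M e^{2u(t)}\,d\mu_{\bar g}=A$, i.e. $u(t)\in\mathcal C_A$, for all $t\in[0,T)$. 2. $|\alpha(t)|\le\|f\|_{L^\infty}+|\bar K|/A$ for all $t\in[0,T)$. 3. The equation is invariant under adding a constant to $f$: for every $c\in\mathbb R$, $u$ also solves the same initial value problem with $f$ replaced by $f+c$ (in the equation and in the definition of $\alpha$). 4. $t\mapsto E_f(u(t))$ is nonincreasing on $[0,T)$; in particular $E_f(u(t))\le E_f(u_0)$ for all $t\in[0,T)$. 5. $\|\nabla u(t)\|_{L^2}^2\le c_0+c_1\|f\|_{L^\infty}$ for all $t\in[0,T)$. 6. $m_0-m_1\|f\|_{L^\infty}\le\bar u(t)\le\frac12\log A$ for all $t\in[0,T)$. 7. For every $p\in\mathbb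 R$, $\int_M e^{2pu(t)}\,d\mu_{\bar g}\le\nu_0(p)\,e^{\nu_1(p)\|f\|_{L^\infty}}$ (in particular, the integral is finite) for all $t\in[0,T)$. -/

import Mathlib

set_option linter.unusedSectionVars false

open scoped Manifold ContDiff Matrix
open MeasureTheory

noncomputable section
namespace Surface

/-- The model space of surfaces. -/
abbrev Plane : Type := EuclideanSpace ℝ (Fin 2)

/-- The standard smooth structure of the plane (its one chart is the identity). -/
instance : ChartedSpace Plane Plane := chartedSpaceSelf Plane

/-- Smooth Riemannian metrics on a smooth surface `M`. -/
abbrev Metric (M : Type*) [TopologicalSpace M] [ChartedSpace Plane M]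
    [IsManifold (𝓡 2) ∞ M] : Type _ :=
  Bundle.ContMDiffRiemannianMetric (𝓡 2) ∞ Plane (TangentSpace (𝓡 2) : M → Type _)

section Charts
variable {M : Type*} [TopologicalSpace M] [ChartedSpace Plane M] [IsManifold (𝓡 2) ∞ M]

/-- The coordinate vector field `∂ᵢ` of the chart `e`, at the point with coordinates `y`. -/
def coordVec (e : OpenPartialHomeomorph M Plane) (y : Plane) (i : Fin 2) :
    TangentSpace (𝓡 2) (e.symm y) :=
  mfderiv (𝓡 2) (𝓡 2) e.symm y (EuclideanSpace.single i (1 : ℝ))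

/-- The matrix `gᵢⱼ` of the metric in the chart `e`, as a function of the coordinates `y`. -/
def gram (g : Metric M) (e : OpenPartialHomeomorph M Plane) (y : Plane) :
    Matrix (Fin 2) (Fin 2) ℝ :=
  Matrix.of fun i j => g.inner (e.symm y) (coordVec e y i) (coordVec e y j)

/-- Partial derivative `∂ᵢ w` of a function on the plane. -/
def pd (i : Fin 2) (w : Plane → ℝ) (y : Plane) : ℝ :=
  fderiv ℝ w y (EuclideanSpace.single i (1 : ℝ))

/-- Christoffel symbol
`Γᵏᵢⱼ = ½ ∑ₗ gᵏˡ (∂ᵢ gⱼₗ + ∂ⱼ gᵢₗ - ∂ₗ gᵢⱼ)` of the Levi-Civita connection. -/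
def christoffel (g : Metric M) (e : OpenPartialHomeomorph M Plane) (k i j : Fin 2) (y : Plane) :
    ℝ :=
  (1 / 2) * ∑ l, (gram g e y)⁻¹ k l *
    (pd i (fun z => gram g e z j l) y + pd j (fun z => gram g e z i l) y
      - pd l (fun z => gram g e z i j) y)

/-- The Gauss curvature `⟨R(∂₀, ∂₁)∂₁, ∂₀⟩ / det (gᵢⱼ)` at `x`, computed in the preferred chart
at `x`; here `R(∂₀, ∂₁)∂₁ = ∑ₗ (∂₀ Γˡ₁₁ - ∂₁ Γˡ₀₁ + ∑ₘ (Γˡ₀ₘ Γᵐ₁₁ - Γˡ₁ₘ Γᵐ₀₁)) ∂ₗ`. -/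
def gaussCurvature (g : Metric M) (x : M) : ℝ :=
  let e := chartAt Plane x
  let y := e x
  let Γ := christoffel g e
  (∑ l, gram g e y 0 l *
    (pd 0 (Γ l 1 1) y - pd 1 (Γ l 0 1) y
      + ∑ m, (Γ l 0 m y * Γ m 1 1 y - Γ l 1 m y * Γ m 0 1 y))) / (gram g e y).det

/-- The components `∂ᵢ φ` of `dφ` in the chart `e`. -/
def differential (e : OpenPartialHomeomorph M Plane) (φ : M → ℝ) (y : Plane) : Fin 2 → ℝ :=
  fun i => pd i (φ ∘ e.symm) y

/-- The components `∂ᵢ∂ⱼ φ - ∑ₖ Γᵏᵢⱼ ∂ₖ φ` of the covariant Hessian `∇²φ` in the chart `e`. -/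
def hessian (g : Metric M) (e : OpenPartialHomeomorph M Plane) (φ : M → ℝ) (y : Plane) :
    Matrix (Fin 2) (Fin 2) ℝ :=
  Matrix.of fun i j =>
    pd i (pd j (φ ∘ e.symm)) y - ∑ k, christoffel g e k i j y * pd k (φ ∘ e.symm) y

/-- `⟨∇φ, ∇ψ⟩ = gⁱʲ ∂ᵢφ ∂ⱼψ` in the chart `e`. -/
def gradInnerIn (g : Metric M) (e : OpenPartialHomeomorph M Plane) (φ ψ : M → ℝ) (y : Plane) : ℝ :=
  differential e φ y ⬝ᵥ (gram g e y)⁻¹ *ᵥ differential e ψ y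

/-- `⟨∇²φ, ∇²ψ⟩ = gⁱᵏ gʲˡ (∇²φ)ᵢⱼ (∇²ψ)ₖₗ` in the chart `e`. -/
def hessInnerIn (g : Metric M) (e : OpenPartialHomeomorph M Plane) (φ ψ : M → ℝ) (y : Plane) : ℝ :=
  ((gram g e y)⁻¹ * hessian g e φ y * (gram g e y)⁻¹ * (hessian g e ψ y)ᵀ).trace

/-- `Δφ = gⁱʲ (∇²φ)ᵢⱼ`, the Laplace-Beltrami operator in the chart `e`. -/
def laplacianIn (g : Metric M) (e : OpenPartialHomeomorph M Plane) (φ : M → ℝ) (y : Plane) : ℝ :=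
  ((gram g e y)⁻¹ * hessian g e φ y).trace

variable {e e' : OpenPartialHomeomorph M Plane}

lemma contMDiffOn_coordVec (he : e ∈ atlas Plane M) (i : Fin 2) :
    ContMDiffOn (𝓡 2) (𝓡 2).tangent ∞
      (fun y => (⟨e.symm y, coordVec e y i⟩ : TangentBundle (𝓡 2) M)) e.target := by
  have h1 : ContMDiffOn (𝓡 2) (𝓡 2) ∞ e.symm e.target :=
    contMDiffOn_symm_of_mem_maximalAtlas (IsManifold.subset_maximalAtlas he)
  have h2 := h1.contMDiffOn_tangentMapWithin (m := ∞) (by simp)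
    e.open_target.uniqueMDiffOn
  have h3 : ContMDiff (𝓡 2) (𝓡 2).tangent ∞
      (fun y : Plane => (⟨y, EuclideanSpace.single i (1 : ℝ)⟩ : TangentBundle (𝓡 2) Plane)) := by
    intro y
    rw [Bundle.contMDiffAt_totalSpace]
    refine ⟨contMDiffAt_id, ?_⟩
    simpa using contMDiffAt_const
  refine (h2.comp (h3.contMDiffOn (s := e.target)) (fun y hy => hy)).congr ?_
  intro y hy
  simp only [Function.comp, tangentMapWithin, coordVec]
  rw [mfderivWithin_of_isOpen e.open_target hy]

lemma contDiffOn_gram (g : Metric M) (he : e ∈ atlas Plane M) (i j : Fin 2) :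
    ContDiffOn ℝ ∞ (fun y => gram g e y i j) e.target := by
  rw [← contMDiffOn_iff_contDiffOn]
  intro y hy
  have h := ContMDiffWithinAt.clm_bundle_apply₂ (F₁ := Plane) (F₂ := Plane) (F₃ := ℝ)
    (E₃ := Bundle.Trivial M ℝ)
    ((g.contMDiff.contMDiffAt (x := e.symm y)).comp_contMDiffWithinAt y
      (contMDiffOn_symm_of_mem_maximalAtlas (IsManifold.subset_maximalAtlas he) y hy))
    (contMDiffOn_coordVec he i y hy) (contMDiffOn_coordVec he j y hy)
  simp only [Bundle.contMDiffWithinAt_totalSpace] at h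
  exact h.2

lemma contDiffOn_comp_symm (he : e ∈ atlas Plane M) {φ : M → ℝ} (hφ : ContMDiff (𝓡 2) 𝓘(ℝ) ∞ φ) :
    ContDiffOn ℝ ∞ (φ ∘ e.symm) e.target := by
  rw [← contMDiffOn_iff_contDiffOn]
  exact hφ.comp_contMDiffOn
    (contMDiffOn_symm_of_mem_maximalAtlas (IsManifold.subset_maximalAtlas he))

lemma contDiffOn_pd {s : Set Plane} (hs : IsOpen s) (i : Fin 2) {w : Plane → ℝ}
    (hw : ContDiffOn ℝ ∞ w s) : ContDiffOn ℝ ∞ (pd i w) s :=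
  (hw.fderiv_of_isOpen hs (by simp)).clm_apply contDiffOn_const

lemma gram_symm (g : Metric M) (y : Plane) : (gram g e y)ᵀ = gram g e y := by
  ext i j
  exact g.symm _ _ _

lemma mfderiv_symm_injective (he : e ∈ atlas Plane M) {y : Plane} (hy : y ∈ e.target) :
    Function.Injective (mfderiv (𝓡 2) (𝓡 2) e.symm y) := by
  have h1 : MDifferentiableAt (𝓡 2) (𝓡 2) e.symm y :=
    ((contMDiffOn_symm_of_mem_maximalAtlas (I := 𝓡 2) (n := ∞) (IsManifold.subset_maximalAtlas he)).contMDiffAt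
      (e.open_target.mem_nhds hy)).mdifferentiableAt (by simp)
  have h2 : MDifferentiableAt (𝓡 2) (𝓡 2) e (e.symm y) :=
    ((contMDiffOn_of_mem_maximalAtlas (I := 𝓡 2) (n := ∞) (IsManifold.subset_maximalAtlas he)).contMDiffAt
      (e.open_source.mem_nhds (e.map_target hy))).mdifferentiableAt (by simp)
  have h3 : mfderiv (𝓡 2) (𝓡 2) (e ∘ e.symm) y = ContinuousLinearMap.id ℝ _ := by
    rw [← mfderiv_id (I := 𝓡 2)]
    apply Filter.EventuallyEq.mfderiv_eq
    filter_upwards [e.open_target.mem_nhds hy] with z hz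
    exact e.right_inv hz
  rw [mfderiv_comp y h2 h1] at h3
  intro v w hvw
  have hv := congrArg (fun L => L v) h3
  have hw := congrArg (fun L => L w) h3
  have : v = mfderiv (𝓡 2) (𝓡 2) e (e.symm y) (mfderiv (𝓡 2) (𝓡 2) e.symm y v) := hv.symm
  rw [this, hvw]
  exact hw

lemma gram_posDef (g : Metric M) (he : e ∈ atlas Plane M) {y : Plane} (hy : y ∈ e.target) :
    (gram g e y).PosDef := by
  refine Matrix.PosDef.of_dotProduct_mulVec_pos ?_ ?_
  · rw [Matrix.IsHermitian, Matrix.conjTranspose_eq_transpose_of_trivial]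
    exact gram_symm g y
  · intro v hv
    have h0 : (WithLp.toLp 2 v : Plane) ≠ 0 := by
      simpa using hv
    have hne : mfderiv (𝓡 2) (𝓡 2) e.symm y (WithLp.toLp 2 v : Plane) ≠ 0 := by
      intro h
      exact h0 (mfderiv_symm_injective he hy (h.trans (map_zero _).symm))
    have hpos := g.pos _ _ hne
    have hdec : (WithLp.toLp 2 v : Plane) = v 0 • EuclideanSpace.single 0 (1 : ℝ)
        + v 1 • EuclideanSpace.single 1 (1 : ℝ) := by
      ext i; fin_cases i <;> simp
    have hL : mfderiv (𝓡 2) (𝓡 2) e.symm y (WithLp.toLp 2 v : Plane)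
        = v 0 • coordVec e y 0 + v 1 • coordVec e y 1 := by
      rw [hdec]
      simp only [coordVec]
      exact (map_add _ _ _).trans (congrArg₂ _ (map_smul _ _ _) (map_smul _ _ _))
    rw [hL] at hpos
    simp only [map_add, map_smul, _root_.add_apply, _root_.smul_apply,
      smul_eq_mul] at hpos
    simp only [Matrix.mulVec, dotProduct, Fin.sum_univ_two, gram, Matrix.of_apply, star_trivial]
    linarith

/-! ### Change of chart -/

/-- Jacobian matrix of the transition map from the chart `e` to the chart `e'`. -/
def jac (e e' : OpenPartialHomeomorph M Plane) (y : Plane) : Matrix (Fin 2) (Fin 2) ℝ :=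
  Matrix.of fun a i => pd i (fun z => e' (e.symm z) a) y

lemma isOpen_overlap (e e' : OpenPartialHomeomorph M Plane) :
    IsOpen (e.target ∩ e.symm ⁻¹' e'.source) :=
  e.continuousOn_symm.isOpen_inter_preimage e.open_target e'.open_source

lemma contDiffOn_trans (he : e ∈ atlas Plane M) (he' : e' ∈ atlas Plane M) :
    ContDiffOn ℝ ∞ (fun z => e' (e.symm z)) (e.target ∩ e.symm ⁻¹' e'.source) := by
  rw [← contMDiffOn_iff_contDiffOn]
  exact (contMDiffOn_of_mem_maximalAtlas (I := 𝓡 2) (n := ∞)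
    (IsManifold.subset_maximalAtlas he')).comp
    ((contMDiffOn_symm_of_mem_maximalAtlas (I := 𝓡 2) (n := ∞)
      (IsManifold.subset_maximalAtlas he)).mono Set.inter_subset_left) (fun z hz => hz.2)

lemma contDiffOn_trans_apply (he : e ∈ atlas Plane M) (he' : e' ∈ atlas Plane M) (a : Fin 2) :
    ContDiffOn ℝ ∞ (fun z => e' (e.symm z) a) (e.target ∩ e.symm ⁻¹' e'.source) :=
  contDiffOn_euclidean.1 (contDiffOn_trans he he') a

lemma fderiv_trans_single (he : e ∈ atlas Plane M) (he' : e' ∈ atlas Plane M) {y : Plane}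
    (hy : y ∈ e.target ∩ e.symm ⁻¹' e'.source) (i : Fin 2) :
    fderiv ℝ (fun z => e' (e.symm z)) y (EuclideanSpace.single i (1 : ℝ))
      = jac e e' y 0 i • EuclideanSpace.single 0 (1 : ℝ)
        + jac e e' y 1 i • EuclideanSpace.single 1 (1 : ℝ) := by
  have hd : DifferentiableAt ℝ (fun z => e' (e.symm z)) y :=
    ((contDiffOn_trans he he').contDiffAt ((isOpen_overlap e e').mem_nhds hy)).differentiableAt
      (by simp)
  have key : ∀ a : Fin 2, jac e e' y a i
      = fderiv ℝ (fun z => e' (e.symm z)) y (EuclideanSpace.single i (1 : ℝ)) a := by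
    intro a
    have := ((EuclideanSpace.proj a : Plane →L[ℝ] ℝ).hasFDerivAt.comp y hd.hasFDerivAt).fderiv
    simp only [jac, Matrix.of_apply, pd]
    have h2 : (fun z => e' (e.symm z) a) = (EuclideanSpace.proj a : Plane →L[ℝ] ℝ) ∘
      (fun z => e' (e.symm z)) := rfl
    rw [h2, this]; rfl
  ext a
  fin_cases a <;> simp [key]

lemma pd_congr {s : Set Plane} (hs : IsOpen s) {w w' : Plane → ℝ} (h : Set.EqOn w w' s) {y : Plane}
    (hy : y ∈ s) (i : Fin 2) : pd i w y = pd i w' y := by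
  unfold pd
  rw [Filter.EventuallyEq.fderiv_eq (Filter.eventuallyEq_of_mem (hs.mem_nhds hy) h)]

lemma pd_add {w w' : Plane → ℝ} {y : Plane} (h : DifferentiableAt ℝ w y)
    (h' : DifferentiableAt ℝ w' y) (i : Fin 2) :
    pd i (fun z => w z + w' z) y = pd i w y + pd i w' y := by
  unfold pd
  rw [fderiv_fun_add h h']; rfl

lemma pd_mul {w w' : Plane → ℝ} {y : Plane} (h : DifferentiableAt ℝ w y)
    (h' : DifferentiableAt ℝ w' y) (i : Fin 2) :
    pd i (fun z => w z * w' z) y = pd i w y * w' y + w y * pd i w' y := by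
  unfold pd
  rw [fderiv_fun_mul h h']
  simp only [_root_.add_apply, _root_.smul_apply, smul_eq_mul]
  ring

lemma pd_comp_trans (he : e ∈ atlas Plane M) (he' : e' ∈ atlas Plane M) {y : Plane}
    (hy : y ∈ e.target ∩ e.symm ⁻¹' e'.source) {h : Plane → ℝ}
    (hh : DifferentiableAt ℝ h (e' (e.symm y))) (i : Fin 2) :
    pd i (fun z => h (e' (e.symm z))) y = jac e e' y 0 i * pd 0 h (e' (e.symm y))
      + jac e e' y 1 i * pd 1 h (e' (e.symm y)) := by
  have hd : DifferentiableAt ℝ (fun z => e' (e.symm z)) y :=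
    ((contDiffOn_trans he he').contDiffAt ((isOpen_overlap e e').mem_nhds hy)).differentiableAt
      (by simp)
  unfold pd
  have := (hh.hasFDerivAt.comp y hd.hasFDerivAt).fderiv
  have h2 : (fun z => h (e' (e.symm z))) = h ∘ (fun z => e' (e.symm z)) := rfl
  rw [h2, this, ContinuousLinearMap.comp_apply, fderiv_trans_single he he' hy]
  simp

lemma pd_comm {s : Set Plane} (hs : IsOpen s) {w : Plane → ℝ} (hw : ContDiffOn ℝ ∞ w s) {y : Plane}
    (hy : y ∈ s) (i j : Fin 2) : pd i (pd j w) y = pd j (pd i w) y := by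
  have hw' := hw.contDiffAt (hs.mem_nhds hy)
  have hsymm := (hw'.of_le (m := 2) (WithTop.coe_le_coe.2 le_top)).isSymmSndFDerivAt (by simp)
  have hd : DifferentiableAt ℝ (fderiv ℝ w) y :=
    ((hw.fderiv_of_isOpen hs (m := ∞) (by simp)).contDiffAt (hs.mem_nhds hy)).differentiableAt
      (by simp)
  have key : ∀ i j : Fin 2, pd i (pd j w) y = fderiv ℝ (fderiv ℝ w) y
      (EuclideanSpace.single i (1 : ℝ)) (EuclideanSpace.single j (1 : ℝ)) := by
    intro i j
    unfold pd
    rw [fderiv_clm_apply hd (by fun_prop)]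
    simp
  rw [key, key]
  exact hsymm _ _

lemma coordVec_trans (he : e ∈ atlas Plane M) (he' : e' ∈ atlas Plane M) {y : Plane}
    (hy : y ∈ e.target ∩ e.symm ⁻¹' e'.source) (i : Fin 2) :
    @Eq Plane (coordVec e y i) (jac e e' y 0 i • coordVec e' (e' (e.symm y)) 0
        + jac e e' y 1 i • coordVec e' (e' (e.symm y)) 1) := by
  have hτ : MDifferentiableAt (𝓡 2) (𝓡 2) (fun z => e' (e.symm z)) y :=
    (((contDiffOn_trans he he').contDiffAt ((isOpen_overlap e e').mem_nhds hy)).differentiableAt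
      (by simp)).mdifferentiableAt
  have h1 : MDifferentiableAt (𝓡 2) (𝓡 2) e'.symm (e' (e.symm y)) :=
    ((contMDiffOn_symm_of_mem_maximalAtlas (I := 𝓡 2) (n := ∞)
      (IsManifold.subset_maximalAtlas he')).contMDiffAt
      (e'.open_target.mem_nhds (e'.map_source hy.2))).mdifferentiableAt (by simp)
  have h3 : @Eq (Plane →L[ℝ] Plane) (mfderiv (𝓡 2) (𝓡 2) e.symm y)
      (mfderiv (𝓡 2) (𝓡 2) (e'.symm ∘ fun z => e' (e.symm z)) y) := by
    apply Filter.EventuallyEq.mfderiv_eq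
    filter_upwards [(isOpen_overlap e e').mem_nhds hy] with z hz
    exact (e'.left_inv hz.2).symm
  have h4 := mfderiv_comp y h1 hτ
  have h5 : mfderiv (𝓡 2) (𝓡 2) (fun z => e' (e.symm z)) y = fderiv ℝ (fun z => e' (e.symm z)) y :=
    mfderiv_eq_fderiv
  have h6 := fderiv_trans_single he he' hy i
  have h7 : @Eq Plane (coordVec e y i) ((mfderiv (𝓡 2) (𝓡 2) e'.symm (e' (e.symm y)))
        (mfderiv (𝓡 2) (𝓡 2) (fun z => e' (e.symm z)) y (EuclideanSpace.single i (1 : ℝ)))) :=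
    congrArg (fun L : Plane →L[ℝ] Plane => L (EuclideanSpace.single i (1 : ℝ))) (h3.trans h4)
  rw [h5] at h7
  refine h7.trans ((congrArg (mfderiv (𝓡 2) (𝓡 2) e'.symm (e' (e.symm y))) h6).trans ?_)
  exact (map_add _ _ _).trans (congrArg₂ _ (map_smul _ _ _) (map_smul _ _ _))

lemma inner_congr (g : Metric M) {x x' : M} (h : x = x') (v w : Plane) :
    g.inner x v w = g.inner x' v w := by subst h; rfl

lemma gram_trans (g : Metric M) (he : e ∈ atlas Plane M) (he' : e' ∈ atlas Plane M) {y : Plane}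
    (hy : y ∈ e.target ∩ e.symm ⁻¹' e'.source) :
    gram g e y = (jac e e' y)ᵀ * gram g e' (e' (e.symm y)) * jac e e' y := by
  ext i j
  have hx : e.symm y = e'.symm (e' (e.symm y)) := (e'.left_inv hy.2).symm
  have h1 : gram g e y i j = g.inner (e'.symm (e' (e.symm y)))
      (jac e e' y 0 i • coordVec e' (e' (e.symm y)) 0
        + jac e e' y 1 i • coordVec e' (e' (e.symm y)) 1)
      (jac e e' y 0 j • coordVec e' (e' (e.symm y)) 0
        + jac e e' y 1 j • coordVec e' (e' (e.symm y)) 1) := by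
    refine (inner_congr g hx _ _).trans ?_
    exact congrArg₂ (fun v w : Plane => g.inner (e'.symm (e' (e.symm y))) v w)
      (coordVec_trans he he' hy i) (coordVec_trans he he' hy j)
  rw [h1]
  simp only [map_add, map_smul, _root_.add_apply, _root_.smul_apply,
      smul_eq_mul, Matrix.mul_apply, Fin.sum_univ_two, Matrix.transpose_apply, gram,
      Matrix.of_apply]
  ring

lemma isUnit_det_jac (g : Metric M) (he : e ∈ atlas Plane M) (he' : e' ∈ atlas Plane M) {y : Plane}
    (hy : y ∈ e.target ∩ e.symm ⁻¹' e'.source) : IsUnit (jac e e' y).det := by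
  have h := (gram_posDef g he hy.1).det_pos
  rw [gram_trans g he he' hy, Matrix.det_mul] at h
  exact isUnit_iff_ne_zero.2 (right_ne_zero_of_mul h.ne')

lemma jac_mul_gram_inv (g : Metric M) (he : e ∈ atlas Plane M) (he' : e' ∈ atlas Plane M)
    {y : Plane} (hy : y ∈ e.target ∩ e.symm ⁻¹' e'.source) :
    jac e e' y * (gram g e y)⁻¹ * (jac e e' y)ᵀ = (gram g e' (e' (e.symm y)))⁻¹ := by
  have hJ := isUnit_det_jac g he he' hy
  have hJT : IsUnit (jac e e' y)ᵀ.det := by rwa [Matrix.det_transpose]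
  rw [gram_trans g he he' hy, Matrix.mul_inv_rev, Matrix.mul_inv_rev]
  simp only [Matrix.mul_assoc]
  rw [Matrix.nonsing_inv_mul _ hJT, Matrix.mul_one, ← Matrix.mul_assoc,
    Matrix.mul_nonsing_inv _ hJ, Matrix.one_mul]

lemma comp_symm_trans {φ : M → ℝ} :
    Set.EqOn (φ ∘ e.symm) (fun z => (φ ∘ e'.symm) (e' (e.symm z)))
      (e.target ∩ e.symm ⁻¹' e'.source) := by
  intro z hz
  simp [e'.left_inv hz.2]

lemma trans_mem_target {y : Plane} (hy : y ∈ e.target ∩ e.symm ⁻¹' e'.source) :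
    e' (e.symm y) ∈ e'.target := e'.map_source hy.2

lemma differential_trans (he : e ∈ atlas Plane M) (he' : e' ∈ atlas Plane M)
    {φ : M → ℝ} (hφ : ContMDiff (𝓡 2) 𝓘(ℝ) ∞ φ) {y : Plane}
    (hy : y ∈ e.target ∩ e.symm ⁻¹' e'.source) :
    differential e φ y = (jac e e' y)ᵀ *ᵥ differential e' φ (e' (e.symm y)) := by
  have hd : DifferentiableAt ℝ (φ ∘ e'.symm) (e' (e.symm y)) :=
    ((contDiffOn_comp_symm he' hφ).contDiffAt
      (e'.open_target.mem_nhds (trans_mem_target hy))).differentiableAt (by simp)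
  ext i
  simp only [differential]
  rw [pd_congr (isOpen_overlap e e') comp_symm_trans hy, pd_comp_trans he he' hy hd]
  simp [Matrix.mulVec, dotProduct, Fin.sum_univ_two, differential]

lemma pd_gram_trans (g : Metric M) (he : e ∈ atlas Plane M) (he' : e' ∈ atlas Plane M) {y : Plane}
    (hy : y ∈ e.target ∩ e.symm ⁻¹' e'.source) (k i j : Fin 2) :
    pd k (fun z => gram g e z i j) y = ∑ a, ∑ b,
      ((pd k (fun z => jac e e' z a i) y * jac e e' y b j
        + jac e e' y a i * pd k (fun z => jac e e' z b j) y) * gram g e' (e' (e.symm y)) a b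
        + jac e e' y a i * jac e e' y b j *
          ∑ c, jac e e' y c k * pd c (fun z => gram g e' z a b) (e' (e.symm y))) := by
  have hS := isOpen_overlap e e'
  have hG : ∀ a b, DifferentiableAt ℝ (fun z => gram g e' z a b) (e' (e.symm y)) := fun a b =>
    ((contDiffOn_gram g he' a b).contDiffAt
      (e'.open_target.mem_nhds (trans_mem_target hy))).differentiableAt (by simp)
  have hJ : ∀ a i, DifferentiableAt ℝ (fun z => jac e e' z a i) y := fun a i =>
    ((contDiffOn_pd hS i (contDiffOn_trans_apply he he' a)).contDiffAt
      (hS.mem_nhds hy)).differentiableAt (by simp)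
  have hτ : DifferentiableAt ℝ (fun z => e' (e.symm z)) y :=
    ((contDiffOn_trans he he').contDiffAt (hS.mem_nhds hy)).differentiableAt (by simp)
  have hGτ : ∀ a b, DifferentiableAt ℝ (fun z => gram g e' (e' (e.symm z)) a b) y := fun a b =>
    DifferentiableAt.comp (g := fun z => gram g e' z a b) y (hG a b) hτ
  have hE : Set.EqOn (fun z => gram g e z i j) (fun z =>
      (jac e e' z 0 i * jac e e' z 0 j * gram g e' (e' (e.symm z)) 0 0
      + jac e e' z 0 i * jac e e' z 1 j * gram g e' (e' (e.symm z)) 0 1)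
      + (jac e e' z 1 i * jac e e' z 0 j * gram g e' (e' (e.symm z)) 1 0
      + jac e e' z 1 i * jac e e' z 1 j * gram g e' (e' (e.symm z)) 1 1))
      (e.target ∩ e.symm ⁻¹' e'.source) := by
    intro z hz
    simp only [gram_trans g he he' hz, Matrix.mul_apply, Fin.sum_univ_two, Matrix.transpose_apply]
    ring
  have hterm : ∀ a b, pd k (fun z => jac e e' z a i * jac e e' z b j *
      gram g e' (e' (e.symm z)) a b) y =
      (pd k (fun z => jac e e' z a i) y * jac e e' y b j
        + jac e e' y a i * pd k (fun z => jac e e' z b j) y) * gram g e' (e' (e.symm y)) a b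
        + jac e e' y a i * jac e e' y b j *
          ∑ c, jac e e' y c k * pd c (fun z => gram g e' z a b) (e' (e.symm y)) := by
    intro a b
    rw [pd_mul ((hJ a i).fun_mul (hJ b j)) (hGτ a b), pd_mul (hJ a i) (hJ b j),
      pd_comp_trans he he' hy (hG a b), Fin.sum_univ_two]
  have hdt : ∀ a b, DifferentiableAt ℝ (fun z => jac e e' z a i * jac e e' z b j *
      gram g e' (e' (e.symm z)) a b) y := fun a b => ((hJ a i).fun_mul (hJ b j)).fun_mul (hGτ a b)
  rw [pd_congr hS hE hy, pd_add ((hdt 0 0).fun_add (hdt 0 1)) ((hdt 1 0).fun_add (hdt 1 1)),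
    pd_add (hdt 0 0) (hdt 0 1), pd_add (hdt 1 0) (hdt 1 1)]
  simp only [hterm]
  simp only [Fin.sum_univ_two]

lemma pd_pd_trans (he : e ∈ atlas Plane M) (he' : e' ∈ atlas Plane M)
    {φ : M → ℝ} (hφ : ContMDiff (𝓡 2) 𝓘(ℝ) ∞ φ) {y : Plane}
    (hy : y ∈ e.target ∩ e.symm ⁻¹' e'.source) (i j : Fin 2) :
    pd i (pd j (φ ∘ e.symm)) y = ∑ a,
      (pd i (fun z => jac e e' z a j) y * pd a (φ ∘ e'.symm) (e' (e.symm y))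
        + jac e e' y a j * ∑ c, jac e e' y c i * pd c (pd a (φ ∘ e'.symm)) (e' (e.symm y))) := by
  have hS := isOpen_overlap e e'
  have hw : ∀ a, DifferentiableAt ℝ (pd a (φ ∘ e'.symm)) (e' (e.symm y)) := fun a =>
    ((contDiffOn_pd e'.open_target a (contDiffOn_comp_symm he' hφ)).contDiffAt
      (e'.open_target.mem_nhds (trans_mem_target hy))).differentiableAt (by simp)
  have hJ : ∀ a i, DifferentiableAt ℝ (fun z => jac e e' z a i) y := fun a i =>
    ((contDiffOn_pd hS i (contDiffOn_trans_apply he he' a)).contDiffAt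
      (hS.mem_nhds hy)).differentiableAt (by simp)
  have hτ : DifferentiableAt ℝ (fun z => e' (e.symm z)) y :=
    ((contDiffOn_trans he he').contDiffAt (hS.mem_nhds hy)).differentiableAt (by simp)
  have hwτ : ∀ a, DifferentiableAt ℝ (fun z => pd a (φ ∘ e'.symm) (e' (e.symm z))) y := fun a =>
    DifferentiableAt.comp (g := pd a (φ ∘ e'.symm)) y (hw a) hτ
  have hE : Set.EqOn (pd j (φ ∘ e.symm)) (fun z =>
      jac e e' z 0 j * pd 0 (φ ∘ e'.symm) (e' (e.symm z))
      + jac e e' z 1 j * pd 1 (φ ∘ e'.symm) (e' (e.symm z)))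
      (e.target ∩ e.symm ⁻¹' e'.source) := by
    intro z hz
    have := congrFun (differential_trans he he' hφ hz) j
    simpa [Matrix.mulVec, dotProduct, Fin.sum_univ_two, differential] using this
  rw [pd_congr hS hE hy, pd_add ((hJ 0 j).fun_mul (hwτ 0)) ((hJ 1 j).fun_mul (hwτ 1)),
    pd_mul (hJ 0 j) (hwτ 0), pd_mul (hJ 1 j) (hwτ 1), pd_comp_trans he he' hy (hw 0),
    pd_comp_trans he he' hy (hw 1)]
  simp only [Fin.sum_univ_two]

lemma hessian_apply (g : Metric M) (φ : M → ℝ) (y : Plane) (i j : Fin 2) :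
    hessian g e φ y i j = pd i (pd j (φ ∘ e.symm)) y
      - (1 / 2) * ∑ l, ((gram g e y)⁻¹ *ᵥ differential e φ y) l *
        (pd i (fun z => gram g e z j l) y + pd j (fun z => gram g e z i l) y
          - pd l (fun z => gram g e z i j) y) := by
  have hs : ∀ k l, (gram g e y)⁻¹ k l = (gram g e y)⁻¹ l k := by
    intro k l
    conv_lhs => rw [← gram_symm (e := e) g y, ← Matrix.transpose_nonsing_inv, Matrix.transpose_apply]
  simp only [hessian, Matrix.of_apply, christoffel, Matrix.mulVec, dotProduct, Fin.sum_univ_two,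
    differential]
  rw [hs 1 0]
  ring

lemma hessian_trans (g : Metric M) (he : e ∈ atlas Plane M) (he' : e' ∈ atlas Plane M)
    {φ : M → ℝ} (hφ : ContMDiff (𝓡 2) 𝓘(ℝ) ∞ φ) {y : Plane}
    (hy : y ∈ e.target ∩ e.symm ⁻¹' e'.source) :
    hessian g e φ y = (jac e e' y)ᵀ * hessian g e' φ (e' (e.symm y)) * jac e e' y := by
  have hS := isOpen_overlap e e'
  set V := (gram g e y)⁻¹ *ᵥ differential e φ y with hV
  set V' := (gram g e' (e' (e.symm y)))⁻¹ *ᵥ differential e' φ (e' (e.symm y)) with hV'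
  have h1 : V' = jac e e' y *ᵥ V := by
    rw [hV, differential_trans he he' hφ hy, hV', ← jac_mul_gram_inv g he he' hy]
    simp only [Matrix.mulVec_mulVec, Matrix.mul_assoc]
  have h2 : differential e' φ (e' (e.symm y)) = gram g e' (e' (e.symm y)) *ᵥ V' := by
    rw [hV', Matrix.mulVec_mulVec, Matrix.mul_nonsing_inv, Matrix.one_mulVec]
    exact (gram_posDef g he' (trans_mem_target hy)).det_pos.ne'.isUnit
  rw [h1] at h2
  have hT : ∀ a k i, pd k (fun z => jac e e' z a i) y = pd i (fun z => jac e e' z a k) y :=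
    fun a k i => pd_comm hS (contDiffOn_trans_apply he he' a) hy k i
  have hGs : ∀ z, gram g e' z 1 0 = gram g e' z 0 1 := fun z =>
    congrFun (congrFun (gram_symm (e := e') g z) 0) 1
  have hd0 := congrFun h2 0
  have hd1 := congrFun h2 1
  have hv0 := congrFun h1 0
  have hv1 := congrFun h1 1
  simp only [differential, Matrix.mulVec, dotProduct, Fin.sum_univ_two] at hd0 hd1
  simp only [Matrix.mulVec, dotProduct, Fin.sum_univ_two] at hv0 hv1
  ext i j
  simp only [Matrix.mul_apply, Matrix.transpose_apply, Fin.sum_univ_two]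
  simp only [hessian_apply, ← hV, ← hV', pd_gram_trans g he he' hy, pd_pd_trans he he' hφ hy]
  simp only [Fin.sum_univ_two, hv0, hv1, hd0, hd1, hGs]
  fin_cases i <;> fin_cases j <;> simp only [Fin.zero_eta, Fin.mk_one, Fin.isValue, hT 0 1 0, hT 1 1 0] <;> ring

lemma gradInnerIn_trans (g : Metric M) (he : e ∈ atlas Plane M) (he' : e' ∈ atlas Plane M)
    {φ ψ : M → ℝ} (hφ : ContMDiff (𝓡 2) 𝓘(ℝ) ∞ φ) (hψ : ContMDiff (𝓡 2) 𝓘(ℝ) ∞ ψ) {y : Plane}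
    (hy : y ∈ e.target ∩ e.symm ⁻¹' e'.source) :
    gradInnerIn g e φ ψ y = gradInnerIn g e' φ ψ (e' (e.symm y)) := by
  unfold gradInnerIn
  rw [differential_trans he he' hφ hy, differential_trans he he' hψ hy,
    ← jac_mul_gram_inv g he he' hy, Matrix.mulVec_transpose, ← Matrix.dotProduct_mulVec,
    Matrix.mulVec_mulVec, Matrix.mulVec_mulVec]

lemma hessInnerIn_trans (g : Metric M) (he : e ∈ atlas Plane M) (he' : e' ∈ atlas Plane M)
    {φ ψ : M → ℝ} (hφ : ContMDiff (𝓡 2) 𝓘(ℝ) ∞ φ) (hψ : ContMDiff (𝓡 2) 𝓘(ℝ) ∞ ψ) {y : Plane}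
    (hy : y ∈ e.target ∩ e.symm ⁻¹' e'.source) :
    hessInnerIn g e φ ψ y = hessInnerIn g e' φ ψ (e' (e.symm y)) := by
  unfold hessInnerIn
  rw [hessian_trans g he he' hφ hy, hessian_trans g he he' hψ hy,
    ← jac_mul_gram_inv g he he' hy]
  simp only [Matrix.transpose_mul, Matrix.transpose_transpose]
  simp only [Matrix.mul_assoc]
  rw [Matrix.trace_mul_comm (jac e e' y)]
  simp only [Matrix.mul_assoc]

lemma laplacianIn_trans (g : Metric M) (he : e ∈ atlas Plane M) (he' : e' ∈ atlas Plane M)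
    {φ : M → ℝ} (hφ : ContMDiff (𝓡 2) 𝓘(ℝ) ∞ φ) {y : Plane}
    (hy : y ∈ e.target ∩ e.symm ⁻¹' e'.source) :
    laplacianIn g e φ y = laplacianIn g e' φ (e' (e.symm y)) := by
  unfold laplacianIn
  rw [hessian_trans g he he' hφ hy, ← jac_mul_gram_inv g he he' hy]
  simp only [Matrix.mul_assoc]
  rw [Matrix.trace_mul_comm (jac e e' y)]
  simp only [Matrix.mul_assoc]

lemma continuousOn_gram_inv (g : Metric M) (he : e ∈ atlas Plane M) :
    ContinuousOn (fun y => (gram g e y)⁻¹) e.target := by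
  have h : ContinuousOn (fun y => gram g e y) e.target :=
    continuousOn_pi.2 fun i => continuousOn_pi.2 fun j => (contDiffOn_gram g he i j).continuousOn
  have hdet : ContinuousOn (fun y => (gram g e y).det) e.target :=
    (Continuous.matrix_det continuous_id).comp_continuousOn h
  have hadj : ContinuousOn (fun y => (gram g e y).adjugate) e.target :=
    (Continuous.matrix_adjugate continuous_id).comp_continuousOn h
  refine ((hdet.inv₀ fun y hy => (gram_posDef g he hy).det_pos.ne').smul hadj).congr ?_
  intro y hy
  simp [Matrix.inv_def]

lemma continuousOn_differential (he : e ∈ atlas Plane M) {φ : M → ℝ}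
    (hφ : ContMDiff (𝓡 2) 𝓘(ℝ) ∞ φ) : ContinuousOn (differential e φ) e.target :=
  continuousOn_pi.2 fun i =>
    (contDiffOn_pd e.open_target i (contDiffOn_comp_symm he hφ)).continuousOn

lemma continuousOn_hessian (g : Metric M) (he : e ∈ atlas Plane M) {φ : M → ℝ}
    (hφ : ContMDiff (𝓡 2) 𝓘(ℝ) ∞ φ) : ContinuousOn (hessian g e φ) e.target := by
  have hP : ∀ k l, ContinuousOn (fun y => (gram g e y)⁻¹ k l) e.target := fun k l =>
    continuousOn_pi.1 (continuousOn_pi.1 (continuousOn_gram_inv g he) k) l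
  have hG : ∀ k i j, ContinuousOn (pd k (fun z => gram g e z i j)) e.target := fun k i j =>
    (contDiffOn_pd e.open_target k (contDiffOn_gram g he i j)).continuousOn
  have hw := contDiffOn_comp_symm he hφ
  have hΓ : ∀ k i j, ContinuousOn (christoffel g e k i j) e.target := fun k i j =>
    continuousOn_const.mul (continuousOn_finsetSum _ fun l _ =>
      (hP k l).mul (((hG i j l).add (hG j i l)).sub (hG l i j)))
  refine continuousOn_pi.2 fun i => continuousOn_pi.2 fun j => ?_
  exact (contDiffOn_pd e.open_target i (contDiffOn_pd e.open_target j hw)).continuousOn.sub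
    (continuousOn_finsetSum _ fun k _ =>
      (hΓ k i j).mul (contDiffOn_pd e.open_target k hw).continuousOn)

lemma differential_add (he : e ∈ atlas Plane M) {φ ψ : M → ℝ} (hφ : ContMDiff (𝓡 2) 𝓘(ℝ) ∞ φ)
    (hψ : ContMDiff (𝓡 2) 𝓘(ℝ) ∞ ψ) {y : Plane} (hy : y ∈ e.target) :
    differential e (φ + ψ) y = differential e φ y + differential e ψ y := by
  ext i
  exact pd_add (((contDiffOn_comp_symm he hφ).contDiffAt
    (e.open_target.mem_nhds hy)).differentiableAt (by simp))
    (((contDiffOn_comp_symm he hψ).contDiffAt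
    (e.open_target.mem_nhds hy)).differentiableAt (by simp)) i

lemma pd_const_mul (c : ℝ) (w : Plane → ℝ) (i : Fin 2) (y : Plane) :
    pd i (fun z => c * w z) y = c * pd i w y := by
  unfold pd
  have : (fun z => c * w z) = c • w := rfl
  rw [this, fderiv_const_smul_field]
  simp

lemma differential_smul (c : ℝ) (φ : M → ℝ) (y : Plane) :
    differential e (c • φ) y = c • differential e φ y := by
  ext i
  exact pd_const_mul c (φ ∘ e.symm) i y

lemma hessian_add (g : Metric M) (he : e ∈ atlas Plane M) {φ ψ : M → ℝ}
    (hφ : ContMDiff (𝓡 2) 𝓘(ℝ) ∞ φ) (hψ : ContMDiff (𝓡 2) 𝓘(ℝ) ∞ ψ) {y : Plane}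
    (hy : y ∈ e.target) : hessian g e (φ + ψ) y = hessian g e φ y + hessian g e ψ y := by
  have hd : ∀ k, ∀ {χ : M → ℝ}, ContMDiff (𝓡 2) 𝓘(ℝ) ∞ χ →
      DifferentiableAt ℝ (pd k (χ ∘ e.symm)) y := fun k χ hχ =>
    ((contDiffOn_pd e.open_target k (contDiffOn_comp_symm he hχ)).contDiffAt
    (e.open_target.mem_nhds hy)).differentiableAt (by simp)
  have h1 : ∀ k, Set.EqOn (pd k ((φ + ψ) ∘ e.symm))
      (fun z => pd k (φ ∘ e.symm) z + pd k (ψ ∘ e.symm) z) e.target := fun k z hz =>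
    congrFun (differential_add he hφ hψ hz) k
  ext i j
  simp only [hessian, Matrix.of_apply, Matrix.add_apply, h1 _ hy, Fin.sum_univ_two]
  rw [pd_congr e.open_target (h1 j) hy, pd_add (hd j hφ) (hd j hψ)]
  ring

lemma hessian_smul (g : Metric M) (c : ℝ) (φ : M → ℝ) (y : Plane) :
    hessian g e (c • φ) y = c • hessian g e φ y := by
  have h1 : ∀ k, pd k ((c • φ) ∘ e.symm) = fun z => c * pd k (φ ∘ e.symm) z := fun k => by
    ext z; exact congrFun (differential_smul c φ z) k
  ext i j
  simp only [hessian, Matrix.of_apply, Matrix.smul_apply, h1, Fin.sum_univ_two, pd_const_mul,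
    smul_eq_mul]
  ring

end Charts

section Global
variable {M : Type*} [TopologicalSpace M] [ChartedSpace Plane M] [IsManifold (𝓡 2) ∞ M]

/-- The function `⟨∇φ, ∇ψ⟩` on `M`. It can be computed in any chart, see `gradInner_eq`. -/
def gradInner (g : Metric M) (φ ψ : M → ℝ) (x : M) : ℝ :=
  gradInnerIn g (chartAt Plane x) φ ψ (chartAt Plane x x)

/-- The function `⟨∇²φ, ∇²ψ⟩` on `M`. It can be computed in any chart, see `hessInner_eq`. -/
def hessInner (g : Metric M) (φ ψ : M → ℝ) (x : M) : ℝ :=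
  hessInnerIn g (chartAt Plane x) φ ψ (chartAt Plane x x)

/-- The Laplacian `Δφ` of a smooth function. It can be computed in any chart, see `laplacian_eq`. -/
def laplacian (g : Metric M) (φ : M → ℝ) (x : M) : ℝ :=
  laplacianIn g (chartAt Plane x) φ (chartAt Plane x x)

variable {e : OpenPartialHomeomorph M Plane}

lemma mem_overlap {x : M} (hx : x ∈ e.source) :
    chartAt Plane x x ∈ (chartAt Plane x).target ∩ (chartAt Plane x).symm ⁻¹' e.source :=
  ⟨mem_chart_target Plane x, by simpa using hx⟩

lemma gradInner_eq (g : Metric M) (he : e ∈ atlas Plane M) {φ ψ : M → ℝ}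
    (hφ : ContMDiff (𝓡 2) 𝓘(ℝ) ∞ φ) (hψ : ContMDiff (𝓡 2) 𝓘(ℝ) ∞ ψ) {x : M} (hx : x ∈ e.source) :
    gradInner g φ ψ x = gradInnerIn g e φ ψ (e x) := by
  unfold gradInner
  rw [gradInnerIn_trans g (chart_mem_atlas Plane x) he hφ hψ (mem_overlap hx)]
  simp

lemma hessInner_eq (g : Metric M) (he : e ∈ atlas Plane M) {φ ψ : M → ℝ}
    (hφ : ContMDiff (𝓡 2) 𝓘(ℝ) ∞ φ) (hψ : ContMDiff (𝓡 2) 𝓘(ℝ) ∞ ψ) {x : M} (hx : x ∈ e.source) :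
    hessInner g φ ψ x = hessInnerIn g e φ ψ (e x) := by
  unfold hessInner
  rw [hessInnerIn_trans g (chart_mem_atlas Plane x) he hφ hψ (mem_overlap hx)]
  simp

lemma laplacian_eq (g : Metric M) (he : e ∈ atlas Plane M) {φ : M → ℝ}
    (hφ : ContMDiff (𝓡 2) 𝓘(ℝ) ∞ φ) {x : M} (hx : x ∈ e.source) :
    laplacian g φ x = laplacianIn g e φ (e x) := by
  unfold laplacian
  rw [laplacianIn_trans g (chart_mem_atlas Plane x) he hφ (mem_overlap hx)]
  simp

lemma continuous_of_charts {F : M → ℝ} (G : OpenPartialHomeomorph M Plane → Plane → ℝ)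
    (hG : ∀ e ∈ atlas Plane M, ContinuousOn (G e) e.target)
    (hF : ∀ e ∈ atlas Plane M, ∀ x ∈ e.source, F x = G e (e x)) : Continuous F := by
  refine continuous_iff_continuousAt.2 fun x => ?_
  have he := chart_mem_atlas Plane x
  have h1 : ContinuousOn (fun z => G (chartAt Plane x) (chartAt Plane x z))
      (chartAt Plane x).source :=
    (hG _ he).comp (chartAt Plane x).continuousOn (chartAt Plane x).mapsTo
  exact (h1.congr fun z hz => hF _ he z hz).continuousAt
    ((chartAt Plane x).open_source.mem_nhds (mem_chart_source Plane x))

lemma continuous_gradInner (g : Metric M) {φ ψ : M → ℝ}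
    (hφ : ContMDiff (𝓡 2) 𝓘(ℝ) ∞ φ) (hψ : ContMDiff (𝓡 2) 𝓘(ℝ) ∞ ψ) :
    Continuous (gradInner g φ ψ) := by
  refine continuous_of_charts (fun e => gradInnerIn g e φ ψ) (fun e he => ?_)
    (fun e he x hx => gradInner_eq g he hφ hψ hx)
  have hP := continuousOn_gram_inv g he
  have h1 := continuousOn_differential he hφ
  have h2 := continuousOn_differential he hψ
  have hc : Continuous (fun p : (Fin 2 → ℝ) × Matrix (Fin 2) (Fin 2) ℝ × (Fin 2 → ℝ) =>
      p.1 ⬝ᵥ p.2.1 *ᵥ p.2.2) :=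
    continuous_fst.dotProduct ((continuous_fst.comp continuous_snd).matrix_mulVec
      (continuous_snd.comp continuous_snd))
  exact hc.comp_continuousOn (h1.prodMk (hP.prodMk h2))

lemma continuous_hessInner (g : Metric M) {φ ψ : M → ℝ}
    (hφ : ContMDiff (𝓡 2) 𝓘(ℝ) ∞ φ) (hψ : ContMDiff (𝓡 2) 𝓘(ℝ) ∞ ψ) :
    Continuous (hessInner g φ ψ) := by
  refine continuous_of_charts (fun e => hessInnerIn g e φ ψ) (fun e he => ?_)
    (fun e he x hx => hessInner_eq g he hφ hψ hx)
  have hP := continuousOn_gram_inv g he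
  have h1 := continuousOn_hessian g he hφ
  have h2 := continuousOn_hessian g he hψ
  rw [continuousOn_iff_continuous_domRestrict] at hP h1 h2 ⊢
  exact (((hP.matrix_mul h1).matrix_mul hP).matrix_mul h2.matrix_transpose).matrix_trace

lemma continuous_laplacian (g : Metric M) {φ : M → ℝ} (hφ : ContMDiff (𝓡 2) 𝓘(ℝ) ∞ φ) :
    Continuous (laplacian g φ) := by
  refine continuous_of_charts (fun e => laplacianIn g e φ) (fun e he => ?_)
    (fun e he x hx => laplacian_eq g he hφ hx)
  have hP := continuousOn_gram_inv g he
  have h1 := continuousOn_hessian g he hφ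
  rw [continuousOn_iff_continuous_domRestrict] at hP h1 ⊢
  exact (hP.matrix_mul h1).matrix_trace

open scoped MatrixOrder in
lemma exists_gram_inv_eq (g : Metric M) (x : M) : ∃ S : Matrix (Fin 2) (Fin 2) ℝ,
    (gram g (chartAt Plane x) (chartAt Plane x x))⁻¹ = Sᵀ * S := by
  have h := (gram_posDef g (chart_mem_atlas Plane x) (mem_chart_target Plane x)).inv.posSemidef
  obtain ⟨S, hS⟩ := CStarAlgebra.nonneg_iff_eq_star_mul_self.1 h.nonneg
  exact ⟨S, by rw [hS, Matrix.star_eq_conjTranspose, Matrix.conjTranspose_eq_transpose_of_trivial]⟩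

lemma gradInner_self_nonneg (g : Metric M) (φ : M → ℝ) (x : M) : 0 ≤ gradInner g φ φ x := by
  obtain ⟨S, hS⟩ := exists_gram_inv_eq g x
  unfold gradInner gradInnerIn
  rw [hS, ← Matrix.mulVec_mulVec, Matrix.dotProduct_mulVec, Matrix.vecMul_transpose]
  exact Finset.sum_nonneg fun i _ => mul_self_nonneg _

lemma gradInner_comm (g : Metric M) (φ ψ : M → ℝ) (x : M) :
    gradInner g φ ψ x = gradInner g ψ φ x := by
  obtain ⟨S, hS⟩ := exists_gram_inv_eq g x
  unfold gradInner gradInnerIn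
  rw [hS]
  simp only [← Matrix.mulVec_mulVec, Matrix.dotProduct_mulVec _ Sᵀ, Matrix.vecMul_transpose]
  exact dotProduct_comm _ _

lemma hessInner_eq_frob (P S H K : Matrix (Fin 2) (Fin 2) ℝ) (hS : P = Sᵀ * S) :
    (P * H * P * Kᵀ).trace = ((S * H * Sᵀ) * (S * K * Sᵀ)ᵀ).trace := by
  subst hS
  simp only [Matrix.transpose_mul, Matrix.transpose_transpose, Matrix.mul_assoc]
  rw [Matrix.trace_mul_comm Sᵀ]
  simp only [Matrix.mul_assoc]

lemma hessInner_self_nonneg (g : Metric M) (φ : M → ℝ) (x : M) : 0 ≤ hessInner g φ φ x := by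
  obtain ⟨S, hS⟩ := exists_gram_inv_eq g x
  unfold hessInner hessInnerIn
  rw [hessInner_eq_frob _ S _ _ hS]
  simp only [Matrix.trace, Matrix.diag, Matrix.mul_apply, Matrix.transpose_apply]
  exact Finset.sum_nonneg fun i _ => Finset.sum_nonneg fun j _ => mul_self_nonneg _

lemma hessInner_comm (g : Metric M) (φ ψ : M → ℝ) (x : M) :
    hessInner g φ ψ x = hessInner g ψ φ x := by
  obtain ⟨S, hS⟩ := exists_gram_inv_eq g x
  unfold hessInner hessInnerIn
  rw [hessInner_eq_frob _ S _ _ hS, hessInner_eq_frob _ S _ _ hS, ← Matrix.trace_transpose]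
  simp only [Matrix.transpose_mul, Matrix.transpose_transpose]

lemma laplacian_sq_le (g : Metric M) (φ : M → ℝ) (x : M) :
    laplacian g φ x ^ 2 ≤ 2 * hessInner g φ φ x := by
  obtain ⟨S, hS⟩ := exists_gram_inv_eq g x
  unfold hessInner hessInnerIn laplacian laplacianIn
  rw [hessInner_eq_frob _ S _ _ hS, hS]
  have : (Sᵀ * S * hessian g (chartAt Plane x) φ (chartAt Plane x x)).trace
      = (S * hessian g (chartAt Plane x) φ (chartAt Plane x x) * Sᵀ).trace := by
    rw [Matrix.mul_assoc, Matrix.trace_mul_comm]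
  rw [this]
  generalize S * hessian g (chartAt Plane x) φ (chartAt Plane x x) * Sᵀ = K
  simp only [Matrix.trace, Matrix.diag, Matrix.mul_apply, Matrix.transpose_apply, Fin.sum_univ_two]
  nlinarith [sq_nonneg (K 0 0 - K 1 1), sq_nonneg (K 0 1), sq_nonneg (K 1 0)]

lemma gradInner_add (g : Metric M) {φ φ' : M → ℝ} (hφ : ContMDiff (𝓡 2) 𝓘(ℝ) ∞ φ)
    (hφ' : ContMDiff (𝓡 2) 𝓘(ℝ) ∞ φ') (ψ : M → ℝ) (x : M) :
    gradInner g (φ + φ') ψ x = gradInner g φ ψ x + gradInner g φ' ψ x := by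
  unfold gradInner gradInnerIn
  rw [differential_add (chart_mem_atlas Plane x) hφ hφ' (mem_chart_target Plane x), add_dotProduct]

lemma gradInner_smul (g : Metric M) (c : ℝ) (φ ψ : M → ℝ) (x : M) :
    gradInner g (c • φ) ψ x = c * gradInner g φ ψ x := by
  unfold gradInner gradInnerIn
  rw [differential_smul, smul_dotProduct, smul_eq_mul]

lemma hessInner_add (g : Metric M) {φ φ' : M → ℝ} (hφ : ContMDiff (𝓡 2) 𝓘(ℝ) ∞ φ)
    (hφ' : ContMDiff (𝓡 2) 𝓘(ℝ) ∞ φ') (ψ : M → ℝ) (x : M) :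
    hessInner g (φ + φ') ψ x = hessInner g φ ψ x + hessInner g φ' ψ x := by
  unfold hessInner hessInnerIn
  rw [hessian_add g (chart_mem_atlas Plane x) hφ hφ' (mem_chart_target Plane x)]
  simp only [Matrix.mul_add, Matrix.add_mul, Matrix.trace_add]

lemma hessInner_smul (g : Metric M) (c : ℝ) (φ ψ : M → ℝ) (x : M) :
    hessInner g (c • φ) ψ x = c * hessInner g φ ψ x := by
  unfold hessInner hessInnerIn
  rw [hessian_smul]
  simp only [Matrix.mul_smul, Matrix.smul_mul, Matrix.trace_smul, smul_eq_mul]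

lemma laplacian_add (g : Metric M) {φ φ' : M → ℝ} (hφ : ContMDiff (𝓡 2) 𝓘(ℝ) ∞ φ)
    (hφ' : ContMDiff (𝓡 2) 𝓘(ℝ) ∞ φ') (x : M) :
    laplacian g (φ + φ') x = laplacian g φ x + laplacian g φ' x := by
  unfold laplacian laplacianIn
  rw [hessian_add g (chart_mem_atlas Plane x) hφ hφ' (mem_chart_target Plane x)]
  simp only [Matrix.mul_add, Matrix.trace_add]

lemma laplacian_smul (g : Metric M) (c : ℝ) (φ : M → ℝ) (x : M) :
    laplacian g (c • φ) x = c * laplacian g φ x := by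
  unfold laplacian laplacianIn
  rw [hessian_smul]
  simp only [Matrix.mul_smul, Matrix.trace_smul, smul_eq_mul]

end Global

section Measure
variable {M : Type*} [TopologicalSpace M] [ChartedSpace Plane M] [IsManifold (𝓡 2) ∞ M]
  [MeasurableSpace M]

/-- The Riemannian measure of `g`: the least measure which on the domain of every chart `e` is at
least `√(det gᵢⱼ) dy`. As these chart measures agree on overlaps, it coincides with each of them on
the domain of the chart (if countably many charts cover `M`). -/
def vol (g : Metric M) : Measure M :=
  ⨆ e ∈ atlas Plane M, Measure.map e.symm
    ((volume.restrict e.target).withDensity fun y => ENNReal.ofReal (√(gram g e y).det))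

end Measure

section PreHilbert
variable {V : Type*} [AddCommGroup V] [Module ℝ V]

/-- The vector space `V` with the pre-Hilbert structure given by the form `B`. -/
def WithForm (B : LinearMap.BilinForm ℝ V) (_hB : B.IsPosSemidef) : Type _ := V

variable (B : LinearMap.BilinForm ℝ V) (hB : B.IsPosSemidef)

instance : AddCommGroup (WithForm B hB) := inferInstanceAs (AddCommGroup V)

instance : Module ℝ (WithForm B hB) := inferInstanceAs (Module ℝ V)

/-- The identity map `V → WithForm B hB`. -/
def WithForm.of : V ≃ₗ[ℝ] WithForm B hB := LinearEquiv.refl ℝ V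

/-- The inner product of `WithForm B hB` is `B`. -/
@[reducible] def WithForm.core : PreInnerProductSpace.Core ℝ (WithForm B hB) where
  inner φ ψ := B ((WithForm.of B hB).symm φ) ((WithForm.of B hB).symm ψ)
  conj_inner_symm φ ψ := by simpa using hB.isSymm.eq _ _
  re_inner_nonneg φ := by simpa using hB.isNonneg.nonneg _
  add_left φ ψ χ := by simp
  smul_left φ ψ c := by simp

instance : SeminormedAddCommGroup (WithForm B hB) :=
  @InnerProductSpace.Core.toSeminormedAddCommGroup ℝ _ _ _ _ (WithForm.core B hB)

instance : InnerProductSpace ℝ (WithForm B hB) := InnerProductSpace.ofCore (WithForm.core B hB)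

lemma WithForm.norm_sq (φ : V) : ‖WithForm.of B hB φ‖ ^ 2 = B φ φ := by
  rw [← real_inner_self_eq_norm_sq]; rfl

end PreHilbert

section Sobolev
variable {M : Type*} [TopologicalSpace M] [ChartedSpace Plane M] [IsManifold (𝓡 2) ∞ M]
  [CompactSpace M] [MeasurableSpace M] [BorelSpace M] (g : Metric M) [IsFiniteMeasure (vol g)]

lemma integrable_of_continuous {F : M → ℝ} (hF : Continuous F) : Integrable F (vol g) :=
  hF.integrable_of_hasCompactSupport (HasCompactSupport.of_compactSpace F)

/-- `∫ φ ψ dμ` -/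
def l2Form : LinearMap.BilinForm ℝ C^∞⟮𝓡 2, M; ℝ⟯ :=
  LinearMap.mk₂ ℝ (fun φ ψ => ∫ x, φ x * ψ x ∂(vol g))
    (fun φ φ' ψ => by
      have h := fun χ : C^∞⟮𝓡 2, M; ℝ⟯ => integrable_of_continuous g
        (χ.contMDiff.continuous.fun_mul ψ.contMDiff.continuous)
      rw [← integral_add (h φ) (h φ')]
      exact integral_congr_ae (.of_forall fun x => add_mul (φ x) (φ' x) (ψ x)))
    (fun c φ ψ => by
      rw [smul_eq_mul, ← integral_const_mul]
      exact integral_congr_ae (.of_forall fun x => mul_assoc c (φ x) (ψ x)))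
    (fun ψ φ φ' => by
      have h := fun χ : C^∞⟮𝓡 2, M; ℝ⟯ => integrable_of_continuous g
        (ψ.contMDiff.continuous.fun_mul χ.contMDiff.continuous)
      rw [← integral_add (h φ) (h φ')]
      exact integral_congr_ae (.of_forall fun x => mul_add (ψ x) (φ x) (φ' x)))
    (fun c ψ φ => by
      rw [smul_eq_mul, ← integral_const_mul]
      exact integral_congr_ae (.of_forall fun x => mul_left_comm (ψ x) c (φ x)))

/-- `∫ ⟨∇φ, ∇ψ⟩ dμ` -/
def gradForm : LinearMap.BilinForm ℝ C^∞⟮𝓡 2, M; ℝ⟯ :=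
  LinearMap.mk₂ ℝ (fun φ ψ => ∫ x, gradInner g φ ψ x ∂(vol g))
    (fun φ φ' ψ => by
      have h := fun χ : C^∞⟮𝓡 2, M; ℝ⟯ => integrable_of_continuous g
        (continuous_gradInner g χ.contMDiff ψ.contMDiff)
      rw [← integral_add (h φ) (h φ')]
      exact integral_congr_ae (.of_forall (gradInner_add g φ.contMDiff φ'.contMDiff ψ)))
    (fun c φ ψ => by
      rw [smul_eq_mul, ← integral_const_mul]
      exact integral_congr_ae (.of_forall (gradInner_smul g c φ ψ)))
    (fun ψ φ φ' => by
      have h := fun χ : C^∞⟮𝓡 2, M; ℝ⟯ => integrable_of_continuous g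
        (continuous_gradInner g χ.contMDiff ψ.contMDiff)
      simp only [gradInner_comm g ψ]
      rw [← integral_add (h φ) (h φ')]
      exact integral_congr_ae (.of_forall (gradInner_add g φ.contMDiff φ'.contMDiff ψ)))
    (fun c ψ φ => by
      simp only [gradInner_comm g ψ]
      rw [smul_eq_mul, ← integral_const_mul]
      exact integral_congr_ae (.of_forall (gradInner_smul g c φ ψ)))

/-- `∫ ⟨∇²φ, ∇²ψ⟩ dμ` -/
def hessForm : LinearMap.BilinForm ℝ C^∞⟮𝓡 2, M; ℝ⟯ :=
  LinearMap.mk₂ ℝ (fun φ ψ => ∫ x, hessInner g φ ψ x ∂(vol g))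
    (fun φ φ' ψ => by
      have h := fun χ : C^∞⟮𝓡 2, M; ℝ⟯ => integrable_of_continuous g
        (continuous_hessInner g χ.contMDiff ψ.contMDiff)
      rw [← integral_add (h φ) (h φ')]
      exact integral_congr_ae (.of_forall (hessInner_add g φ.contMDiff φ'.contMDiff ψ)))
    (fun c φ ψ => by
      rw [smul_eq_mul, ← integral_const_mul]
      exact integral_congr_ae (.of_forall (hessInner_smul g c φ ψ)))
    (fun ψ φ φ' => by
      have h := fun χ : C^∞⟮𝓡 2, M; ℝ⟯ => integrable_of_continuous g
        (continuous_hessInner g χ.contMDiff ψ.contMDiff)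
      simp only [hessInner_comm g ψ]
      rw [← integral_add (h φ) (h φ')]
      exact integral_congr_ae (.of_forall (hessInner_add g φ.contMDiff φ'.contMDiff ψ)))
    (fun c ψ φ => by
      simp only [hessInner_comm g ψ]
      rw [smul_eq_mul, ← integral_const_mul]
      exact integral_congr_ae (.of_forall (hessInner_smul g c φ ψ)))

lemma l2Form_isPosSemidef : (l2Form g).IsPosSemidef where
  eq φ ψ := integral_congr_ae (.of_forall fun x => mul_comm (φ x) (ψ x))
  nonneg φ := integral_nonneg fun x => mul_self_nonneg (φ x)

lemma gradForm_isPosSemidef : (gradForm g).IsPosSemidef where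
  eq φ ψ := integral_congr_ae (.of_forall (gradInner_comm g φ ψ))
  nonneg φ := integral_nonneg (gradInner_self_nonneg g φ)

lemma hessForm_isPosSemidef : (hessForm g).IsPosSemidef where
  eq φ ψ := integral_congr_ae (.of_forall (hessInner_comm g φ ψ))
  nonneg φ := integral_nonneg (hessInner_self_nonneg g φ)

lemma h1_isPosSemidef : (l2Form g + gradForm g).IsPosSemidef :=
  (l2Form_isPosSemidef g).add (gradForm_isPosSemidef g)

lemma h2_isPosSemidef : (l2Form g + gradForm g + hessForm g).IsPosSemidef :=
  (h1_isPosSemidef g).add (hessForm_isPosSemidef g)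

/-- Smooth functions with the norm `‖φ‖² = ∫ φ² + ∫ |∇φ|²`. -/
abbrev SmoothH1 : Type _ := WithForm (l2Form g + gradForm g) (h1_isPosSemidef g)

/-- Smooth functions with the norm `‖φ‖² = ∫ φ² + ∫ |∇φ|² + ∫ |∇²φ|²`. -/
abbrev SmoothH2 : Type _ := WithForm (l2Form g + gradForm g + hessForm g) (h2_isPosSemidef g)

/-- The Sobolev space `H¹(M, g)`: the completion of `C^∞(M)` in the `H¹` norm. -/
abbrev H1 : Type _ := UniformSpace.Completion (SmoothH1 g)

/-- The Sobolev space `H²(M, g)`: the completion of `C^∞(M)` in the `H²` norm. -/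
abbrev H2 : Type _ := UniformSpace.Completion (SmoothH2 g)

/-- The space `L²(M, g)`. -/
abbrev L2 : Type _ := Lp ℝ 2 (vol g)

/-- A smooth function as an element of `L²`. -/
def smoothToL2 : C^∞⟮𝓡 2, M; ℝ⟯ →ₗ[ℝ] L2 g where
  toFun φ := ContinuousMap.toLp 2 (vol g) ℝ ⟨φ, φ.contMDiff.continuous⟩
  map_add' φ ψ := map_add (ContinuousMap.toLp 2 (vol g) ℝ)
    (⟨φ, φ.contMDiff.continuous⟩ : C(M, ℝ)) ⟨ψ, ψ.contMDiff.continuous⟩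
  map_smul' c φ := map_smul (ContinuousMap.toLp 2 (vol g) ℝ) c
    (⟨φ, φ.contMDiff.continuous⟩ : C(M, ℝ))

/-- The Laplacian of a smooth function as an element of `L²`. -/
def smoothLaplacian : C^∞⟮𝓡 2, M; ℝ⟯ →ₗ[ℝ] L2 g where
  toFun φ := ContinuousMap.toLp 2 (vol g) ℝ ⟨laplacian g φ, continuous_laplacian g φ.contMDiff⟩
  map_add' φ ψ := by
    rw [← map_add]
    congr 1
    ext x
    exact laplacian_add g φ.contMDiff ψ.contMDiff x
  map_smul' c φ := by
    rw [RingHom.id_apply, ← map_smul]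
    congr 1
    ext x
    exact laplacian_smul g c φ x

lemma norm_toLp_sq (F : C(M, ℝ)) :
    ‖ContinuousMap.toLp 2 (vol g) ℝ F‖ ^ 2 = ∫ x, F x * F x ∂(vol g) := by
  rw [← real_inner_self_eq_norm_sq, ContinuousMap.inner_toLp]
  simp

lemma norm_smoothToL2_le (φ : SmoothH1 g) :
    ‖smoothToL2 g ((WithForm.of _ _).symm φ)‖ ≤ 1 * ‖φ‖ := by
  rw [one_mul]
  refine abs_le_of_sq_le_sq' ?_ (norm_nonneg _) |>.2
  obtain ⟨φ, rfl⟩ := (WithForm.of _ (h1_isPosSemidef g)).surjective φ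
  rw [LinearEquiv.symm_apply_apply, WithForm.norm_sq, smoothToL2]
  refine (norm_toLp_sq g _).trans_le ?_
  exact le_add_of_nonneg_right ((gradForm_isPosSemidef g).isNonneg.nonneg φ)

lemma norm_smoothH2_le (φ : SmoothH2 g) :
    ‖WithForm.of _ (h1_isPosSemidef g) ((WithForm.of _ (h2_isPosSemidef g)).symm φ)‖ ≤ 1 * ‖φ‖ := by
  rw [one_mul]
  refine abs_le_of_sq_le_sq' ?_ (norm_nonneg _) |>.2
  obtain ⟨φ, rfl⟩ := (WithForm.of _ (h2_isPosSemidef g)).surjective φ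
  rw [LinearEquiv.symm_apply_apply, WithForm.norm_sq, WithForm.norm_sq]
  exact le_add_of_nonneg_right ((hessForm_isPosSemidef g).isNonneg.nonneg φ)

lemma norm_smoothLaplacian_le (φ : SmoothH2 g) :
    ‖smoothLaplacian g ((WithForm.of _ _).symm φ)‖ ≤ √2 * ‖φ‖ := by
  refine abs_le_of_sq_le_sq' ?_ (by positivity) |>.2
  obtain ⟨φ, rfl⟩ := (WithForm.of _ (h2_isPosSemidef g)).surjective φ
  rw [LinearEquiv.symm_apply_apply, mul_pow, Real.sq_sqrt (by norm_num), WithForm.norm_sq,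
    smoothLaplacian]
  refine (norm_toLp_sq g _).trans_le ?_
  have h1 : ∫ x, laplacian g φ x * laplacian g φ x ∂(vol g) ≤ 2 * hessForm g φ φ := by
    refine le_trans (integral_mono (integrable_of_continuous g
      ((continuous_laplacian g φ.contMDiff).mul (continuous_laplacian g φ.contMDiff)))
      ((integrable_of_continuous g
        (continuous_hessInner g φ.contMDiff φ.contMDiff)).const_mul 2) fun x => ?_)
      (integral_const_mul _ _).le
    have := laplacian_sq_le g φ x
    simpa [sq] using this
  have h2 := (h1_isPosSemidef g).isNonneg.nonneg φ
  have h3 : (l2Form g + gradForm g + hessForm g) φ φ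
      = (l2Form g + gradForm g) φ φ + hessForm g φ φ := rfl
  rw [h3]
  refine le_trans h1 ?_
  linarith

/-- The inclusion `H¹ → L²`, extended by continuity from smooth functions. -/
def H1.toL2 : H1 g →L[ℝ] L2 g :=
  (LinearMap.mkContinuous (smoothToL2 g ∘ₗ (WithForm.of _ _).symm.toLinearMap) 1
    (norm_smoothToL2_le g)).extend UniformSpace.Completion.toComplL

/-- The inclusion `H² → H¹`, extended by continuity from smooth functions. -/
def H2.toH1 : H2 g →L[ℝ] H1 g :=
  (UniformSpace.Completion.toComplL ∘L
    (LinearMap.mkContinuous ((WithForm.of _ (h1_isPosSemidef g)).toLinearMap ∘ₗ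
      (WithForm.of _ (h2_isPosSemidef g)).symm.toLinearMap) 1
      (norm_smoothH2_le g))).extend UniformSpace.Completion.toComplL

/-- The Laplacian `Δ : H² → L²`, extended by continuity from smooth functions. -/
def H2.laplacian : H2 g →L[ℝ] L2 g :=
  (LinearMap.mkContinuous (smoothLaplacian g ∘ₗ (WithForm.of _ _).symm.toLinearMap) (√2)
    (norm_smoothLaplacian_le g)).extend UniformSpace.Completion.toComplL

lemma H1.toL2_coe (φ : C^∞⟮𝓡 2, M; ℝ⟯) :
    H1.toL2 g (WithForm.of _ (h1_isPosSemidef g) φ : SmoothH1 g) = smoothToL2 g φ :=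
  ContinuousLinearMap.extend_eq _ (e := (UniformSpace.Completion.toComplL : SmoothH1 g →L[ℝ] H1 g))
    UniformSpace.Completion.denseRange_coe
    (UniformSpace.Completion.isUniformInducing_coe _) _

lemma H2.toH1_coe (φ : C^∞⟮𝓡 2, M; ℝ⟯) :
    H2.toH1 g (WithForm.of _ (h2_isPosSemidef g) φ : SmoothH2 g)
      = (WithForm.of _ (h1_isPosSemidef g) φ : SmoothH1 g) :=
  ContinuousLinearMap.extend_eq _ (e := (UniformSpace.Completion.toComplL : SmoothH2 g →L[ℝ] H2 g))
    UniformSpace.Completion.denseRange_coe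
    (UniformSpace.Completion.isUniformInducing_coe _) _

lemma H2.laplacian_coe (φ : C^∞⟮𝓡 2, M; ℝ⟯) :
    H2.laplacian g (WithForm.of _ (h2_isPosSemidef g) φ : SmoothH2 g) = smoothLaplacian g φ :=
  ContinuousLinearMap.extend_eq _ (e := (UniformSpace.Completion.toComplL : SmoothH2 g →L[ℝ] H2 g))
    UniformSpace.Completion.denseRange_coe
    (UniformSpace.Completion.isUniformInducing_coe _) _

/-- A representative of `u ∈ H¹` as a function on `M`. -/
def H1.fn (u : H1 g) : M → ℝ := H1.toL2 g u

/-- `‖∇u‖²` in `L²`, that is `‖u‖²` in `H¹` minus `‖u‖²` in `L²`. This is the continuous function on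
`H¹` that is `∫ |∇φ|²` for smooth `φ`, see `gradNormSq_coe`. -/
def gradNormSq (u : H1 g) : ℝ := ‖u‖ ^ 2 - ‖H1.toL2 g u‖ ^ 2

lemma gradNormSq_coe (φ : C^∞⟮𝓡 2, M; ℝ⟯) :
    gradNormSq g (WithForm.of _ (h1_isPosSemidef g) φ : SmoothH1 g)
      = ∫ x, gradInner g φ φ x ∂(vol g) := by
  have h : ‖smoothToL2 g φ‖ ^ 2 = l2Form g φ φ := norm_toLp_sq g _
  have h2 : (l2Form g + gradForm g) φ φ
      = l2Form g φ φ + ∫ x, gradInner g φ φ x ∂(vol g) := rfl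
  rw [gradNormSq, H1.toL2_coe, UniformSpace.Completion.norm_coe, WithForm.norm_sq, h, h2,
    add_sub_cancel_left]

/-- The `L^∞(M, g)` norm of a smooth function. -/
def supNorm (f : C^∞⟮𝓡 2, M; ℝ⟯) : ℝ := (eLpNorm f ⊤ (vol g)).toReal

/-- The mean `ū` of `u` (the volume of `g` is normalised to one). -/
def mean (u : H1 g) : ℝ := ∫ x, H1.fn g u x ∂(vol g)

/-- The set `C_A` of all `u ∈ H¹` for which the metric `e²ᵘ g` has volume `A`. -/
def volumeClass (A : ℝ) : Set (H1 g) :=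
  {u | Integrable (fun x => Real.exp (2 * H1.fn g u x)) (vol g) ∧
    ∫ x, Real.exp (2 * H1.fn g u x) ∂(vol g) = A}

/-- The energy `E_f(u) = ½ ∫ (|∇u|² + 2 K u - f e²ᵘ)`, where `K` is the curvature of `g`. -/
def energy (K : ℝ) (f : C^∞⟮𝓡 2, M; ℝ⟯) (u : H1 g) : ℝ :=
  (1 / 2) * (gradNormSq g u + ∫ x, (2 * K * H1.fn g u x) ∂(vol g)
    - ∫ x, f x * Real.exp (2 * H1.fn g u x) ∂(vol g))

/-- The normalisation `(1 / A) (∫ f e²ᵘ - K)`. -/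
def alpha (K A : ℝ) (f : C^∞⟮𝓡 2, M; ℝ⟯) (u : H1 g) : ℝ :=
  (1 / A) * (∫ x, f x * Real.exp (2 * H1.fn g u x) ∂(vol g) - K)

/-- The Gauss curvature `e⁻²ᵛ (-Δv + K)` of the metric `e²ᵛ g` for `v ∈ H²`, where `K` is the
curvature of `g`. -/
def conformalCurvature (K : ℝ) (v : H2 g) (x : M) : ℝ :=
  Real.exp (-2 * H1.fn g (H2.toH1 g v) x) * (-(H2.laplacian g v : M → ℝ) x + K)

/-- `u ∈ C([0,T), H¹) ∩ C¹((0,T), H²)` solves `∂ₜ u = f - K_{g(t)} - α(t)` on `(0,T) × M`, `u(0) = u₀`,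
where `g(t) = e^{2u(t)} g`. The curve `v` is `u` on `(0,T)`, as a curve in `H²`. -/
structure IsFlowSolution (K A : ℝ) (f : C^∞⟮𝓡 2, M; ℝ⟯) (u₀ : H1 g) (T : ℝ) (u : ℝ → H1 g) :
    Prop where
  continuousOn : ContinuousOn u (Set.Ico 0 T)
  initial : u 0 = u₀
  equation : ∃ v : ℝ → H2 g, ContDiffOn ℝ 1 v (Set.Ioo 0 T) ∧
    (∀ t ∈ Set.Ioo 0 T, H2.toH1 g (v t) = u t) ∧
    ∀ t ∈ Set.Ioo 0 T, ∀ᵐ x ∂(vol g), H1.fn g (H2.toH1 g (deriv v t)) x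
      = f x - conformalCurvature g K (v t) x - alpha g K A f (u t)

end Sobolev

end Surface

end

/-!
The estimates come from three facts about the flow: the volume `V = ∫ e²ᵘ` is preserved, the energy
decreases, and `H¹` functions have exponential integrals of every order.

*Volume and energy.* Multiplying the equation by `e²ᵘ` and integrating, with `∫ Δu = 0`, gives
`V' = 2α (A - V)`; as `V(0) = A`, this forces `V = A` (`IsFlowSolution.integral_exp_eq`).
Multiplying by `e²ᵘ ∂ₜu` instead and using Green's formula gives `d/dt E_f(u) = -∫ e²ᵘ (∂ₜu)²`,
where the term with `α` drops out because `∫ e²ᵘ ∂ₜu = V' / 2 = 0` (`IsFlowSolution.antitoneOn_energy`).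
With `|∫ f e²ᵘ| ≤ A ‖f‖_∞` the energy inequality reads
`‖∇u‖² + 2Kū ≤ ‖∇u₀‖² + 2Kū₀ + 2A ‖f‖_∞` (`IsFlowSolution.gradNormSq_add_le`).
Jensen's inequality bounds `ū` above, and since `K < 0` this bounds `‖∇u‖²`; dropping `‖∇u‖²` from
the same inequality bounds `ū` below. In place of a Poincaré inequality,
`|y| ≤ e²ʸ - y` turns the bounds on `V` and `ū` into a bound on `‖u‖_{L¹}`.

*Exponential integrals.* The inequality `∫ e^|u| ≤ C exp (C (‖∇u‖² + ‖u‖_{L¹}))` is proved in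
`exists_integral_exp_abs_fn_le`; replacing `u` by `2pu` gives the remaining bound. Its source is the
Sobolev inequality `‖w‖_{L²} ≤ C (‖∇w‖_{L¹} + ‖w‖_{L¹})` (`exists_integral_sq_le`), which follows
from the Gagliardo-Nirenberg-Sobolev inequality of the plane by a partition of unity. Applied to a
cut-off of a smooth `u` between the levels `s` and `s + 1` it bounds the measure `μ(s + 1)` of
`{u > s + 1}` by `C μ(s) (D(s) + μ(s))`, where `D(s)` is the Dirichlet integral over
`{s < u < s + 1}`. Above the level `s₀ = ‖u‖_{L¹} / δ + 1` the term `C μ(s)` is small, so the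
factor is at most `exp (-2 + B D(s))`, and as the `D(s₀ + j)` add up to at most `‖∇u‖²`, one gets
`μ(s₀ + n) ≤ δ exp (-2n + B ‖∇u‖²)` (`exists_superlevel_le_exp`). Fatou's lemma extends the result
to `H¹`. The same inequality shows that `u ↦ ∫ F e²ᵘ` is differentiable on `H¹`
(`hasFDerivAt_expIntegral`), which is what differentiating `V` and the energy requires.

Integration on the surface is reduced to the plane by `vol_restrict_source`: on the domain of a
chart the Riemannian measure is `√(det gᵢⱼ) dy`. Green's formula is `integral_gradInner`.
-/

noncomputable section
namespace Surface

/-! ### The Riemannian measure in charts -/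

section ChartMeasure
variable {M : Type*} [TopologicalSpace M] [ChartedSpace Plane M] [IsManifold (𝓡 2) ∞ M]
  [MeasurableSpace M]

/-- The measure `√(det gᵢⱼ) dy` of the chart `e`, pushed forward to `M`. -/
def chartMeasure (g : Metric M) (e : OpenPartialHomeomorph M Plane) : Measure M :=
  Measure.map e.symm
    ((volume.restrict e.target).withDensity fun y => ENNReal.ofReal (√(gram g e y).det))

variable [BorelSpace M] {e e' : OpenPartialHomeomorph M Plane}

lemma measurableSet_target_inter_preimage {S : Set M} (hS : MeasurableSet S) :
    MeasurableSet (e.symm ⁻¹' S ∩ e.target) := by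
  have h : Measurable (e.target.domRestrict e.symm) :=
    (continuousOn_iff_continuous_domRestrict.1 e.continuousOn_symm).measurable
  have := e.open_target.measurableSet.subtype_image (h hS)
  convert this using 1
  ext y
  simp [and_comm, Set.domRestrict]

lemma aemeasurable_symm :
    AEMeasurable e.symm (volume.restrict e.target) :=
  e.continuousOn_symm.aemeasurable e.open_target.measurableSet

lemma continuousOn_sqrt_det (g : Metric M) (he : e ∈ atlas Plane M) :
    ContinuousOn (fun y => √(gram g e y).det) e.target := by
  have h : ContinuousOn (fun y => gram g e y) e.target :=
    continuousOn_pi.2 fun i => continuousOn_pi.2 fun j => (contDiffOn_gram g he i j).continuousOn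
  exact ((Continuous.matrix_det continuous_id).comp_continuousOn h).sqrt

lemma aemeasurable_symm_withDensity (g : Metric M) :
    AEMeasurable e.symm ((volume.restrict e.target).withDensity
      fun y => ENNReal.ofReal (√(gram g e y).det)) :=
  aemeasurable_symm.mono_ac (withDensity_absolutelyContinuous _ _)

lemma chartMeasure_apply (g : Metric M) {S : Set M} (hS : MeasurableSet S) :
    chartMeasure g e S
      = ∫⁻ y in e.symm ⁻¹' S ∩ e.target, ENNReal.ofReal (√(gram g e y).det) := by
  rw [chartMeasure, Measure.map_apply_of_aemeasurable (aemeasurable_symm_withDensity g) hS,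
    withDensity_apply', Measure.restrict_restrict' e.open_target.measurableSet]

lemma lintegral_chartMeasure (g : Metric M) (he : e ∈ atlas Plane M) {F : M → ENNReal}
    (hF : Measurable F) : ∫⁻ x, F x ∂(chartMeasure g e)
      = ∫⁻ y in e.target, ENNReal.ofReal (√(gram g e y).det) * F (e.symm y) := by
  rw [chartMeasure, lintegral_map' hF.aemeasurable (aemeasurable_symm_withDensity g),
    lintegral_withDensity_eq_lintegral_mul₀']
  · rfl
  · exact ((continuousOn_sqrt_det g he).aemeasurable e.open_target.measurableSet).ennreal_ofReal
  · exact hF.comp_aemeasurable (aemeasurable_symm_withDensity g)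

lemma det_fderiv_trans (he : e ∈ atlas Plane M) (he' : e' ∈ atlas Plane M) {y : Plane}
    (hy : y ∈ e.target ∩ e.symm ⁻¹' e'.source) :
    (fderiv ℝ (fun z => e' (e.symm z)) y).det = (jac e e' y).det := by
  have h := LinearMap.det_toMatrix (EuclideanSpace.basisFun (Fin 2) ℝ).toBasis
    (fderiv ℝ (fun z => e' (e.symm z)) y : Plane →ₗ[ℝ] Plane)
  rw [ContinuousLinearMap.det, ← h]
  congr 1
  ext a i
  rw [LinearMap.toMatrix_apply]
  simp only [OrthonormalBasis.coe_toBasis, EuclideanSpace.basisFun_apply,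
    ContinuousLinearMap.coe_coe, OrthonormalBasis.coe_toBasis_repr_apply,
    fderiv_trans_single he he' hy]
  fin_cases a <;> simp

/-- Two chart measures agree on the overlap of the charts, by the change of variables formula. -/
lemma chartMeasure_eq_of_subset (g : Metric M) (he : e ∈ atlas Plane M) (he' : e' ∈ atlas Plane M)
    {S : Set M} (hS : MeasurableSet S) (h : S ⊆ e.source) (h' : S ⊆ e'.source) :
    chartMeasure g e S = chartMeasure g e' S := by
  rw [chartMeasure_apply g hS, chartMeasure_apply g hS]
  have him : e'.symm ⁻¹' S ∩ e'.target
      = (fun z => e' (e.symm z)) '' (e.symm ⁻¹' S ∩ e.target) := by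
    ext z
    constructor
    · rintro ⟨hz, hz'⟩
      refine ⟨e (e'.symm z), ⟨?_, e.map_source (h hz)⟩, ?_⟩
      · simpa [e.left_inv (h hz)] using hz
      · simp [e.left_inv (h hz), e'.right_inv hz']
    · rintro ⟨y, ⟨hy, hy'⟩, rfl⟩
      exact ⟨by simpa [e'.left_inv (h' hy)] using hy, e'.map_source (h' hy)⟩
  have hsub : e.symm ⁻¹' S ∩ e.target ⊆ e.target ∩ e.symm ⁻¹' e'.source :=
    fun y hy => ⟨hy.2, h' hy.1⟩
  rw [him, lintegral_image_eq_lintegral_abs_det_fderiv_mul volume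
    (measurableSet_target_inter_preimage hS)
    (f' := fun y => fderiv ℝ (fun z => e' (e.symm z)) y)]
  · refine setLIntegral_congr_fun (measurableSet_target_inter_preimage hS) fun y hy => ?_
    rw [det_fderiv_trans he he' (hsub hy), ← ENNReal.ofReal_mul (abs_nonneg _),
      gram_trans g he he' (hsub hy), Matrix.det_mul, Matrix.det_mul, Matrix.det_transpose,
      mul_right_comm, Real.sqrt_mul (mul_self_nonneg _), Real.sqrt_mul_self_eq_abs]
  · intro y hy
    exact ((((contDiffOn_trans he he').contDiffAt ((isOpen_overlap e e').mem_nhds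
      (hsub hy))).differentiableAt (by simp)).hasFDerivAt).hasFDerivWithinAt
  · intro y hy z hz hyz
    have h1 := e'.injOn (h' hy.1) (h' hz.1) hyz
    exact e.symm.injOn hy.2 hz.2 h1

lemma chartMeasure_compl_source (g : Metric M) : chartMeasure g e e.sourceᶜ = 0 := by
  rw [chartMeasure_apply g e.open_source.measurableSet.compl]
  have : e.symm ⁻¹' e.sourceᶜ ∩ e.target = ∅ := by
    ext y
    simp only [Set.mem_inter_iff, Set.mem_preimage, Set.mem_compl_iff, Set.mem_empty_iff_false,
      iff_false, not_and]
    intro h hy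
    exact h (e.map_target hy)
  rw [this, Measure.restrict_empty, lintegral_zero_measure]

lemma chartMeasure_inter_source (g : Metric M) (S : Set M) :
    chartMeasure g e (S ∩ e.source) = chartMeasure g e S :=
  measure_inter_conull (chartMeasure_compl_source g)

variable [CompactSpace M]

/-- On the domain of a chart of the atlas, the Riemannian measure is the measure of that chart. -/
theorem vol_restrict_source (g : Metric M) (he : e ∈ atlas Plane M) :
    (vol g).restrict e.source = chartMeasure g e := by
  -- an upper bound `ν` of all chart measures which is `chartMeasure g e` on the domain of `e`:
  -- the domain of `e` is completed by finitely many chart domains to a partition of `M`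
  obtain ⟨t, ht⟩ := isCompact_univ.elim_finite_subcover
    (fun x : M => (chartAt Plane x).source) (fun x => (chartAt Plane x).open_source)
    (fun x _ => Set.mem_iUnion.2 ⟨x, mem_chart_source Plane x⟩)
  let L : List M := t.toList
  let c : ℕ → OpenPartialHomeomorph M Plane := fun n =>
    if n = 0 then e else if h : n - 1 < L.length then chartAt Plane (L[n-1]) else e
  have hc : ∀ n, c n ∈ atlas Plane M := by
    intro n
    simp only [c]
    split_ifs
    exacts [he, chart_mem_atlas _ _, he]
  have hcover : ⋃ n, (c n).source = Set.univ := by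
    refine Set.eq_univ_of_forall fun x => ?_
    obtain ⟨z, hz, hx⟩ := Set.mem_iUnion₂.1 (ht (Set.mem_univ x))
    obtain ⟨n, hn, hnz⟩ := List.getElem_of_mem (Finset.mem_toList.2 hz)
    refine Set.mem_iUnion.2 ⟨n + 1, ?_⟩
    simp only [c, Nat.add_sub_cancel, Nat.succ_ne_zero, if_false]
    rw [dif_pos hn]
    simp only [L, hnz]
    exact hx
  let B : ℕ → Set M := disjointed fun n => (c n).source
  have hBm : ∀ n, MeasurableSet (B n) :=
    fun n => MeasurableSet.disjointed (fun i => (c i).open_source.measurableSet) n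
  have hBs : ∀ n, B n ⊆ (c n).source := fun n => disjointed_subset _ n
  have hBd : Pairwise (Function.onFun Disjoint B) := disjoint_disjointed _
  have hBu : ⋃ n, B n = Set.univ := by rw [iUnion_disjointed, hcover]
  let ν : Measure M := Measure.sum fun n => (chartMeasure g (c n)).restrict (B n)
  have hν : ∀ e' ∈ atlas Plane M, chartMeasure g e' ≤ ν := by
    intro e' he'
    refine Measure.le_iff.2 fun S hS => ?_
    rw [Measure.sum_apply _ hS]
    have h1 : S = ⋃ n, S ∩ B n := by rw [← Set.inter_iUnion, hBu, Set.inter_univ]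
    calc chartMeasure g e' S = ∑' n, chartMeasure g e' (S ∩ B n) := by
          conv_lhs => rw [h1]
          exact measure_iUnion (fun i j hij => (hBd hij).mono Set.inter_subset_right
            Set.inter_subset_right) fun n => hS.inter (hBm n)
      _ ≤ _ := ENNReal.tsum_le_tsum fun n => by
          rw [← chartMeasure_inter_source, Measure.restrict_apply hS,
            chartMeasure_eq_of_subset g he' (hc n)
              ((hS.inter (hBm n)).inter e'.open_source.measurableSet)
              Set.inter_subset_right fun x hx => hBs n hx.1.2]
          exact measure_mono Set.inter_subset_left
  have hle : vol g ≤ ν := iSup₂_le hν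
  have hge : chartMeasure g e ≤ vol g := le_iSup₂ (f := fun e _ => chartMeasure g e) e he
  refine le_antisymm (Measure.le_iff.2 fun S hS => ?_) (Measure.le_iff.2 fun S hS => ?_)
  · rw [Measure.restrict_apply hS]
    refine (hle _).trans ?_
    have hSm := hS.inter e.open_source.measurableSet
    rw [Measure.sum_apply _ hSm, tsum_eq_single 0]
    · refine (Measure.restrict_apply_le _ _).trans ?_
      simp only [c, if_true]
      exact measure_mono Set.inter_subset_left
    · intro n hn
      rw [Measure.restrict_apply hSm]
      have h0 : B 0 = e.source := by simp [B, c, disjointed_zero]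
      have : S ∩ e.source ∩ B n = ∅ := by
        rw [← h0, Set.inter_assoc, (hBd (Ne.symm hn)).inter_eq, Set.inter_empty]
      simp [this]
  · rw [Measure.restrict_apply hS, ← chartMeasure_inter_source]
    exact hge _

lemma setLIntegral_vol (g : Metric M) (he : e ∈ atlas Plane M) {F : M → ENNReal}
    (hF : Measurable F) : ∫⁻ x in e.source, F x ∂(vol g)
      = ∫⁻ y in e.target, ENNReal.ofReal (√(gram g e y).det) * F (e.symm y) := by
  rw [vol_restrict_source g he, lintegral_chartMeasure g he hF]

lemma setIntegral_vol (g : Metric M) (he : e ∈ atlas Plane M) {F : M → ℝ}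
    (hF : StronglyMeasurable F) : ∫ x in e.source, F x ∂(vol g)
      = ∫ y in e.target, √(gram g e y).det * F (e.symm y) := by
  rw [vol_restrict_source g he, chartMeasure, integral_map (aemeasurable_symm_withDensity g)
    hF.aestronglyMeasurable, integral_withDensity_eq_integral_toReal_smul₀]
  · refine integral_congr_ae (.of_forall fun y => ?_)
    simp [ENNReal.toReal_ofReal (Real.sqrt_nonneg _)]
  · exact ((continuousOn_sqrt_det g he).aemeasurable e.open_target.measurableSet).ennreal_ofReal
  · exact .of_forall fun y => by simp

end ChartMeasure

/-! ### Localisation in a chart and integration by parts -/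

section Localise

lemma contDiff_of_contDiffOn_of_eq_zero {E : Type*} [NormedAddCommGroup E] [NormedSpace ℝ E]
    {w : E → ℝ} {U K : Set E} {n : ℕ∞ω} (hU : IsOpen U) (hK : IsClosed K)
    (hKU : K ⊆ U) (hw : ContDiffOn ℝ n w U) (h0 : ∀ y ∉ K, w y = 0) : ContDiff ℝ n w := by
  refine contDiff_iff_contDiffAt.2 fun y => ?_
  by_cases hy : y ∈ U
  · exact hw.contDiffAt (hU.mem_nhds hy)
  · have : w =ᶠ[nhds y] fun _ => 0 :=
      Filter.eventuallyEq_of_mem (hK.isOpen_compl.mem_nhds fun h => hy (hKU h)) h0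
    exact contDiffAt_const.congr_of_eventuallyEq this

lemma integral_pd_eq_zero {w : Plane → ℝ} (hw : ContDiff ℝ 1 w) (hc : HasCompactSupport w)
    (i : Fin 2) : ∫ y, pd i w y = 0 := by
  have hcont : Continuous (fun y => fderiv ℝ w y (EuclideanSpace.single i (1 : ℝ))) :=
    (hw.continuous_fderiv (by simp)).clm_apply continuous_const
  have h := integral_mul_fderiv_eq_neg_fderiv_mul_of_integrable (𝕜 := ℝ) (μ := volume)
    (f := fun _ : Plane => (1 : ℝ)) (g := w) (v := EuclideanSpace.single i (1 : ℝ))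
    (by simp) ?_ ?_ (fun _ _ => differentiableAt_const _)
    (fun _ _ => (hw.differentiable (by simp)) _)
  · simpa [pd] using h
  · simpa using hcont.integrable_of_hasCompactSupport (hc.fderiv_apply ℝ _)
  · simpa using hw.continuous.integrable_of_hasCompactSupport hc

variable {M : Type*} [TopologicalSpace M] [ChartedSpace Plane M] [IsManifold (𝓡 2) ∞ M]
  {e : OpenPartialHomeomorph M Plane}

lemma det_gram (g : Metric M) (y : Plane) :
    (gram g e y).det = gram g e y 0 0 * gram g e y 1 1 - gram g e y 0 1 * gram g e y 0 1 := by
  rw [Matrix.det_fin_two]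
  have : gram g e y 1 0 = gram g e y 0 1 := congrFun (congrFun (gram_symm (e := e) g y) 0) 1
  rw [this]

lemma gram_inv_apply (g : Metric M) (y : Plane) :
    (gram g e y)⁻¹ 0 0 = ((gram g e y).det)⁻¹ * gram g e y 1 1 ∧
    (gram g e y)⁻¹ 0 1 = -(((gram g e y).det)⁻¹ * gram g e y 0 1) ∧
    (gram g e y)⁻¹ 1 0 = -(((gram g e y).det)⁻¹ * gram g e y 0 1) ∧
    (gram g e y)⁻¹ 1 1 = ((gram g e y).det)⁻¹ * gram g e y 0 0 := by
  have : gram g e y 1 0 = gram g e y 0 1 := congrFun (congrFun (gram_symm (e := e) g y) 0) 1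
  rw [Matrix.inv_def, Matrix.adjugate_fin_two, this, Ring.inverse_eq_inv']
  simp

lemma pd_inv_sqrt {w : Plane → ℝ} {y : Plane} (hw : DifferentiableAt ℝ w y) (h0 : 0 < w y)
    (i : Fin 2) : pd i (fun z => (√(w z))⁻¹) y = -(pd i w y) / (2 * √(w y) ^ 3) := by
  have h := (hasDerivAt_inv (Real.sqrt_pos.2 h0).ne').comp_hasFDerivAt y
    (hw.hasFDerivAt.sqrt h0.ne')
  have h2 : (fun z => (√(w z))⁻¹) = (fun r => r⁻¹) ∘ fun z => √(w z) := rfl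
  unfold pd
  rw [h2, h.fderiv]
  have := (Real.sqrt_pos.2 h0).ne'
  simp
  field_simp

lemma pd_sub {w w' : Plane → ℝ} {y : Plane} (h : DifferentiableAt ℝ w y)
    (h' : DifferentiableAt ℝ w' y) (i : Fin 2) :
    pd i (fun z => w z - w' z) y = pd i w y - pd i w' y := by
  unfold pd
  rw [fderiv_fun_sub h h']; rfl

/-- The component `√(det g) gⁱʲ ∂ⱼψ` of the density-weighted gradient of `ψ` in the chart `e`. -/
def flux (g : Metric M) (e : OpenPartialHomeomorph M Plane) (ψ : M → ℝ) (i : Fin 2) (y : Plane) :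
    ℝ :=
  √(gram g e y).det * ((gram g e y)⁻¹ *ᵥ differential e ψ y) i

lemma contDiffOn_det_gram (g : Metric M) (he : e ∈ atlas Plane M) :
    ContDiffOn ℝ ∞ (fun y => (gram g e y).det) e.target := by
  simp only [det_gram]
  have h := contDiffOn_gram g he
  exact ((h 0 0).mul (h 1 1)).sub ((h 0 1).mul (h 0 1))

lemma flux_zero (g : Metric M) (he : e ∈ atlas Plane M) (ψ : M → ℝ) {y : Plane}
    (hy : y ∈ e.target) : flux g e ψ 0 y = (√(gram g e y).det)⁻¹ *
      (gram g e y 1 1 * pd 0 (ψ ∘ e.symm) y - gram g e y 0 1 * pd 1 (ψ ∘ e.symm) y) := by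
  have hd := (gram_posDef g he hy).det_pos
  have hs := Real.mul_self_sqrt hd.le
  have hs0 := (Real.sqrt_pos.2 hd).ne'
  obtain ⟨h00, h01, -, -⟩ := gram_inv_apply (e := e) g y
  simp only [flux, Matrix.mulVec, dotProduct, Fin.sum_univ_two, differential, h00, h01]
  generalize √(gram g e y).det = r at *
  rw [← hs]
  field_simp
  ring

lemma flux_one (g : Metric M) (he : e ∈ atlas Plane M) (ψ : M → ℝ) {y : Plane}
    (hy : y ∈ e.target) : flux g e ψ 1 y = (√(gram g e y).det)⁻¹ *
      (gram g e y 0 0 * pd 1 (ψ ∘ e.symm) y - gram g e y 0 1 * pd 0 (ψ ∘ e.symm) y) := by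
  have hd := (gram_posDef g he hy).det_pos
  have hs := Real.mul_self_sqrt hd.le
  have hs0 := (Real.sqrt_pos.2 hd).ne'
  obtain ⟨-, -, h10, h11⟩ := gram_inv_apply (e := e) g y
  simp only [flux, Matrix.mulVec, dotProduct, Fin.sum_univ_two, differential, h10, h11]
  generalize √(gram g e y).det = r at *
  rw [← hs]
  field_simp
  ring

lemma contDiffOn_flux (g : Metric M) (he : e ∈ atlas Plane M) {ψ : M → ℝ}
    (hψ : ContMDiff (𝓡 2) 𝓘(ℝ) ∞ ψ) (i : Fin 2) : ContDiffOn ℝ ∞ (flux g e ψ i) e.target := by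
  have hG := contDiffOn_gram g he
  have hp := fun j => contDiffOn_pd e.open_target j (contDiffOn_comp_symm he hψ)
  have hd : ContDiffOn ℝ ∞ (fun y => (√(gram g e y).det)⁻¹) e.target :=
    ((contDiffOn_det_gram g he).sqrt fun y hy => (gram_posDef g he hy).det_pos.ne').inv
      fun y hy => (Real.sqrt_pos.2 (gram_posDef g he hy).det_pos).ne'
  fin_cases i
  · exact (hd.mul (((hG 1 1).mul (hp 0)).sub ((hG 0 1).mul (hp 1)))).congr
      fun y hy => flux_zero g he ψ hy
  · exact (hd.mul (((hG 0 0).mul (hp 1)).sub ((hG 0 1).mul (hp 0)))).congr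
      fun y hy => flux_one g he ψ hy

/-- The divergence form `√(det g) Δψ = ∂ᵢ(√(det g) gⁱʲ ∂ⱼψ)` of the Laplacian. -/
lemma sum_pd_flux (g : Metric M) (he : e ∈ atlas Plane M) {ψ : M → ℝ}
    (hψ : ContMDiff (𝓡 2) 𝓘(ℝ) ∞ ψ) {y : Plane} (hy : y ∈ e.target) :
    pd 0 (flux g e ψ 0) y + pd 1 (flux g e ψ 1) y
      = √(gram g e y).det * laplacianIn g e ψ y := by
  have hnhds := e.open_target.mem_nhds hy
  have hG : ∀ i j, DifferentiableAt ℝ (fun z => gram g e z i j) y := fun i j =>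
    ((contDiffOn_gram g he i j).contDiffAt hnhds).differentiableAt (by simp)
  have hp : ∀ j, DifferentiableAt ℝ (pd j (ψ ∘ e.symm)) y := fun j =>
    ((contDiffOn_pd e.open_target j (contDiffOn_comp_symm he hψ)).contDiffAt
      hnhds).differentiableAt (by simp)
  have hdet : DifferentiableAt ℝ (fun z => (gram g e z).det) y :=
    ((contDiffOn_det_gram g he).contDiffAt hnhds).differentiableAt (by simp)
  have hd := (gram_posDef g he hy).det_pos
  have hinv : DifferentiableAt ℝ (fun z => (√(gram g e z).det)⁻¹) y :=
    (hdet.sqrt hd.ne').fun_inv (Real.sqrt_pos.2 hd).ne'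
  have hpdet : ∀ i, pd i (fun z => (gram g e z).det) y
      = pd i (fun z => gram g e z 0 0) y * gram g e y 1 1
        + gram g e y 0 0 * pd i (fun z => gram g e z 1 1) y
        - 2 * gram g e y 0 1 * pd i (fun z => gram g e z 0 1) y := by
    intro i
    simp only [det_gram]
    rw [pd_sub ((hG 0 0).fun_mul (hG 1 1)) ((hG 0 1).fun_mul (hG 0 1)), pd_mul (hG 0 0) (hG 1 1),
      pd_mul (hG 0 1) (hG 0 1)]
    ring
  have hsym : (fun z => gram g e z 1 0) = fun z => gram g e z 0 1 := by
    ext z; exact congrFun (congrFun (gram_symm (e := e) g z) 0) 1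
  have hsymy : gram g e y 1 0 = gram g e y 0 1 := congrFun hsym y
  obtain ⟨h00, h01, h10, h11⟩ := gram_inv_apply (e := e) g y
  rw [pd_congr e.open_target (fun z hz => flux_zero g he ψ hz) hy,
    pd_congr e.open_target (fun z hz => flux_one g he ψ hz) hy,
    pd_mul hinv (((hG 1 1).fun_mul (hp 0)).fun_sub ((hG 0 1).fun_mul (hp 1))),
    pd_mul hinv (((hG 0 0).fun_mul (hp 1)).fun_sub ((hG 0 1).fun_mul (hp 0))),
    pd_sub ((hG 1 1).fun_mul (hp 0)) ((hG 0 1).fun_mul (hp 1)),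
    pd_sub ((hG 0 0).fun_mul (hp 1)) ((hG 0 1).fun_mul (hp 0)),
    pd_mul (hG 1 1) (hp 0), pd_mul (hG 0 1) (hp 1), pd_mul (hG 0 0) (hp 1), pd_mul (hG 0 1) (hp 0),
    pd_inv_sqrt hdet hd, pd_inv_sqrt hdet hd, hpdet, hpdet,
    pd_comm e.open_target (contDiffOn_comp_symm he hψ) hy 1 0]
  simp only [laplacianIn, Matrix.trace, Matrix.diag, Matrix.mul_apply, Fin.sum_univ_two,
    hessian, Matrix.of_apply, christoffel, h00, h01, h10, h11, hsym,
    pd_comm e.open_target (contDiffOn_comp_symm he hψ) hy 1 0]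
  have hs0 := (Real.sqrt_pos.2 hd).ne'
  have hs : (gram g e y).det = √(gram g e y).det ^ 2 := (Real.sq_sqrt hd.le).symm
  generalize √(gram g e y).det = r at *
  have hs' := hs
  rw [det_gram] at hs'
  rw [hs]
  generalize gram g e y 0 0 = a at *
  generalize gram g e y 0 1 = b at *
  generalize gram g e y 1 1 = c at *
  field_simp
  simp only [← hs']
  ring

lemma gradInner_eq_zero (g : Metric M) {φ : M → ℝ} (ψ : M → ℝ) {x : M} (hx : x ∉ tsupport φ) :
    gradInner g φ ψ x = 0 := by
  have hd : differential (chartAt Plane x) φ (chartAt Plane x x) = 0 := by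
    ext i
    have h1 : φ =ᶠ[nhds ((chartAt Plane x).symm (chartAt Plane x x))] fun _ => 0 := by
      rw [(chartAt Plane x).left_inv (mem_chart_source Plane x)]
      exact notMem_tsupport_iff_eventuallyEq.1 hx
    have h2 := ((chartAt Plane x).continuousAt_symm (mem_chart_target Plane x)).eventually h1
    simp only [differential, pd]
    have h3 : (φ ∘ (chartAt Plane x).symm) =ᶠ[nhds (chartAt Plane x x)] fun _ => 0 := h2
    rw [h3.fderiv_eq]
    simp
  simp [gradInner, gradInnerIn, hd]

variable [CompactSpace M] [T2Space M]

/-- There is a smooth partition of unity subordinate to finitely many charts. -/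
lemma exists_finite_partition : ∃ (t : Finset M) (χ : t → C^∞⟮𝓡 2, M; ℝ⟯),
    (∀ i, tsupport (χ i) ⊆ (chartAt Plane (i : M)).source) ∧ ∀ x, ∑ i, χ i x = 1 := by
  obtain ⟨t, ht⟩ := isCompact_univ.elim_finite_subcover
    (fun x : M => (chartAt Plane x).source) (fun x => (chartAt Plane x).open_source)
    (fun x _ => Set.mem_iUnion.2 ⟨x, mem_chart_source Plane x⟩)
  obtain ⟨f, hf⟩ := SmoothPartitionOfUnity.exists_isSubordinate (𝓡 2) (s := (Set.univ : Set M))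
    isClosed_univ (fun i : t => (chartAt Plane (i : M)).source)
    (fun i => (chartAt Plane (i : M)).open_source) (by
      intro x hx
      obtain ⟨z, hz, hxz⟩ := Set.mem_iUnion₂.1 (ht hx)
      exact Set.mem_iUnion.2 ⟨⟨z, hz⟩, hxz⟩)
  refine ⟨t, fun i => f i, hf, fun x => ?_⟩
  have := f.sum_eq_one (Set.mem_univ x)
  rwa [finsum_eq_sum_of_fintype] at this

variable [MeasurableSpace M] [BorelSpace M] (g : Metric M) [IsFiniteMeasure (vol g)]

/-- Green's formula for a function supported in one chart: there the integrand is a divergence. -/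
lemma integral_gradInner_add_of_tsupport_subset (he : e ∈ atlas Plane M) {φ ψ : M → ℝ}
    (hφ : ContMDiff (𝓡 2) 𝓘(ℝ) ∞ φ) (hψ : ContMDiff (𝓡 2) 𝓘(ℝ) ∞ ψ)
    (hs : tsupport φ ⊆ e.source) :
    ∫ x, (gradInner g φ ψ x + φ x * laplacian g ψ x) ∂(vol g) = 0 := by
  have hF : Continuous fun x => gradInner g φ ψ x + φ x * laplacian g ψ x :=
    (continuous_gradInner g hφ hψ).add (hφ.continuous.mul (continuous_laplacian g hψ))
  have h0 : ∀ x ∉ e.source, gradInner g φ ψ x + φ x * laplacian g ψ x = 0 := fun x hx => by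
    rw [gradInner_eq_zero g ψ fun h => hx (hs h),
      image_eq_zero_of_notMem_tsupport fun h => hx (hs h)]
    simp
  rw [← setIntegral_eq_integral_of_forall_compl_eq_zero h0,
    setIntegral_vol g he hF.stronglyMeasurable]
  set K : Set Plane := e '' tsupport φ
  have hKc : IsCompact K := ((isClosed_tsupport φ).isCompact).image_of_continuousOn
    (e.continuousOn.mono hs)
  have hKt : K ⊆ e.target := by
    rintro _ ⟨x, hx, rfl⟩
    exact e.map_source (hs hx)
  -- the compactly supported field `Y` has divergence equal to the integrand
  let Y : Fin 2 → Plane → ℝ := fun i => e.target.indicator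
    fun y => flux g e ψ i y * (φ ∘ e.symm) y
  have hYe : ∀ i, Set.EqOn (Y i) (fun y => flux g e ψ i y * (φ ∘ e.symm) y) e.target :=
    fun i y hy => Set.indicator_of_mem hy _
  have hY0 : ∀ i, ∀ y ∉ K, Y i y = 0 := by
    intro i y hy
    by_cases hyt : y ∈ e.target
    · rw [hYe i hyt]
      have : φ (e.symm y) = 0 := image_eq_zero_of_notMem_tsupport fun h =>
        hy ⟨_, h, e.right_inv hyt⟩
      simp [this]
    · exact Set.indicator_of_notMem hyt _
  have hYd : ∀ i, ContDiff ℝ ∞ (Y i) := fun i =>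
    contDiff_of_contDiffOn_of_eq_zero e.open_target hKc.isClosed hKt
      (((contDiffOn_flux g he hψ i).mul (contDiffOn_comp_symm he hφ)).congr (hYe i)) (hY0 i)
  have hYc : ∀ i, HasCompactSupport (Y i) := fun i =>
    HasCompactSupport.intro hKc (hY0 i)
  have hYi : ∀ i, Integrable (pd i (Y i)) := fun i =>
    (((hYd i).continuous_fderiv (by simp)).clm_apply
      continuous_const).integrable_of_hasCompactSupport ((hYc i).fderiv_apply ℝ _)
  have hpt : ∀ y ∈ e.target, √(gram g e y).det * (gradInner g φ ψ (e.symm y)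
      + φ (e.symm y) * laplacian g ψ (e.symm y)) = pd 0 (Y 0) y + pd 1 (Y 1) y := by
    intro y hy
    have hnhds := e.open_target.mem_nhds hy
    have hX : ∀ i, DifferentiableAt ℝ (flux g e ψ i) y := fun i =>
      ((contDiffOn_flux g he hψ i).contDiffAt hnhds).differentiableAt (by simp)
    have hφd : DifferentiableAt ℝ (φ ∘ e.symm) y :=
      ((contDiffOn_comp_symm he hφ).contDiffAt hnhds).differentiableAt (by simp)
    have h1 := sum_pd_flux g he hψ hy
    have hgr : √(gram g e y).det * gradInnerIn g e φ ψ y = pd 0 (φ ∘ e.symm) y * flux g e ψ 0 y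
        + pd 1 (φ ∘ e.symm) y * flux g e ψ 1 y := by
      simp only [gradInnerIn, dotProduct, Fin.sum_univ_two, flux, differential]
      ring
    rw [pd_congr e.open_target (hYe 0) hy, pd_congr e.open_target (hYe 1) hy,
      pd_mul (hX 0) hφd, pd_mul (hX 1) hφd,
      gradInner_eq g he hφ hψ (e.map_target hy), laplacian_eq g he hψ (e.map_target hy),
      e.right_inv hy, mul_add, hgr, Function.comp_apply]
    linear_combination (-(φ (e.symm y))) * h1
  rw [setIntegral_congr_fun e.open_target.measurableSet hpt,
    setIntegral_eq_integral_of_forall_compl_eq_zero, integral_add (hYi 0) (hYi 1),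
    integral_pd_eq_zero ((hYd 0).of_le (by simp)) (hYc 0),
    integral_pd_eq_zero ((hYd 1).of_le (by simp)) (hYc 1), add_zero]
  intro y hy
  have : ∀ i, pd i (Y i) y = 0 := fun i => by
    have h2 : Y i =ᶠ[nhds y] fun _ => 0 :=
      Filter.eventuallyEq_of_mem (hKc.isClosed.isOpen_compl.mem_nhds fun h => hy (hKt h)) (hY0 i)
    rw [pd, h2.fderiv_eq]
    simp
  simp [this]

/-- Green's formula on the closed surface. -/
theorem integral_gradInner (φ ψ : C^∞⟮𝓡 2, M; ℝ⟯) :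
    ∫ x, gradInner g φ ψ x ∂(vol g) = -∫ x, φ x * laplacian g ψ x ∂(vol g) := by
  obtain ⟨t, χ, hχ, hsum⟩ := exists_finite_partition (M := M)
  have hloc : ∀ i, gradForm g (χ i * φ) ψ
      + ∫ x, (χ i * φ) x * laplacian g ψ x ∂(vol g) = 0 := by
    intro i
    have := integral_gradInner_add_of_tsupport_subset g (chart_mem_atlas Plane (i : M))
      (χ i * φ).contMDiff ψ.contMDiff
      ((closure_mono (Function.support_mul_subset_left _ _)).trans (hχ i))
    rw [← this]
    exact (integral_add (integrable_of_continuous g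
        (continuous_gradInner g (χ i * φ).contMDiff ψ.contMDiff))
      (integrable_of_continuous g ((χ i * φ).contMDiff.continuous.mul
        (continuous_laplacian g ψ.contMDiff)))).symm
  have hφ : φ = ∑ i, χ i * φ := by
    ext x
    rw [← Finset.sum_mul]
    have : (∑ i, χ i : C^∞⟮𝓡 2, M; ℝ⟯) x = ∑ i, χ i x := by
      simpa using congrFun (map_sum (ContMDiffMap.coeFnAddMonoidHom (I := 𝓡 2) (N := M)
        (I' := 𝓘(ℝ)) (G := ℝ) (n := ∞)) χ Finset.univ) x
    rw [ContMDiffMap.coe_mul, Pi.mul_apply, this, hsum, one_mul]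
  have h1 : ∫ x, gradInner g φ ψ x ∂(vol g) = ∑ i, gradForm g (χ i * φ) ψ := by
    change gradForm g φ ψ = _
    conv_lhs => rw [hφ]
    simp only [map_sum, LinearMap.sum_apply]
  have h2 : ∫ x, φ x * laplacian g ψ x ∂(vol g)
      = ∑ i, ∫ x, (χ i * φ) x * laplacian g ψ x ∂(vol g) := by
    rw [← integral_finsetSum]
    · refine integral_congr_ae (.of_forall fun x => ?_)
      simp only [ContMDiffMap.coe_mul, Pi.mul_apply, mul_assoc]
      rw [← Finset.sum_mul, hsum, one_mul]
    · exact fun i _ => integrable_of_continuous g ((χ i * φ).contMDiff.continuous.mul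
        (continuous_laplacian g ψ.contMDiff))
  rw [h1, h2, eq_neg_iff_add_eq_zero, ← Finset.sum_add_distrib]
  exact Finset.sum_eq_zero fun i _ => hloc i

end Localise

/-! ### The Sobolev inequality `W^{1,1} ⊂ L²` -/

section Sobolev11
variable {M : Type*} [TopologicalSpace M] [ChartedSpace Plane M] [IsManifold (𝓡 2) ∞ M]
  {e : OpenPartialHomeomorph M Plane}

/-- The length `|∇φ|` of the gradient. -/
def gradNorm (g : Metric M) (φ : M → ℝ) (x : M) : ℝ := √(gradInner g φ φ x)

lemma gradNorm_nonneg (g : Metric M) (φ : M → ℝ) (x : M) : 0 ≤ gradNorm g φ x :=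
  Real.sqrt_nonneg _

lemma gradNorm_sq (g : Metric M) (φ : M → ℝ) (x : M) :
    gradNorm g φ x ^ 2 = gradInner g φ φ x :=
  Real.sq_sqrt (gradInner_self_nonneg g φ x)

lemma continuous_gradNorm (g : Metric M) {φ : M → ℝ} (hφ : ContMDiff (𝓡 2) 𝓘(ℝ) ∞ φ) :
    Continuous (gradNorm g φ) :=
  (continuous_gradInner g hφ hφ).sqrt

/-- The largest eigenvalue of the metric is at most its trace. -/
lemma differential_sq_le (g : Metric M) (he : e ∈ atlas Plane M) (φ : M → ℝ) {y : Plane}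
    (hy : y ∈ e.target) : differential e φ y 0 ^ 2 + differential e φ y 1 ^ 2
      ≤ (gram g e y 0 0 + gram g e y 1 1) * gradInnerIn g e φ φ y := by
  have hd := (gram_posDef g he hy).det_pos
  obtain ⟨h00, h01, h10, h11⟩ := gram_inv_apply (e := e) g y
  simp only [gradInnerIn, Matrix.mulVec, dotProduct, Fin.sum_univ_two, h00, h01, h10, h11]
  have hdet := det_gram (e := e) g y
  generalize (gram g e y).det = D at *
  generalize differential e φ y 0 = p
  generalize differential e φ y 1 = q
  generalize gram g e y 0 0 = a at *
  generalize gram g e y 0 1 = b at *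
  generalize gram g e y 1 1 = c at *
  have h : (a + c) * (p * (D⁻¹ * c * p + -(D⁻¹ * b) * q) + q * (-(D⁻¹ * b) * p + D⁻¹ * a * q))
      = p ^ 2 + q ^ 2 + D⁻¹ * ((c * p - b * q) ^ 2 + (b * p - a * q) ^ 2) := by
    field_simp
    rw [hdet]
    ring
  rw [h]
  have := inv_pos.2 hd
  nlinarith [mul_nonneg this.le
    (add_nonneg (sq_nonneg (c * p - b * q)) (sq_nonneg (b * p - a * q)))]

lemma norm_clm_plane_le (L : Plane →L[ℝ] ℝ) :
    ‖L‖ ≤ |L (EuclideanSpace.single 0 1)| + |L (EuclideanSpace.single 1 1)| := by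
  refine L.opNorm_le_bound (by positivity) fun v => ?_
  have hdec : v = v 0 • EuclideanSpace.single 0 (1 : ℝ)
      + v 1 • EuclideanSpace.single 1 (1 : ℝ) := by
    ext i; fin_cases i <;> simp
  have h0 := PiLp.norm_apply_le v 0
  have h1 := PiLp.norm_apply_le v 1
  have hL : L v = v 0 * L (EuclideanSpace.single 0 1) + v 1 * L (EuclideanSpace.single 1 1) := by
    conv_lhs => rw [hdec]
    simp
  rw [hL, Real.norm_eq_abs]
  refine (abs_add_le _ _).trans ?_
  rw [abs_mul, abs_mul, add_mul, mul_comm |v 0|, mul_comm |v 1|]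
  gcongr
  exacts [h0, h1]

lemma gradNorm_mul_le (g : Metric M) {χ w : M → ℝ} (hχ : ContMDiff (𝓡 2) 𝓘(ℝ) ∞ χ)
    (hw : ContMDiff (𝓡 2) 𝓘(ℝ) ∞ w) (x : M) :
    gradNorm g (χ * w) x ≤ 2 * (|χ x| * gradNorm g w x + |w x| * gradNorm g χ x) := by
  obtain ⟨S, hS⟩ := exists_gram_inv_eq g x
  have hdw : ∀ {φ : M → ℝ}, ContMDiff (𝓡 2) 𝓘(ℝ) ∞ φ → DifferentiableAt ℝ
      (φ ∘ (chartAt Plane x).symm) (chartAt Plane x x) := fun hφ =>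
    ((contDiffOn_comp_symm (chart_mem_atlas Plane x) hφ).contDiffAt
      ((chartAt Plane x).open_target.mem_nhds (mem_chart_target Plane x))).differentiableAt
      (by simp)
  have hx : (chartAt Plane x).symm (chartAt Plane x x) = x :=
    (chartAt Plane x).left_inv (mem_chart_source Plane x)
  have hd : differential (chartAt Plane x) (χ * w) (chartAt Plane x x)
      = χ x • differential (chartAt Plane x) w (chartAt Plane x x)
        + w x • differential (chartAt Plane x) χ (chartAt Plane x x) := by
    ext i
    have := pd_mul (hdw hχ) (hdw hw) i
    simp only [Function.comp_apply, hx] at this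
    simp only [differential, Pi.add_apply, Pi.smul_apply, smul_eq_mul]
    refine Eq.trans this ?_
    ring
  have hq : ∀ φ : M → ℝ, gradInner g φ φ x
      = (S *ᵥ differential (chartAt Plane x) φ (chartAt Plane x x)) ⬝ᵥ
        (S *ᵥ differential (chartAt Plane x) φ (chartAt Plane x x)) := fun φ => by
    unfold gradInner gradInnerIn
    rw [hS, ← Matrix.mulVec_mulVec, Matrix.dotProduct_mulVec, Matrix.vecMul_transpose]
  have hle : gradInner g (χ * w) (χ * w) x
      ≤ 2 * (χ x ^ 2 * gradInner g w w x + w x ^ 2 * gradInner g χ χ x) := by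
    simp only [hq, hd, Matrix.mulVec_add, Matrix.mulVec_smul]
    generalize S *ᵥ differential (chartAt Plane x) w (chartAt Plane x x) = a
    generalize S *ᵥ differential (chartAt Plane x) χ (chartAt Plane x x) = b
    simp only [dotProduct, Fin.sum_univ_two, Pi.add_apply, Pi.smul_apply, smul_eq_mul]
    nlinarith [sq_nonneg (χ x * a 0 - w x * b 0), sq_nonneg (χ x * a 1 - w x * b 1)]
  have h1 := gradNorm_nonneg g w x
  have h2 := gradNorm_nonneg g χ x
  refine Real.sqrt_le_iff.2 ⟨by positivity, hle.trans ?_⟩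
  rw [← gradNorm_sq, ← gradNorm_sq, ← sq_abs (χ x), ← sq_abs (w x)]
  have h3 : 0 ≤ |χ x| * gradNorm g w x := by positivity
  have h4 : 0 ≤ |w x| * gradNorm g χ x := by positivity
  nlinarith [mul_nonneg h3 h4, sq_nonneg (|χ x| * gradNorm g w x),
    sq_nonneg (|w x| * gradNorm g χ x)]

variable [CompactSpace M] [T2Space M] [MeasurableSpace M] [BorelSpace M] (g : Metric M)
  [IsFiniteMeasure (vol g)]

/-- On functions supported in a compact subset of a chart domain the metric is comparable to the
Euclidean one, so the Gagliardo-Nirenberg-Sobolev inequality of the plane carries over. -/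
lemma exists_lintegral_sq_le_of_tsupport_subset (he : e ∈ atlas Plane M) {K : Set M}
    (hK : IsCompact K) (hKe : K ⊆ e.source) :
    ∃ C : NNReal, ∀ φ : M → ℝ, ContMDiff (𝓡 2) 𝓘(ℝ) ∞ φ → tsupport φ ⊆ K →
      ∫⁻ x, ENNReal.ofReal (φ x ^ 2) ∂(vol g)
        ≤ C * (∫⁻ x, ENNReal.ofReal (gradNorm g φ x) ∂(vol g)) ^ 2 := by
  have hKc : IsCompact (e '' K) := hK.image_of_continuousOn (e.continuousOn.mono hKe)
  have hKt : e '' K ⊆ e.target := by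
    rintro _ ⟨x, hx, rfl⟩
    exact e.map_source (hKe hx)
  have hdet := (continuousOn_sqrt_det g he).mono hKt
  obtain ⟨C₂, hC₂⟩ := hKc.bddAbove_image hdet
  have htr : ContinuousOn (fun y => √2 * √(gram g e y 0 0 + gram g e y 1 1) / √(gram g e y).det)
      (e '' K) :=
    (continuousOn_const.mul (((contDiffOn_gram g he 0 0).continuousOn.add
      (contDiffOn_gram g he 1 1).continuousOn).mono hKt).sqrt).div hdet
      fun y hy => (Real.sqrt_pos.2 (gram_posDef g he (hKt hy)).det_pos).ne'
  obtain ⟨C₁, hC₁⟩ := hKc.bddAbove_image htr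
  set C₀ := lintegralPowLePowLIntegralFDerivConst (volume : Measure Plane) 2
  refine ⟨C₂.toNNReal * C₀ * C₁.toNNReal ^ 2, fun φ hφ hs => ?_⟩
  set W : Plane → ℝ := e.target.indicator (φ ∘ e.symm) with hW
  have hWe : Set.EqOn W (φ ∘ e.symm) e.target := fun y hy => Set.indicator_of_mem hy _
  have hφ0 : ∀ y ∈ e.target, y ∉ e '' K → φ (e.symm y) = 0 := fun y hyt hy =>
    image_eq_zero_of_notMem_tsupport fun h => hy ⟨_, hs h, e.right_inv hyt⟩
  have hW0 : ∀ y ∉ e '' K, W y = 0 := by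
    intro y hy
    by_cases hyt : y ∈ e.target
    · rw [hWe hyt]
      exact hφ0 y hyt hy
    · exact Set.indicator_of_notMem hyt _
  have hWd : ContDiff ℝ ∞ W := contDiff_of_contDiffOn_of_eq_zero e.open_target hKc.isClosed hKt
    ((contDiffOn_comp_symm he hφ).congr hWe) hW0
  have hWc : HasCompactSupport W := HasCompactSupport.intro hKc hW0
  have hgns := lintegral_pow_le_pow_lintegral_fderiv (volume : Measure Plane)
    (hWd.of_le (m := 1) (by simp)) hWc (p := 2)
    (by rw [finrank_euclideanSpace, Fintype.card_fin]; exact_mod_cast Real.HolderConjugate.two_two)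
  simp only [ENNReal.rpow_two] at hgns
  -- the left side
  have h1 : ∫⁻ x, ENNReal.ofReal (φ x ^ 2) ∂(vol g) ≤ C₂.toNNReal * ∫⁻ y, ‖W y‖ₑ ^ 2 := by
    have hsupp : Function.support (fun x => ENNReal.ofReal (φ x ^ 2)) ⊆ e.source := by
      intro x hx
      by_contra hxe
      refine hx ?_
      simp [image_eq_zero_of_notMem_tsupport fun h => hxe (hKe (hs h))]
    rw [← setLIntegral_eq_of_support_subset hsupp, setLIntegral_vol g he
      (by exact (hφ.continuous.pow 2).measurable.ennreal_ofReal),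
      ← lintegral_const_mul' _ _ ENNReal.coe_ne_top]
    refine (setLIntegral_mono' e.open_target.measurableSet fun y hy => ?_).trans
      (setLIntegral_le_lintegral e.target _)
    by_cases hyK : y ∈ e '' K
    · have hn : ‖W y‖ₑ ^ 2 = ENNReal.ofReal (φ (e.symm y) ^ 2) := by
        rw [hWe hy, Function.comp_apply, ← ofReal_norm, ← ENNReal.ofReal_pow (norm_nonneg _),
          Real.norm_eq_abs, sq_abs]
      rw [hn]
      gcongr
      exact ENNReal.ofReal_le_ofReal (hC₂ ⟨y, hyK, rfl⟩)
    · simp [hφ0 y hy hyK]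
  -- the right side
  have h2 : ∫⁻ y, ‖fderiv ℝ W y‖ₑ
      ≤ C₁.toNNReal * ∫⁻ x, ENNReal.ofReal (gradNorm g φ x) ∂(vol g) := by
    have hD0 : ∀ y ∉ e '' K, ‖fderiv ℝ W y‖ₑ = 0 := by
      intro y hy
      have h2 : W =ᶠ[nhds y] fun _ => 0 :=
        Filter.eventuallyEq_of_mem (hKc.isClosed.isOpen_compl.mem_nhds hy) hW0
      have h3 : fderiv ℝ W y = 0 := by rw [h2.fderiv_eq, fderiv_fun_const]; rfl
      rw [h3, ← ofReal_norm, norm_zero, ENNReal.ofReal_zero]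
    have hsupp : Function.support (fun y => ‖fderiv ℝ W y‖ₑ) ⊆ e.target := by
      intro y hy
      by_contra hye
      exact hy (hD0 y fun h => hye (hKt h))
    refine le_trans ?_ (mul_le_mul_right (setLIntegral_le_lintegral e.source _) _)
    rw [← setLIntegral_eq_of_support_subset hsupp, setLIntegral_vol g he
      (continuous_gradNorm g hφ).measurable.ennreal_ofReal,
      ← lintegral_const_mul' _ _ ENNReal.coe_ne_top]
    refine setLIntegral_mono' e.open_target.measurableSet fun y hy => ?_
    by_cases hyK : y ∈ e '' K
    · have hfd : fderiv ℝ W y = fderiv ℝ (φ ∘ e.symm) y :=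
        (Filter.eventuallyEq_of_mem (e.open_target.mem_nhds hy) hWe).fderiv_eq
      have hgr : gradNorm g φ (e.symm y) = √(gradInnerIn g e φ φ y) := by
        rw [gradNorm, gradInner_eq g he hφ hφ (e.map_target hy), e.right_inv hy]
      have hdp := Real.sqrt_pos.2 (gram_posDef g he hy).det_pos
      have hgi : 0 ≤ gradInnerIn g e φ φ y := by
        have := gradInner_self_nonneg g φ (e.symm y)
        rwa [gradInner_eq g he hφ hφ (e.map_target hy), e.right_inv hy] at this
      have hC := hC₁ ⟨y, hyK, rfl⟩
      have hC0 : 0 ≤ C₁ := le_trans (by positivity) hC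
      have hC' : √2 * √(gram g e y 0 0 + gram g e y 1 1) ≤ C₁ * √(gram g e y).det :=
        (div_le_iff₀ hdp).1 hC
      have hkey : ‖fderiv ℝ W y‖ ≤ C₁ * (√(gram g e y).det * gradNorm g φ (e.symm y)) := by
        rw [hfd, hgr]
        refine (norm_clm_plane_le _).trans ?_
        have h3 := differential_sq_le g he φ hy
        set p := fderiv ℝ (φ ∘ e.symm) y (EuclideanSpace.single 0 1)
        set q := fderiv ℝ (φ ∘ e.symm) y (EuclideanSpace.single 1 1)
        have h4 : p ^ 2 + q ^ 2 ≤ (gram g e y 0 0 + gram g e y 1 1) * gradInnerIn g e φ φ y := h3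
        have h5 : |p| + |q|
            ≤ √(2 * ((gram g e y 0 0 + gram g e y 1 1) * gradInnerIn g e φ φ y)) := by
          refine Real.le_sqrt_of_sq_le ?_
          nlinarith [sq_abs p, sq_abs q, sq_nonneg (|p| - |q|)]
        refine h5.trans ?_
        rw [Real.sqrt_mul (by norm_num), Real.sqrt_mul' _ hgi, ← mul_assoc, ← mul_assoc]
        gcongr
      rw [← ofReal_norm, ← ENNReal.ofReal_mul hdp.le]
      refine (ENNReal.ofReal_le_ofReal hkey).trans_eq ?_
      rw [ENNReal.ofReal_mul hC0]
      rfl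
    · rw [hD0 y hyK]
      exact zero_le
  calc _ ≤ C₂.toNNReal
          * (C₀ * (C₁.toNNReal * ∫⁻ x, ENNReal.ofReal (gradNorm g φ x) ∂(vol g)) ^ 2) := by
        refine h1.trans ?_
        gcongr
        refine hgns.trans ?_
        gcongr
    _ = _ := by
        push_cast
        ring

/-- The Sobolev inequality `‖w‖_{L²} ≤ C (‖∇w‖_{L¹} + ‖w‖_{L¹})` for smooth functions. -/
theorem exists_integral_sq_le : ∃ C : ℝ, 0 < C ∧ ∀ w : C^∞⟮𝓡 2, M; ℝ⟯,
    ∫ x, w x ^ 2 ∂(vol g) ≤ C * (∫ x, (gradNorm g w x + |w x|) ∂(vol g)) ^ 2 := by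
  obtain ⟨t, χ, hχ, hsum⟩ := exists_finite_partition (M := M)
  choose C hC using fun i : t => exists_lintegral_sq_le_of_tsupport_subset g
    (chart_mem_atlas Plane (i : M)) (isClosed_tsupport (χ i)).isCompact (hχ i)
  have hloc : ∀ (i : t) (w : C^∞⟮𝓡 2, M; ℝ⟯), ∫ x, (χ i x * w x) ^ 2 ∂(vol g)
      ≤ C i * (∫ x, gradNorm g (χ i * w) x ∂(vol g)) ^ 2 := by
    intro i w
    have hsm : ContMDiff (𝓡 2) 𝓘(ℝ) ∞ (⇑(χ i) * ⇑w) := (χ i * w).contMDiff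
    have h1 := hC i (χ i * w) hsm
      (closure_mono (Function.support_mul_subset_left _ _))
    rw [← ofReal_integral_eq_lintegral_ofReal (integrable_of_continuous g
        (continuous_gradNorm g hsm)) (.of_forall fun x => gradNorm_nonneg g _ x),
      ← ofReal_integral_eq_lintegral_ofReal (integrable_of_continuous g
        (F := fun x => (⇑(χ i) * ⇑w) x ^ 2) (hsm.continuous.pow 2))
        (.of_forall fun x => sq_nonneg _),
      ← ENNReal.ofReal_pow (integral_nonneg fun x => gradNorm_nonneg g _ x),
      ← ENNReal.ofReal_coe_nnreal, ← ENNReal.ofReal_mul (by positivity),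
      ENNReal.ofReal_le_ofReal_iff (by positivity)] at h1
    exact h1
  have hbdd : ∀ i : t, ∃ B : ℝ, 0 ≤ B ∧ ∀ x, 2 * |χ i x| ≤ B ∧ 2 * gradNorm g (χ i) x ≤ B := by
    intro i
    obtain ⟨B₁, hB₁⟩ := isCompact_univ.bddAbove_image
      (continuous_const.mul (χ i).contMDiff.continuous.abs :
        Continuous fun x => 2 * |χ i x|).continuousOn
    obtain ⟨B₂, hB₂⟩ := isCompact_univ.bddAbove_image
      (continuous_const.mul (continuous_gradNorm g (χ i).contMDiff) :
        Continuous fun x => 2 * gradNorm g (χ i) x).continuousOn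
    exact ⟨max 0 (max B₁ B₂), le_max_left _ _, fun x =>
      ⟨(hB₁ ⟨x, trivial, rfl⟩).trans ((le_max_left _ _).trans (le_max_right _ _)),
        (hB₂ ⟨x, trivial, rfl⟩).trans ((le_max_right _ _).trans (le_max_right _ _))⟩⟩
  choose B hB0 hB using hbdd
  refine ⟨Fintype.card t * ∑ i, C i * B i ^ 2 + 1, ?_, fun w => ?_⟩
  · have : 0 ≤ (Fintype.card t : ℝ) * ∑ i, C i * B i ^ 2 :=
      mul_nonneg (by positivity) (Finset.sum_nonneg fun i _ => by positivity)
    linarith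
  set I := ∫ x, (gradNorm g w x + |w x|) ∂(vol g) with hI
  have hcw := w.contMDiff.continuous
  have hgw := continuous_gradNorm g w.contMDiff
  have hgrad : ∀ i, ∫ x, gradNorm g (χ i * w) x ∂(vol g) ≤ B i * I := by
    intro i
    rw [hI, ← integral_const_mul]
    refine integral_mono (integrable_of_continuous g (continuous_gradNorm g (χ i * w).contMDiff))
      (integrable_of_continuous g (continuous_const.mul (hgw.add hcw.abs))) fun x => ?_
    refine (gradNorm_mul_le g (χ i).contMDiff w.contMDiff x).trans ?_
    have h1 := mul_le_mul_of_nonneg_right (hB i x).1 (gradNorm_nonneg g w x)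
    have h2 := mul_le_mul_of_nonneg_right (hB i x).2 (abs_nonneg (w x))
    change _ ≤ B i * (gradNorm g w x + |w x|)
    linarith
  have hci : ∀ i, Integrable (fun x => (χ i x * w x) ^ 2) (vol g) := fun i =>
    integrable_of_continuous g (((χ i).contMDiff.continuous.mul hcw).pow 2)
  calc ∫ x, w x ^ 2 ∂(vol g)
      ≤ ∫ x, Fintype.card t * ∑ i, (χ i x * w x) ^ 2 ∂(vol g) := by
        refine integral_mono (integrable_of_continuous g (hcw.pow 2))
          ((integrable_finsetSum _ fun i _ => hci i).const_mul _) fun x => ?_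
        have h1 : w x = ∑ i, χ i x * w x := by rw [← Finset.sum_mul, hsum, one_mul]
        have h2 := sq_sum_le_card_mul_sum_sq (s := Finset.univ) (f := fun i => χ i x * w x)
        rw [← h1] at h2
        exact h2
    _ = Fintype.card t * ∑ i, ∫ x, (χ i x * w x) ^ 2 ∂(vol g) := by
        rw [integral_const_mul, integral_finsetSum _ fun i _ => hci i]
    _ ≤ Fintype.card t * ∑ i, C i * B i ^ 2 * I ^ 2 := by
        gcongr with i
        refine (hloc i w).trans ?_
        rw [mul_assoc, ← mul_pow]
        gcongr
        · exact integral_nonneg fun x => gradNorm_nonneg g _ x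
        · exact hgrad i
    _ ≤ _ := by
        rw [← Finset.sum_mul, ← mul_assoc, add_mul]
        have := sq_nonneg I
        linarith

end Sobolev11

/-! ### Exponential integrability of smooth functions -/

section Trudinger

/-- Outside `(0, 1)` the transition function is extremal. -/
lemma deriv_smoothTransition_eq_zero {r : ℝ} (hr : r ∉ Set.Ioo (0 : ℝ) 1) :
    deriv Real.smoothTransition r = 0 := by
  rw [Set.mem_Ioo, not_and_or, not_lt, not_lt] at hr
  rcases hr with hr | hr
  · exact IsLocalMin.deriv_eq_zero (.of_forall fun z => by
      rw [Real.smoothTransition.zero_of_nonpos hr]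
      exact Real.smoothTransition.nonneg z)
  · exact IsLocalMax.deriv_eq_zero (.of_forall fun z => by
      rw [Real.smoothTransition.one_of_one_le hr]
      exact Real.smoothTransition.le_one z)

lemma exists_abs_deriv_smoothTransition_le :
    ∃ L : ℝ, 0 < L ∧ ∀ r, |deriv Real.smoothTransition r| ≤ L := by
  have hc : Continuous (deriv Real.smoothTransition) :=
    (Real.smoothTransition.contDiff (n := 1)).continuous_deriv (by simp)
  obtain ⟨L, hL⟩ := (isCompact_Icc (a := (0 : ℝ)) (b := 1)).bddAbove_image hc.abs.continuousOn
  refine ⟨max L 1, by positivity, fun r => ?_⟩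
  by_cases hr : r ∈ Set.Icc (0 : ℝ) 1
  · exact (hL ⟨r, hr, rfl⟩).trans (le_max_left _ _)
  · rw [deriv_smoothTransition_eq_zero fun h => hr (Set.Ioo_subset_Icc_self h), abs_zero]
    positivity

/-- The Cauchy-Schwarz inequality against the constant one. -/
lemma sq_setIntegral_le {X : Type*} [MeasurableSpace X] {μ : Measure X} [IsFiniteMeasure μ]
    {f : X → ℝ} (hf : Integrable f μ) (hf2 : Integrable (fun x => f x ^ 2) μ) (S : Set X) :
    (∫ x in S, f x ∂μ) ^ 2 ≤ μ.real S * ∫ x in S, f x ^ 2 ∂μ := by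
  set m := μ.real S with hm
  set I := ∫ x in S, f x ∂μ with hI
  set F := ∫ x in S, f x ^ 2 ∂μ with hF
  have hm0 : 0 ≤ m := measureReal_nonneg
  -- expand the nonnegative integral of `(m f - I)²`, which is `m (m F - I²)`
  have h : 0 ≤ ∫ x in S, (m * f x - I) ^ 2 ∂μ := integral_nonneg fun x => sq_nonneg _
  have h2 : ∫ x in S, (m * f x - I) ^ 2 ∂μ = m ^ 2 * F - 2 * m * I * I + m * I ^ 2 := by
    have : ∀ x, (m * f x - I) ^ 2 = m ^ 2 * f x ^ 2 - 2 * m * I * f x + I ^ 2 := fun x => by ring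
    simp only [this]
    rw [integral_add, integral_sub, integral_const_mul, integral_const_mul, integral_const]
    · simp [hm, hF, hI]
    · exact hf2.restrict.const_mul _
    · exact hf.restrict.const_mul _
    · exact (hf2.restrict.const_mul _).sub (hf.restrict.const_mul _)
    · exact integrable_const _
  rw [h2] at h
  rcases hm0.eq_or_lt with h0 | h0
  · have : I = 0 := by
      rw [hI]
      apply setIntegral_measure_zero
      rw [← measureReal_eq_zero_iff]
      exact h0.symm
    rw [this, ← h0]
    simp
  · have h3 : 0 ≤ m * (m * F - I ^ 2) := by nlinarith
    have := nonneg_of_mul_nonneg_right h3 h0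
    linarith

variable {M : Type*} [TopologicalSpace M] [ChartedSpace Plane M] [IsManifold (𝓡 2) ∞ M]

lemma gradNorm_comp (g : Metric M) {h : ℝ → ℝ} (hh : Differentiable ℝ h) {φ : M → ℝ}
    (hφ : ContMDiff (𝓡 2) 𝓘(ℝ) ∞ φ) (x : M) :
    gradNorm g (fun z => h (φ z)) x = |deriv h (φ x)| * gradNorm g φ x := by
  have hd : DifferentiableAt ℝ (φ ∘ (chartAt Plane x).symm) (chartAt Plane x x) :=
    ((contDiffOn_comp_symm (chart_mem_atlas Plane x) hφ).contDiffAt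
      ((chartAt Plane x).open_target.mem_nhds (mem_chart_target Plane x))).differentiableAt
      (by simp)
  have hx : (chartAt Plane x).symm (chartAt Plane x x) = x :=
    (chartAt Plane x).left_inv (mem_chart_source Plane x)
  have h1 : differential (chartAt Plane x) (fun z => h (φ z)) (chartAt Plane x x)
      = deriv h (φ x) • differential (chartAt Plane x) φ (chartAt Plane x x) := by
    ext i
    have := ((hh _).hasDerivAt.comp_hasFDerivAt _ hd.hasFDerivAt).fderiv
    simp only [Function.comp_apply, hx] at this
    simp only [differential, pd, Pi.smul_apply, smul_eq_mul]
    exact congrArg (fun L : Plane →L[ℝ] ℝ => L (EuclideanSpace.single i 1)) this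
  unfold gradNorm gradInner gradInnerIn
  rw [h1, Matrix.mulVec_smul, smul_dotProduct, dotProduct_smul, smul_eq_mul, smul_eq_mul,
    ← mul_assoc, Real.sqrt_mul (mul_self_nonneg _), Real.sqrt_mul_self_eq_abs]

variable [CompactSpace M] [T2Space M] [MeasurableSpace M] [BorelSpace M] (g : Metric M)
  [IsFiniteMeasure (vol g)]

/-- The step from one superlevel set to the next: the Sobolev inequality for a smooth cut-off
of `u` between the levels `s` and `s + 1`. -/
lemma exists_superlevel_le : ∃ C : ℝ, 0 < C ∧ ∀ (u : C^∞⟮𝓡 2, M; ℝ⟯) (s : ℝ),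
    (vol g).real {x | s + 1 < u x} ≤ C * (vol g).real {x | s < u x} *
      (∫ x in {x | s < u x ∧ u x < s + 1}, gradInner g u u x ∂(vol g)
        + (vol g).real {x | s < u x}) := by
  obtain ⟨C, hC, hsob⟩ := exists_integral_sq_le g
  obtain ⟨L, hL, hL'⟩ := exists_abs_deriv_smoothTransition_le
  refine ⟨2 * C * max 1 (L ^ 2), by positivity, fun u s => ?_⟩
  have hu := u.contMDiff.continuous
  have hηd : Differentiable ℝ (fun r => Real.smoothTransition (r - s)) :=
    ((Real.smoothTransition.contDiff (n := 1)).differentiable (by simp)).comp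
      (differentiable_id.sub_const s)
  let w : C^∞⟮𝓡 2, M; ℝ⟯ := ⟨fun x => Real.smoothTransition (u x - s), by
    have h : ContDiff ℝ ∞ (fun r => Real.smoothTransition (r - s)) :=
      Real.smoothTransition.contDiff.comp (contDiff_id.sub contDiff_const)
    exact h.contMDiff.comp u.contMDiff⟩
  have hw : ∀ x, w x = Real.smoothTransition (u x - s) := fun x => rfl
  have hwc := w.contMDiff.continuous
  have hm1 : MeasurableSet {x | s < u x} := (isOpen_lt continuous_const hu).measurableSet
  have hm2 : MeasurableSet {x | s + 1 < u x} := (isOpen_lt continuous_const hu).measurableSet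
  have hm3 : MeasurableSet {x | s < u x ∧ u x < s + 1} :=
    ((isOpen_lt continuous_const hu).inter (isOpen_lt hu continuous_const)).measurableSet
  set S := {x | s < u x ∧ u x < s + 1} with hS
  set m := (vol g).real {x | s < u x} with hm
  set D := ∫ x in S, gradInner g u u x ∂(vol g) with hD
  have h1 : (vol g).real {x | s + 1 < u x} ≤ ∫ x, w x ^ 2 ∂(vol g) := by
    rw [← integral_indicator_one hm2]
    refine integral_mono ((integrable_const (1 : ℝ)).indicator hm2)
      (integrable_of_continuous g (hwc.pow 2)) fun x => ?_
    by_cases hx : x ∈ {x | s + 1 < u x}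
    · rw [Set.indicator_of_mem hx, hw, Real.smoothTransition.one_of_one_le]
      · simp
      · have : s + 1 < u x := hx
        linarith
    · rw [Set.indicator_of_notMem hx]
      positivity
  have h2 : ∫ x, |w x| ∂(vol g) ≤ m := by
    rw [hm, ← integral_indicator_one hm1]
    refine integral_mono (integrable_of_continuous g hwc.abs)
      ((integrable_const (1 : ℝ)).indicator hm1) fun x => ?_
    beta_reduce
    rw [hw, abs_of_nonneg (Real.smoothTransition.nonneg _)]
    by_cases hx : x ∈ {x | s < u x}
    · rw [Set.indicator_of_mem hx]
      exact Real.smoothTransition.le_one _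
    · rw [Set.indicator_of_notMem hx, Real.smoothTransition.zero_of_nonpos]
      have : ¬ s < u x := hx
      linarith
  have h3 : ∫ x, gradNorm g w x ∂(vol g) ≤ L * ∫ x in S, gradNorm g u x ∂(vol g) := by
    rw [← integral_indicator hm3, ← integral_const_mul]
    refine integral_mono (integrable_of_continuous g (continuous_gradNorm g w.contMDiff))
      (((integrable_of_continuous g (continuous_gradNorm g u.contMDiff)).indicator hm3).const_mul _)
      fun x => ?_
    have hgw : gradNorm g w x = |deriv Real.smoothTransition (u x - s)| * gradNorm g u x := by
      have := gradNorm_comp g hηd u.contMDiff x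
      rwa [deriv_comp_sub_const] at this
    beta_reduce
    rw [hgw]
    by_cases hx : x ∈ S
    · rw [Set.indicator_of_mem hx]
      exact mul_le_mul_of_nonneg_right (hL' _) (gradNorm_nonneg _ _ _)
    · rw [Set.indicator_of_notMem hx, deriv_smoothTransition_eq_zero]
      · simp
      · rintro ⟨ha, hb⟩
        exact hx ⟨by linarith, by linarith⟩
  have h4 : (∫ x in S, gradNorm g u x ∂(vol g)) ^ 2 ≤ m * D := by
    have h := sq_setIntegral_le (integrable_of_continuous g (continuous_gradNorm g u.contMDiff))
      (integrable_of_continuous g ((continuous_gradNorm g u.contMDiff).pow 2)) S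
    simp only [gradNorm_sq] at h
    refine h.trans (mul_le_mul_of_nonneg_right (measureReal_mono fun x hx => hx.1) ?_)
    exact integral_nonneg fun x => gradInner_self_nonneg g u x
  have hsum : ∫ x, (gradNorm g w x + |w x|) ∂(vol g)
      ≤ L * ∫ x in S, gradNorm g u x ∂(vol g) + m := by
    rw [integral_add (integrable_of_continuous g (continuous_gradNorm g w.contMDiff))
      (integrable_of_continuous g hwc.abs)]
    exact add_le_add h3 h2
  have h0 : 0 ≤ ∫ x, (gradNorm g w x + |w x|) ∂(vol g) :=
    integral_nonneg fun x => add_nonneg (gradNorm_nonneg _ _ _) (abs_nonneg _)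
  have hD0 : 0 ≤ D := integral_nonneg fun x => gradInner_self_nonneg g u x
  have hm0 : 0 ≤ m := measureReal_nonneg
  generalize ∫ x in S, gradNorm g u x ∂(vol g) = I at *
  have h5 : (L * I + m) ^ 2 ≤ 2 * max 1 (L ^ 2) * (m * (D + m)) := by
    have ha : (L * I + m) ^ 2 ≤ 2 * (L ^ 2 * I ^ 2 + m ^ 2) := by
      nlinarith [sq_nonneg (L * I - m)]
    have hb : L ^ 2 * I ^ 2 ≤ max 1 (L ^ 2) * (m * D) :=
      mul_le_mul (le_max_right _ _) h4 (sq_nonneg _) (by positivity)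
    have hc : m ^ 2 ≤ max 1 (L ^ 2) * m ^ 2 := le_mul_of_one_le_left (sq_nonneg _) (le_max_left _ _)
    nlinarith
  calc (vol g).real {x | s + 1 < u x} ≤ C * (∫ x, (gradNorm g w x + |w x|) ∂(vol g)) ^ 2 :=
        h1.trans (hsob w)
    _ ≤ C * (L * I + m) ^ 2 := by gcongr
    _ ≤ C * (2 * max 1 (L ^ 2) * (m * (D + m))) := by gcongr
    _ = _ := by ring

/-- Iterating the step over unit levels, the superlevel sets of `u` decay like `exp (-2 n)`, up to
a factor exponential in the Dirichlet integral: each of the increments of the levels uses a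
different part of the Dirichlet integral. -/
lemma exists_superlevel_le_exp : ∃ δ B : ℝ, 0 < δ ∧ 0 < B ∧ ∀ (u : C^∞⟮𝓡 2, M; ℝ⟯) (s : ℝ),
    (vol g).real {x | s < u x} ≤ δ → ∀ n : ℕ, (vol g).real {x | s + n < u x}
      ≤ δ * Real.exp (-2 * n + B * ∫ x, gradInner g u u x ∂(vol g)) := by
  obtain ⟨C, hC, hstep⟩ := exists_superlevel_le g
  -- for `m ≤ δ` the factor `C (D + m)` is at most `exp (-2) (1 + B D) ≤ exp (-2 + B D)`
  refine ⟨Real.exp (-2) / C, C * Real.exp 2, by positivity, by positivity, fun u s hs n => ?_⟩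
  set δ := Real.exp (-2) / C with hδ
  set B := C * Real.exp 2 with hB
  have hu := u.contMDiff.continuous
  have hint : Integrable (gradInner g u u) (vol g) :=
    integrable_of_continuous g (continuous_gradInner g u.contMDiff u.contMDiff)
  have hnn := gradInner_self_nonneg g u
  have hδ0 : 0 < δ := by positivity
  have key : ∀ n : ℕ, (vol g).real {x | s + n < u x} ≤ δ * Real.exp (-2 * n
      + B * ∫ x in {x | u x < s + n}, gradInner g u u x ∂(vol g)) := by
    intro n
    induction n with
    | zero =>
      have : 0 ≤ ∫ x in {x | u x < s + (0 : ℕ)}, gradInner g u u x ∂(vol g) :=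
        integral_nonneg hnn
      have h1 : 1 ≤ Real.exp (-2 * (0 : ℕ) + B *
          ∫ x in {x | u x < s + (0 : ℕ)}, gradInner g u u x ∂(vol g)) := by
        apply Real.one_le_exp
        have hB0 : 0 ≤ B := by positivity
        have := mul_nonneg hB0 this
        simpa using this
      have h2 : {x | s + (0 : ℕ) < u x} = {x | s < u x} := by simp
      rw [h2]
      nlinarith
    | succ n ih =>
      have h1 := hstep u (s + n)
      set m := (vol g).real {x | s + n < u x} with hm
      set D := ∫ x in {x | s + n < u x ∧ u x < s + n + 1}, gradInner g u u x ∂(vol g)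
      have hm0 : 0 ≤ m := measureReal_nonneg
      have hmδ : m ≤ δ := by
        refine (measureReal_mono fun x hx => ?_).trans hs
        have h3 : s + n < u x := hx
        have h4 : (0 : ℝ) ≤ n := n.cast_nonneg
        change s < u x
        linarith
      have hD : ∫ x in {x | u x < s + n}, gradInner g u u x ∂(vol g) + D
          ≤ ∫ x in {x | u x < s + (n + 1 : ℕ)}, gradInner g u u x ∂(vol g) := by
        have hmD : MeasurableSet {x | s + n < u x ∧ u x < s + n + 1} :=
          ((isOpen_lt continuous_const hu).inter (isOpen_lt hu continuous_const)).measurableSet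
        rw [← setIntegral_union _ hmD hint.integrableOn hint.integrableOn]
        · refine setIntegral_mono_set hint.integrableOn (.of_forall hnn)
            (.of_forall fun x hx => ?_)
          change u x < _
          push_cast
          rcases hx with hx | hx
          · have : u x < s + n := hx
            linarith
          · linarith [hx.2]
        · refine Set.disjoint_left.2 fun x hx hx' => ?_
          exact lt_asymm hx hx'.1
      have hfac : C * (D + m) ≤ Real.exp (-2 + B * D) := by
        have h3 : C * (D + m) ≤ Real.exp (-2) * (B * D + 1) := by
          have h4 : Real.exp (-2) * Real.exp 2 = 1 := by rw [← Real.exp_add]; simp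
          have h5 : C * δ = Real.exp (-2) := by rw [hδ]; field_simp
          have h6 : Real.exp (-2) * (B * D) = C * D := by
            rw [hB]
            linear_combination (C * D) * h4
          nlinarith
        refine h3.trans ?_
        rw [Real.exp_add]
        gcongr
        exact Real.add_one_le_exp _
      have h7 : {x | s + (n + 1 : ℕ) < u x} = {x | s + n + 1 < u x} := by
        push_cast
        simp only [add_assoc]
      rw [h7]
      calc _ ≤ m * (C * (D + m)) := h1.trans_eq (by ring)
        _ ≤ (δ * Real.exp (-2 * n + B * ∫ x in {x | u x < s + n}, gradInner g u u x ∂(vol g)))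
            * Real.exp (-2 + B * D) := by
            refine mul_le_mul ih hfac ?_ (by positivity)
            have : 0 ≤ D := integral_nonneg hnn
            positivity
        _ = δ * Real.exp (-2 * (n + 1 : ℕ) + B *
            (∫ x in {x | u x < s + n}, gradInner g u u x ∂(vol g) + D)) := by
            rw [mul_assoc, ← Real.exp_add]
            push_cast
            ring_nf
        _ ≤ _ := by gcongr
  refine (key n).trans ?_
  have := setIntegral_le_integral (s := {x | u x < s + n}) hint (.of_forall hnn)
  gcongr

/-- A discrete layer-cake bound for the exponential function. -/
lemma exp_le_one_add_sum (n : ℕ) {r : ℝ} (hr : r ≤ n) :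
    Real.exp r ≤ 1 + ∑ k ∈ Finset.range n, if (k : ℝ) < r then Real.exp (k + 1) else 0 := by
  induction n with
  | zero => simpa using hr
  | succ n ih =>
    rw [Finset.sum_range_succ]
    by_cases h : (n : ℝ) < r
    · rw [if_pos h]
      have h1 : 0 ≤ ∑ k ∈ Finset.range n, if (k : ℝ) < r then Real.exp (k + 1) else 0 :=
        Finset.sum_nonneg fun k _ => by split_ifs <;> positivity
      have h2 : Real.exp r ≤ Real.exp (n + 1) := by
        gcongr
        exact_mod_cast hr
      linarith
    · rw [if_neg h, add_zero]
      exact ih (not_lt.1 h)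

/-- One-sided version of the Trudinger inequality for smooth functions. -/
lemma exists_integral_exp_le : ∃ C : ℝ, 0 < C ∧ ∀ u : C^∞⟮𝓡 2, M; ℝ⟯,
    ∫ x, Real.exp (u x) ∂(vol g) ≤ C * Real.exp (C *
      (∫ x, gradInner g u u x ∂(vol g) + ∫ x, |u x| ∂(vol g))) := by
  obtain ⟨δ, B, hδ, hB, hdec⟩ := exists_superlevel_le_exp g
  set V := (vol g).real Set.univ with hV
  have hV0 : 0 ≤ V := measureReal_nonneg
  refine ⟨Real.exp 1 * (V + δ * Real.exp 1 * 2) + (B + 1 / δ), by positivity, fun u => ?_⟩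
  set D := ∫ x, gradInner g u u x ∂(vol g) with hD
  set N := ∫ x, |u x| ∂(vol g) with hN
  have hD0 : 0 ≤ D := integral_nonneg (gradInner_self_nonneg g u)
  have hN0 : 0 ≤ N := integral_nonneg fun x => abs_nonneg _
  have hu := u.contMDiff.continuous
  -- by Markov's inequality the superlevel set of `s` has measure at most `δ`; the summand `1` keeps
  -- `s` positive if `u = 0`
  set s := N / δ + 1 with hs
  have hs0 : 0 < s := by positivity
  have hms : (vol g).real {x | s < u x} ≤ δ := by
    have h1 : s * (vol g).real {x | s ≤ |u x|} ≤ N :=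
      mul_meas_ge_le_integral_of_nonneg (.of_forall fun x => abs_nonneg _)
        (integrable_of_continuous g hu.abs) s
    have h2 : (vol g).real {x | s < u x} ≤ (vol g).real {x | s ≤ |u x|} :=
      measureReal_mono fun x (hx : s < u x) => show s ≤ |u x| from hx.le.trans (le_abs_self _)
    have h3 : N ≤ s * δ := by
      rw [hs, add_mul, div_mul_cancel₀ _ hδ.ne']
      linarith
    have h4 : s * (vol g).real {x | s < u x} ≤ s * δ :=
      (mul_le_mul_of_nonneg_left h2 hs0.le).trans (h1.trans h3)
    exact le_of_mul_le_mul_left h4 hs0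
  have hdec' : ∀ k : ℕ, (vol g).real {x | s + k < u x} ≤ δ * Real.exp (-2 * k + B * D) :=
    hdec u s hms
  obtain ⟨b, hb⟩ := isCompact_univ.bddAbove_image hu.continuousOn
  obtain ⟨n, hn⟩ := exists_nat_ge (b - s)
  have hpt : ∀ x, Real.exp (u x) ≤ Real.exp s * (1 + ∑ k ∈ Finset.range n,
      Real.exp (k + 1) * {x | s + k < u x}.indicator 1 x) := by
    intro x
    have h1 := exp_le_one_add_sum n (r := u x - s)
      ((sub_le_sub_right (hb ⟨x, trivial, rfl⟩) s).trans hn)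
    have h2 : Real.exp (u x) = Real.exp s * Real.exp (u x - s) := by
      rw [← Real.exp_add]; ring_nf
    rw [h2]
    gcongr
    refine h1.trans_eq ?_
    congr 1
    refine Finset.sum_congr rfl fun k _ => ?_
    by_cases hk : s + k < u x
    · rw [if_pos (by linarith), Set.indicator_of_mem (show x ∈ {x | s + k < u x} from hk)]
      simp
    · rw [if_neg (by linarith), Set.indicator_of_notMem (show x ∉ {x | s + k < u x} from hk)]
      simp
  have hmeas : ∀ k : ℕ, MeasurableSet {x | s + k < u x} := fun k =>
    (isOpen_lt continuous_const hu).measurableSet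
  have hi : ∀ k : ℕ, Integrable (fun x => Real.exp (k + 1) *
      {x | s + k < u x}.indicator (1 : M → ℝ) x) (vol g) := fun k =>
    ((integrable_const (1 : ℝ)).indicator (hmeas k)).const_mul _
  have hgeom : ∑ k ∈ Finset.range n, Real.exp (-1) ^ k ≤ 2 := by
    have h1 : Real.exp (-1) ≤ 1 / 2 := by
      have := Real.add_one_le_exp (1 : ℝ)
      rw [Real.exp_neg, one_div]
      exact inv_anti₀ (by norm_num) (by linarith)
    refine (Finset.sum_le_sum fun k _ => pow_le_pow_left₀ (Real.exp_pos _).le h1 k).trans ?_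
    refine (Summable.sum_le_tsum _ (fun k _ => by positivity) summable_geometric_two).trans_eq ?_
    exact tsum_geometric_two
  calc ∫ x, Real.exp (u x) ∂(vol g)
      ≤ ∫ x, Real.exp s * (1 + ∑ k ∈ Finset.range n,
          Real.exp (k + 1) * {x | s + k < u x}.indicator 1 x) ∂(vol g) :=
        integral_mono (integrable_of_continuous g (Real.continuous_exp.comp hu))
          (((integrable_const _).add (integrable_finsetSum _ fun k _ => hi k)).const_mul _) hpt
    _ = Real.exp s * (V + ∑ k ∈ Finset.range n,
          Real.exp (k + 1) * (vol g).real {x | s + k < u x}) := by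
        rw [integral_const_mul, integral_add (integrable_const _)
          (integrable_finsetSum _ fun k _ => hi k), integral_finsetSum _ fun k _ => hi k]
        simp only [integral_const_mul, integral_indicator_one (hmeas _)]
        simp [hV]
    _ ≤ Real.exp s * (V + ∑ k ∈ Finset.range n,
          (δ * Real.exp (1 + B * D)) * Real.exp (-1) ^ k) := by
        refine mul_le_mul_of_nonneg_left (add_le_add_right (Finset.sum_le_sum fun k _ => ?_) _)
          (Real.exp_pos _).le
        refine (mul_le_mul_of_nonneg_left (hdec' k) (Real.exp_pos _).le).trans_eq ?_
        rw [← Real.exp_nat_mul, mul_left_comm, mul_assoc, ← Real.exp_add, ← Real.exp_add]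
        ring_nf
    _ ≤ Real.exp s * (V + (δ * Real.exp (1 + B * D)) * 2) := by
        rw [← Finset.mul_sum]
        gcongr
    _ ≤ Real.exp s * ((V + δ * Real.exp 1 * 2) * Real.exp (B * D)) := by
        have hexp : Real.exp (1 + B * D) = Real.exp 1 * Real.exp (B * D) := Real.exp_add _ _
        rw [hexp]
        have : 1 ≤ Real.exp (B * D) := Real.one_le_exp (by positivity)
        gcongr
        nlinarith
    _ = Real.exp 1 * (V + δ * Real.exp 1 * 2) * Real.exp (B * D + 1 / δ * N) := by
        rw [hs, Real.exp_add, Real.exp_add, div_eq_inv_mul, one_div]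
        ring
    _ ≤ _ := by
        have hP : 0 ≤ Real.exp 1 * (V + δ * Real.exp 1 * 2) := by positivity
        have hδ1 : 0 < 1 / δ := by positivity
        generalize Real.exp 1 * (V + δ * Real.exp 1 * 2) = P at *
        generalize 1 / δ = Q at *
        gcongr
        · linarith
        · nlinarith [mul_nonneg hP hD0, mul_nonneg hP hN0, mul_nonneg hB.le hN0,
            mul_nonneg hδ1.le hD0]

/-- The Trudinger inequality for smooth functions, with the `L¹` norm of `u` as the lower order
term. -/
theorem exists_integral_exp_abs_le : ∃ C : ℝ, 0 < C ∧ ∀ u : C^∞⟮𝓡 2, M; ℝ⟯,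
    ∫ x, Real.exp |u x| ∂(vol g) ≤ C * Real.exp (C *
      (∫ x, gradInner g u u x ∂(vol g) + ∫ x, |u x| ∂(vol g))) := by
  obtain ⟨C, hC, h⟩ := exists_integral_exp_le g
  refine ⟨2 * C, by positivity, fun u => ?_⟩
  set D := ∫ x, gradInner g u u x ∂(vol g) with hD
  set N := ∫ x, |u x| ∂(vol g) with hN
  have hD0 : 0 ≤ D := integral_nonneg (gradInner_self_nonneg g u)
  have hN0 : 0 ≤ N := integral_nonneg fun x => abs_nonneg _
  have hu := u.contMDiff.continuous
  have h1 := h u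
  have h2 := h (-u)
  have hneg : ∫ x, gradInner g (-u) (-u) x ∂(vol g) = D := by
    change gradForm g (-u) (-u) = gradForm g u u
    simp
  have e1 : ∫ x, gradInner g (⇑(-u)) (⇑(-u)) x ∂(vol g) = D := hneg
  have e2 : ∫ x, |(-u) x| ∂(vol g) = N := by
    refine integral_congr_ae (.of_forall fun x => ?_)
    exact abs_neg (u x)
  have e3 : ∫ x, Real.exp ((-u) x) ∂(vol g) = ∫ x, Real.exp (-u x) ∂(vol g) := rfl
  rw [e1, e2, e3] at h2
  calc ∫ x, Real.exp |u x| ∂(vol g) ≤ ∫ x, (Real.exp (u x) + Real.exp (-u x)) ∂(vol g) := by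
        refine integral_mono (integrable_of_continuous g (Real.continuous_exp.comp hu.abs))
          (integrable_of_continuous g ((Real.continuous_exp.comp hu).add
            (Real.continuous_exp.comp hu.neg))) fun x => ?_
        exact Real.exp_abs_le (u x)
    _ = ∫ x, Real.exp (u x) ∂(vol g) + ∫ x, Real.exp (-u x) ∂(vol g) :=
        integral_add (integrable_of_continuous g (Real.continuous_exp.comp hu))
          (integrable_of_continuous g (Real.continuous_exp.comp hu.neg))
    _ ≤ 2 * C * Real.exp (C * (D + N)) := by linarith
    _ ≤ _ := by
        gcongr
        linarith

end Trudinger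

/-! ### Sobolev functions -/

section SobolevFunctions
variable {M : Type*} [TopologicalSpace M] [ChartedSpace Plane M] [IsManifold (𝓡 2) ∞ M]
  [CompactSpace M] [MeasurableSpace M] [BorelSpace M] (g : Metric M) [IsFiniteMeasure (vol g)]

open scoped InnerProductSpace

lemma inner_toLp_eq_integral {F : M → ℝ} (hF : MemLp F 2 (vol g)) (v : L2 g) :
    ⟪hF.toLp F, v⟫_ℝ = ∫ x, F x * v x ∂(vol g) := by
  rw [L2.inner_def]
  refine integral_congr_ae ?_
  filter_upwards [hF.coeFn_toLp] with x hx
  rw [hx]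
  exact mul_comm _ _

lemma inner_eq_integral (v w : L2 g) : ⟪v, w⟫_ℝ = ∫ x, v x * w x ∂(vol g) := by
  rw [L2.inner_def]
  exact integral_congr_ae (.of_forall fun x => mul_comm _ _)

lemma coeFn_smoothToL2 (φ : C^∞⟮𝓡 2, M; ℝ⟯) : smoothToL2 g φ =ᵐ[vol g] φ :=
  ContinuousMap.coeFn_toLp _ _

lemma integral_eq_inner_one (v : L2 g) :
    ∫ x, v x ∂(vol g) = ⟪smoothToL2 g (ContMDiffMap.const 1), v⟫_ℝ := by
  rw [inner_eq_integral]
  refine integral_congr_ae ?_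
  filter_upwards [coeFn_smoothToL2 g (ContMDiffMap.const 1)] with x hx
  rw [hx]
  exact (one_mul _).symm

lemma integral_abs_eq_inner_one (v : L2 g) :
    ∫ x, |v x| ∂(vol g) = ⟪smoothToL2 g (ContMDiffMap.const 1), |v|⟫_ℝ := by
  rw [← integral_eq_inner_one]
  exact integral_congr_ae ((Lp.coeFn_abs v).mono fun x hx => hx.symm)

lemma continuous_integral_abs : Continuous fun v : L2 g => ∫ x, |v x| ∂(vol g) := by
  simp only [integral_abs_eq_inner_one]
  have : Continuous fun v : L2 g => |v| := continuous_id.sup continuous_neg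
  exact continuous_const.inner this

lemma continuous_integral_L2 : Continuous fun v : L2 g => ∫ x, v x ∂(vol g) := by
  simp only [integral_eq_inner_one]
  exact continuous_const.inner continuous_id

lemma integrable_L2 (v : L2 g) : Integrable v (vol g) := (Lp.memLp v).integrable (by norm_num)

lemma integrable_fn (u : H1 g) : Integrable (H1.fn g u) (vol g) := integrable_L2 g _

lemma memLp_fn (u : H1 g) : MemLp (H1.fn g u) 2 (vol g) := Lp.memLp _

lemma fn_add (u h : H1 g) : H1.fn g (u + h) =ᵐ[vol g] fun x => H1.fn g u x + H1.fn g h x := by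
  unfold H1.fn
  rw [map_add]
  exact Lp.coeFn_add _ _

lemma fn_smul (c : ℝ) (u : H1 g) : H1.fn g (c • u) =ᵐ[vol g] fun x => c * H1.fn g u x := by
  unfold H1.fn
  rw [map_smul]
  exact Lp.coeFn_smul _ _

lemma gradNormSq_smul (c : ℝ) (u : H1 g) : gradNormSq g (c • u) = c ^ 2 * gradNormSq g u := by
  rw [gradNormSq, gradNormSq, map_smul, norm_smul, norm_smul, mul_pow, mul_pow, Real.norm_eq_abs,
    sq_abs]
  ring

lemma continuous_gradNormSq : Continuous (gradNormSq g) :=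
  (continuous_norm.pow 2).sub (((H1.toL2 g).continuous.norm).pow 2)

lemma gradNormSq_le (u : H1 g) : gradNormSq g u ≤ ‖u‖ ^ 2 :=
  sub_le_self _ (sq_nonneg _)

lemma gradNormSq_nonneg (u : H1 g) : 0 ≤ gradNormSq g u := by
  induction u using UniformSpace.Completion.induction_on with
  | hp => exact isClosed_le continuous_const (continuous_gradNormSq g)
  | ih φ =>
    obtain ⟨φ, rfl⟩ := (WithForm.of _ (h1_isPosSemidef g)).surjective φ
    rw [gradNormSq_coe]
    exact integral_nonneg (gradInner_self_nonneg g φ)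

lemma norm_toL2_le (u : H1 g) : ‖H1.toL2 g u‖ ≤ ‖u‖ := by
  have := gradNormSq_nonneg g u
  rw [gradNormSq] at this
  exact le_of_sq_le_sq (by linarith) (norm_nonneg _)

lemma integral_abs_fn_smul (c : ℝ) (u : H1 g) :
    ∫ x, |H1.fn g (c • u) x| ∂(vol g) = |c| * ∫ x, |H1.fn g u x| ∂(vol g) := by
  rw [← integral_const_mul]
  refine integral_congr_ae ((fn_smul g c u).mono fun x hx => ?_)
  beta_reduce
  rw [hx, abs_mul]

/-- Green's formula for `a ∈ H²` and `b ∈ H¹`. -/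
theorem inner_toH1_sub [T2Space M] (a : H2 g) (b : H1 g) :
    ⟪H2.toH1 g a, b⟫_ℝ - ⟪H1.toL2 g (H2.toH1 g a), H1.toL2 g b⟫_ℝ
      = -⟪H2.laplacian g a, H1.toL2 g b⟫_ℝ := by
  induction a, b using UniformSpace.Completion.induction_on₂ with
  | hp =>
    have h1 := (H2.toH1 g).continuous.comp (continuous_fst (X := H2 g) (Y := H1 g))
    have h2 := (H1.toL2 g).continuous.comp h1
    have h3 := (H2.laplacian g).continuous.comp (continuous_fst (X := H2 g) (Y := H1 g))
    have h4 := (H1.toL2 g).continuous.comp (continuous_snd (X := H2 g) (Y := H1 g))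
    exact isClosed_eq ((h1.inner continuous_snd).sub (h2.inner h4)) (h3.inner h4).neg
  | ih φ ψ =>
    obtain ⟨φ, rfl⟩ := (WithForm.of _ (h2_isPosSemidef g)).surjective φ
    obtain ⟨ψ, rfl⟩ := (WithForm.of _ (h1_isPosSemidef g)).surjective ψ
    rw [H2.toH1_coe, H1.toL2_coe, H1.toL2_coe, H2.laplacian_coe, UniformSpace.Completion.inner_coe]
    have e1 : ⟪WithForm.of _ (h1_isPosSemidef g) φ, WithForm.of _ (h1_isPosSemidef g) ψ⟫_ℝ
        = l2Form g φ ψ + gradForm g φ ψ := rfl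
    have e2 : ⟪smoothToL2 g φ, smoothToL2 g ψ⟫_ℝ = l2Form g φ ψ := by
      rw [inner_eq_integral]
      refine integral_congr_ae ?_
      filter_upwards [coeFn_smoothToL2 g φ, coeFn_smoothToL2 g ψ] with x hx hx'
      rw [hx, hx']
    have e3 : ⟪smoothLaplacian g φ, smoothToL2 g ψ⟫_ℝ = ∫ x, ψ x * laplacian g φ x ∂(vol g) := by
      rw [inner_eq_integral]
      refine integral_congr_ae ?_
      have h : smoothLaplacian g φ =ᵐ[vol g] laplacian g φ := ContinuousMap.coeFn_toLp _ _
      filter_upwards [h, coeFn_smoothToL2 g ψ] with x hx hx'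
      rw [hx, hx', mul_comm]
    have e4 : gradForm g φ ψ = -∫ x, ψ x * laplacian g φ x ∂(vol g) := by
      rw [← integral_gradInner g ψ φ]
      exact integral_congr_ae (.of_forall (gradInner_comm g φ ψ))
    rw [e1, e2, e3, e4]
    ring

lemma integral_laplacian [T2Space M] (a : H2 g) : ∫ x, H2.laplacian g a x ∂(vol g) = 0 := by
  induction a using UniformSpace.Completion.induction_on with
  | hp =>
    exact isClosed_eq ((continuous_integral_L2 g).comp (H2.laplacian g).continuous)
      continuous_const
  | ih φ =>
    obtain ⟨φ, rfl⟩ := (WithForm.of _ (h2_isPosSemidef g)).surjective φ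
    have h : smoothLaplacian g φ =ᵐ[vol g] laplacian g φ := ContinuousMap.coeFn_toLp _ _
    rw [H2.laplacian_coe, integral_congr_ae h]
    have h1 := integral_gradInner g (ContMDiffMap.const 1) φ
    have h2 : ∀ x, gradInner g (ContMDiffMap.const 1 : C^∞⟮𝓡 2, M; ℝ⟯) φ x = 0 := by
      intro x
      have : differential (chartAt Plane x) (ContMDiffMap.const 1 : C^∞⟮𝓡 2, M; ℝ⟯)
          (chartAt Plane x x) = 0 := by
        ext i
        have h3 : ((ContMDiffMap.const 1 : C^∞⟮𝓡 2, M; ℝ⟯) ∘ (chartAt Plane x).symm)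
          = fun _ => (1 : ℝ) := rfl
        simp [differential, pd, h3]
      simp [gradInner, gradInnerIn, this]
    have h3 : ∀ x, (ContMDiffMap.const 1 : C^∞⟮𝓡 2, M; ℝ⟯) x * laplacian g φ x
      = laplacian g φ x := fun x => one_mul _
    simp only [h2, h3, integral_zero] at h1
    linarith

/-! ### The Trudinger inequality in `H¹` -/

variable [T2Space M]

/-- The Trudinger inequality on `H¹`, from the one for smooth functions by Fatou's lemma. -/
theorem exists_integral_exp_abs_fn_le : ∃ C : ℝ, 0 < C ∧ ∀ u : H1 g,
    Integrable (fun x => Real.exp |H1.fn g u x|) (vol g) ∧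
    ∫ x, Real.exp |H1.fn g u x| ∂(vol g)
      ≤ C * Real.exp (C * (gradNormSq g u + ∫ x, |H1.fn g u x| ∂(vol g))) := by
  obtain ⟨C, hC, h⟩ := exists_integral_exp_abs_le g
  refine ⟨C, hC, fun u => ?_⟩
  let bound : H1 g → ℝ := fun v =>
    C * Real.exp (C * (gradNormSq g v + ∫ x, |H1.fn g v x| ∂(vol g)))
  have hbound : Continuous bound := continuous_const.mul (Real.continuous_exp.comp
    (continuous_const.mul ((continuous_gradNormSq g).add
      ((continuous_integral_abs g).comp (H1.toL2 g).continuous))))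
  have hdense : u ∈ closure (Set.range ((↑) : SmoothH1 g → H1 g)) :=
    UniformSpace.Completion.denseRange_coe u
  obtain ⟨z, hz, hzu⟩ := mem_closure_iff_seq_limit.1 hdense
  have hz' : ∀ n, ∃ φ : C^∞⟮𝓡 2, M; ℝ⟯,
      z n = (WithForm.of _ (h1_isPosSemidef g) φ : SmoothH1 g) := by
    intro n
    obtain ⟨ψ, hψ⟩ := hz n
    obtain ⟨φ, rfl⟩ := (WithForm.of _ (h1_isPosSemidef g)).surjective ψ
    exact ⟨φ, hψ.symm⟩
  choose φ hφ using hz'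
  have hfn : ∀ n, H1.fn g (z n) =ᵐ[vol g] φ n := fun n => by
    rw [H1.fn, hφ, H1.toL2_coe]
    exact coeFn_smoothToL2 g (φ n)
  have hle : ∀ n, ∫⁻ x, ENNReal.ofReal (Real.exp |H1.fn g (z n) x|) ∂(vol g)
      ≤ ENNReal.ofReal (bound (z n)) := by
    intro n
    have e1 : ∫⁻ x, ENNReal.ofReal (Real.exp |H1.fn g (z n) x|) ∂(vol g)
        = ∫⁻ x, ENNReal.ofReal (Real.exp |φ n x|) ∂(vol g) :=
      lintegral_congr_ae ((hfn n).mono fun x hx => by beta_reduce; rw [hx])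
    have e2 : ∫ x, |H1.fn g (z n) x| ∂(vol g) = ∫ x, |φ n x| ∂(vol g) :=
      integral_congr_ae ((hfn n).mono fun x hx => by beta_reduce; rw [hx])
    rw [e1, ← ofReal_integral_eq_lintegral_ofReal (integrable_of_continuous g
      (F := fun x => Real.exp |φ n x|) (Real.continuous_exp.comp (φ n).contMDiff.continuous.abs))
      (.of_forall fun x => (Real.exp_pos _).le)]
    refine ENNReal.ofReal_le_ofReal ?_
    simp only [bound]
    rw [e2, hφ, gradNormSq_coe]
    exact h (φ n)
  have hL2 : Filter.Tendsto (fun n => H1.toL2 g (z n)) Filter.atTop (nhds (H1.toL2 g u)) :=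
    ((H1.toL2 g).continuous.tendsto u).comp hzu
  obtain ⟨ns, hns, hae⟩ := (tendstoInMeasure_of_tendsto_Lp hL2).exists_seq_tendsto_ae
  have hmeas : ∀ v : H1 g, AEMeasurable (fun x => ENNReal.ofReal (Real.exp |H1.fn g v x|))
      (vol g) := fun v => (Real.measurable_exp.comp_aemeasurable
        (integrable_fn g v).abs.aemeasurable).ennreal_ofReal
  have hfatou : ∫⁻ x, ENNReal.ofReal (Real.exp |H1.fn g u x|) ∂(vol g)
      ≤ ENNReal.ofReal (bound u) := by
    calc ∫⁻ x, ENNReal.ofReal (Real.exp |H1.fn g u x|) ∂(vol g)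
        = ∫⁻ x, Filter.liminf (fun n => ENNReal.ofReal (Real.exp |H1.fn g (z (ns n)) x|))
            Filter.atTop ∂(vol g) := by
          refine lintegral_congr_ae (hae.mono fun x hx => ?_)
          refine (Filter.Tendsto.liminf_eq ?_).symm
          exact (ENNReal.continuous_ofReal.tendsto _).comp
            ((Real.continuous_exp.tendsto _).comp hx.abs)
      _ ≤ Filter.liminf (fun n => ∫⁻ x, ENNReal.ofReal (Real.exp |H1.fn g (z (ns n)) x|) ∂(vol g))
            Filter.atTop := lintegral_liminf_le' fun n => hmeas _
      _ ≤ Filter.liminf (fun n => ENNReal.ofReal (bound (z (ns n)))) Filter.atTop :=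
          Filter.liminf_le_liminf (.of_forall fun n => hle _)
      _ = ENNReal.ofReal (bound u) := by
          refine Filter.Tendsto.liminf_eq ?_
          exact (ENNReal.continuous_ofReal.tendsto _).comp
            ((hbound.tendsto u).comp (hzu.comp hns.tendsto_atTop))
  have hint : Integrable (fun x => Real.exp |H1.fn g u x|) (vol g) :=
    ⟨(Real.measurable_exp.comp_aemeasurable
        (integrable_fn g u).abs.aemeasurable).aestronglyMeasurable, by
      rw [hasFiniteIntegral_iff_ofReal (.of_forall fun x => (Real.exp_pos _).le)]
      exact hfatou.trans_lt ENNReal.ofReal_lt_top⟩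
  refine ⟨hint, ?_⟩
  rw [← ofReal_integral_eq_lintegral_ofReal hint
    (.of_forall fun x => (Real.exp_pos _).le)] at hfatou
  have hb : 0 ≤ bound u := by positivity
  exact (ENNReal.ofReal_le_ofReal_iff hb).1 hfatou

lemma integrable_exp_abs_mul (p : ℝ) (u : H1 g) :
    Integrable (fun x => Real.exp |p * H1.fn g u x|) (vol g) := by
  obtain ⟨C, -, h⟩ := exists_integral_exp_abs_fn_le g
  refine (h (p • u)).1.congr ((fn_smul g p u).mono fun x hx => ?_)
  beta_reduce
  rw [hx]

lemma integrable_exp_mul (p : ℝ) (u : H1 g) :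
    Integrable (fun x => Real.exp (p * H1.fn g u x)) (vol g) := by
  refine (integrable_exp_abs_mul g p u).mono' ?_ (.of_forall fun x => ?_)
  · exact (Real.measurable_exp.comp_aemeasurable
      ((integrable_fn g u).const_mul p).aemeasurable).aestronglyMeasurable
  · rw [Real.norm_eq_abs, Real.abs_exp]
    exact Real.exp_le_exp.2 (le_abs_self _)

lemma exists_integral_exp_mul_le : ∃ C : ℝ, 0 < C ∧ ∀ (p : ℝ) (u : H1 g),
    ∫ x, Real.exp |p * H1.fn g u x| ∂(vol g)
      ≤ C * Real.exp (C * (p ^ 2 * gradNormSq g u + |p| * ∫ x, |H1.fn g u x| ∂(vol g))) := by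
  obtain ⟨C, hC, h⟩ := exists_integral_exp_abs_fn_le g
  refine ⟨C, hC, fun p u => ?_⟩
  have h1 := (h (p • u)).2
  rw [gradNormSq_smul, integral_abs_fn_smul] at h1
  refine le_trans (le_of_eq (integral_congr_ae ((fn_smul g p u).mono fun x hx => ?_))) h1
  beta_reduce
  rw [hx]

/-- The exponential integrals are bounded on bounded subsets of `H¹`. -/
lemma exists_integral_exp_mul_le_of_norm_le (R : ℝ) : ∃ C : ℝ, 0 < C ∧ ∀ (p : ℝ) (u : H1 g),
    |p| * ‖u‖ ≤ R → ∫ x, Real.exp |p * H1.fn g u x| ∂(vol g) ≤ C := by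
  obtain ⟨C, hC, h⟩ := exists_integral_exp_mul_le g
  set b := ‖smoothToL2 g (ContMDiffMap.const 1)‖ with hb
  refine ⟨C * Real.exp (C * (R ^ 2 + b * R)), by positivity, fun p u hp => (h p u).trans ?_⟩
  have h1 : ∫ x, |H1.fn g u x| ∂(vol g) ≤ b * ‖u‖ := by
    unfold H1.fn
    rw [integral_abs_eq_inner_one]
    refine (real_inner_le_norm _ _).trans ?_
    rw [norm_abs_eq_norm]
    gcongr
    exact norm_toL2_le g u
  have h2 := gradNormSq_le g u
  have hp0 : 0 ≤ |p| * ‖u‖ := by positivity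
  refine mul_le_mul_of_nonneg_left (Real.exp_le_exp.2 (mul_le_mul_of_nonneg_left
    (add_le_add ?_ ?_) hC.le)) hC.le
  · calc p ^ 2 * gradNormSq g u ≤ p ^ 2 * ‖u‖ ^ 2 := by gcongr
      _ = (|p| * ‖u‖) ^ 2 := by rw [mul_pow, sq_abs]
      _ ≤ R ^ 2 := by gcongr
  · calc |p| * ∫ x, |H1.fn g u x| ∂(vol g) ≤ |p| * (b * ‖u‖) := by gcongr
      _ = b * (|p| * ‖u‖) := by ring
      _ ≤ b * R := by gcongr

/-! ### Differentiability of the exponential integrals -/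

lemma abs_exp_sub_one_sub_le (y : ℝ) : |Real.exp y - 1 - y| ≤ y ^ 2 * Real.exp |y| := by
  rcases le_total |y| 1 with hy | hy
  · refine (Real.abs_exp_sub_one_sub_id_le hy).trans ?_
    exact le_mul_of_one_le_right (sq_nonneg _) (Real.one_le_exp (abs_nonneg _))
  · have h0 : 0 ≤ Real.exp y - 1 - y := by linarith [Real.add_one_le_exp y]
    have h1 : 1 ≤ y ^ 2 := by rw [← sq_abs]; nlinarith
    have h2 : 1 ≤ Real.exp |y| := Real.one_le_exp (abs_nonneg _)
    rw [abs_of_nonneg h0]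
    rcases abs_cases y with ⟨h, hy0⟩ | ⟨h, hy0⟩
    · rw [h]
      nlinarith [Real.exp_pos y]
    · have h3 : Real.exp y ≤ 1 := Real.exp_le_one_iff.2 hy0.le
      have h4 : -y ≤ y ^ 2 := by nlinarith
      nlinarith

lemma exp_add_add_le (a b c : ℝ) :
    Real.exp (a + b + c) ≤ Real.exp (3 * a) + Real.exp (3 * b) + Real.exp (3 * c) := by
  have ha := Real.exp_pos (3 * a)
  have hb := Real.exp_pos (3 * b)
  have hc := Real.exp_pos (3 * c)
  rcases le_total a b with h1 | h1 <;> rcases le_total b c with h2 | h2 <;>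
    rcases le_total a c with h3 | h3
  all_goals first
    | linarith [Real.exp_le_exp.2 (show a + b + c ≤ 3 * a by linarith)]
    | linarith [Real.exp_le_exp.2 (show a + b + c ≤ 3 * b by linarith)]
    | linarith [Real.exp_le_exp.2 (show a + b + c ≤ 3 * c by linarith)]

/-- The second order remainder of `exp (2 a)`, with the increment `b` measured on the scale `r`. -/
lemma abs_exp_remainder_le (a b : ℝ) {r : ℝ} (hr : 0 < r) :
    |Real.exp (2 * (a + b)) - Real.exp (2 * a) - 2 * (Real.exp (2 * a) * b)|
      ≤ 8 * r ^ 2 * (Real.exp |6 * a| + Real.exp |6 * b| + Real.exp |3 / r * b|) := by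
  have h1 : Real.exp (2 * (a + b)) - Real.exp (2 * a) - 2 * (Real.exp (2 * a) * b)
      = Real.exp (2 * a) * (Real.exp (2 * b) - 1 - 2 * b) := by
    rw [mul_add, Real.exp_add]; ring
  rw [h1, abs_mul, Real.abs_exp]
  have h2 : (2 * b) ^ 2 ≤ 8 * r ^ 2 * Real.exp (|b| / r) := by
    have := Real.quadratic_le_exp_of_nonneg (x := |b| / r) (by positivity)
    have h3 : (|b| / r) ^ 2 ≤ 2 * Real.exp (|b| / r) := by
      have : 0 ≤ |b| / r := by positivity
      nlinarith
    have h4 : (2 * b) ^ 2 = 4 * r ^ 2 * (|b| / r) ^ 2 := by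
      rw [div_pow, sq_abs]; field_simp; ring
    rw [h4]
    nlinarith [sq_nonneg r]
  calc Real.exp (2 * a) * |Real.exp (2 * b) - 1 - 2 * b|
      ≤ Real.exp (2 * |a|) * ((2 * b) ^ 2 * Real.exp |2 * b|) := by
        gcongr
        · exact le_abs_self a
        · exact abs_exp_sub_one_sub_le _
    _ ≤ Real.exp (2 * |a|) * ((8 * r ^ 2 * Real.exp (|b| / r)) * Real.exp |2 * b|) := by gcongr
    _ = 8 * r ^ 2 * Real.exp (2 * |a| + 2 * |b| + |b| / r) := by
        rw [abs_mul, abs_two, Real.exp_add, Real.exp_add]; ring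
    _ ≤ 8 * r ^ 2 * (Real.exp (3 * (2 * |a|)) + Real.exp (3 * (2 * |b|))
          + Real.exp (3 * (|b| / r))) := by
        gcongr
        exact exp_add_add_le _ _ _
    _ = _ := by
        rw [abs_mul 6, abs_mul 6, abs_mul (3 / r), abs_of_pos (by norm_num : (0 : ℝ) < 6),
          abs_of_pos (by positivity : 0 < 3 / r)]
        ring_nf

variable {F : M → ℝ}

lemma integrable_mul_exp (hF : Continuous F) (p : ℝ) (u : H1 g) :
    Integrable (fun x => F x * Real.exp (p * H1.fn g u x)) (vol g) := by
  obtain ⟨S, hS⟩ := isCompact_univ.bddAbove_image hF.norm.continuousOn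
  exact (integrable_exp_mul g p u).bdd_mul hF.aestronglyMeasurable
    (.of_forall fun x => hS ⟨x, trivial, rfl⟩)

lemma memLp_mul_exp (hF : Continuous F) (p : ℝ) (u : H1 g) :
    MemLp (fun x => F x * Real.exp (p * H1.fn g u x)) 2 (vol g) := by
  rw [memLp_two_iff_integrable_sq (integrable_mul_exp g hF p u).aestronglyMeasurable]
  refine (integrable_mul_exp g (hF.pow 2) (2 * p) u).congr (.of_forall fun x => ?_)
  simp only [Pi.pow_apply]
  rw [mul_pow, ← Real.exp_nat_mul]
  push_cast
  ring_nf

/-- The derivative of `u ↦ ∫ F e²ᵘ` on `H¹`. -/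
def expIntegralDeriv (hF : Continuous F) (u : H1 g) : H1 g →L[ℝ] ℝ :=
  (2 : ℝ) • ((innerSL ℝ ((memLp_mul_exp g hF 2 u).toLp _)) ∘L H1.toL2 g)

lemma expIntegralDeriv_apply (hF : Continuous F) (u h : H1 g) :
    expIntegralDeriv g hF u h
      = 2 * ∫ x, F x * Real.exp (2 * H1.fn g u x) * H1.fn g h x ∂(vol g) := by
  have := inner_toLp_eq_integral g (memLp_mul_exp g hF 2 u) (H1.toL2 g h)
  simp only [expIntegralDeriv, _root_.smul_apply, ContinuousLinearMap.comp_apply,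
    innerSL_apply_apply, smul_eq_mul, this]
  rfl

theorem hasFDerivAt_expIntegral (hF : Continuous F) (u : H1 g) :
    HasFDerivAt (fun v : H1 g => ∫ x, F x * Real.exp (2 * H1.fn g v x) ∂(vol g))
      (expIntegralDeriv g hF u) u := by
  obtain ⟨S, hS⟩ := isCompact_univ.bddAbove_image hF.abs.continuousOn
  have hS' : ∀ x, |F x| ≤ max S 0 := fun x => (hS ⟨x, trivial, rfl⟩).trans (le_max_left _ _)
  obtain ⟨C₁, hC₁, h₁⟩ := exists_integral_exp_mul_le_of_norm_le g (6 * ‖u‖)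
  obtain ⟨C₂, hC₂, h₂⟩ := exists_integral_exp_mul_le_of_norm_le g 6
  obtain ⟨C₃, hC₃, h₃⟩ := exists_integral_exp_mul_le_of_norm_le g 3
  set Q := max S 0 * (8 * (C₁ + C₂ + C₃)) with hQ
  have key : ∀ h : H1 g, ‖h‖ ≤ 1 → ‖∫ x, F x * Real.exp (2 * H1.fn g (u + h) x) ∂(vol g)
      - ∫ x, F x * Real.exp (2 * H1.fn g u x) ∂(vol g) - expIntegralDeriv g hF u h‖
      ≤ Q * ‖‖h‖ ^ 2‖ := by
    intro h hh
    rcases (norm_nonneg h).eq_or_lt with h0 | h0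
    · have : h = 0 := norm_eq_zero.1 h0.symm
      simp [this]
    · -- on the scale `r` of the increment, `h / r` stays bounded in `H¹`
      set r := ‖h‖ with hr
      have hi1 := integrable_exp_abs_mul g 6 u
      have hi2 := integrable_exp_abs_mul g 6 h
      have hi3 := integrable_exp_abs_mul g (3 / r) h
      have hiF : Integrable (fun x => F x * Real.exp (2 * H1.fn g u x) * H1.fn g h x) (vol g) :=
        (memLp_mul_exp g hF 2 u).integrable_mul (memLp_fn g h)
      rw [expIntegralDeriv_apply, ← integral_const_mul, ← integral_sub, ← integral_sub]
      · refine (norm_integral_le_of_norm_le (((hi1.add hi2).add hi3).const_mul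
          (max S 0 * (8 * r ^ 2))) ?_).trans ?_
        · filter_upwards [fn_add g u h] with x hx
          have h4 := abs_exp_remainder_le (H1.fn g u x) (H1.fn g h x) h0
          have h5 : F x * Real.exp (2 * H1.fn g (u + h) x) - F x * Real.exp (2 * H1.fn g u x)
              - 2 * (F x * Real.exp (2 * H1.fn g u x) * H1.fn g h x)
              = F x * (Real.exp (2 * (H1.fn g u x + H1.fn g h x)) - Real.exp (2 * H1.fn g u x)
                - 2 * (Real.exp (2 * H1.fn g u x) * H1.fn g h x)) := by
            rw [hx]; ring
          rw [h5, norm_mul, Real.norm_eq_abs, Real.norm_eq_abs, mul_assoc]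
          exact mul_le_mul (hS' x) h4 (abs_nonneg _) (le_max_right _ _)
        · rw [integral_const_mul]
          have e : ∫ x, (((fun x => Real.exp |6 * H1.fn g u x|) + fun x =>
              Real.exp |6 * H1.fn g h x|) + fun x => Real.exp |3 / r * H1.fn g h x|) x ∂(vol g)
              ≤ C₁ + C₂ + C₃ := by
            rw [integral_add' (hi1.add hi2) hi3, integral_add' hi1 hi2]
            refine add_le_add (add_le_add (h₁ 6 u ?_) (h₂ 6 h ?_)) (h₃ _ h ?_)
            · rw [abs_of_pos (by norm_num : (0 : ℝ) < 6)]
            · rw [abs_of_pos (by norm_num : (0 : ℝ) < 6)]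
              linarith
            · rw [abs_of_pos (by positivity : 0 < 3 / r), ← hr, div_mul_cancel₀ _ h0.ne']
          rw [hQ, Real.norm_eq_abs, abs_of_nonneg (sq_nonneg r)]
          have h6 : 0 ≤ max S 0 * (8 * r ^ 2) := by positivity
          refine (mul_le_mul_of_nonneg_left e h6).trans_eq ?_
          ring
      · exact (integrable_mul_exp g hF 2 _).sub (integrable_mul_exp g hF 2 _)
      · exact hiF.const_mul 2
      · exact integrable_mul_exp g hF 2 _
      · exact integrable_mul_exp g hF 2 _
  rw [hasFDerivAt_iff_isLittleO_nhds_zero]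
  refine Asymptotics.IsBigO.trans_isLittleO (g := fun h : H1 g => ‖h‖ ^ 2)
    (Asymptotics.IsBigO.of_bound Q ?_) (Asymptotics.isLittleO_norm_pow_id one_lt_two)
  filter_upwards [Metric.closedBall_mem_nhds (0 : H1 g) one_pos] with h hh
  exact key h (by simpa using hh)

lemma continuous_expIntegral (hF : Continuous F) :
    Continuous (fun v : H1 g => ∫ x, F x * Real.exp (2 * H1.fn g v x) ∂(vol g)) :=
  continuous_iff_continuousAt.2 fun u => (hasFDerivAt_expIntegral g hF u).continuousAt

end SobolevFunctions

/-! ### The flow -/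

section Flow
variable {M : Type*} [TopologicalSpace M] [ChartedSpace Plane M] [IsManifold (𝓡 2) ∞ M]
  [CompactSpace M] [T2Space M] [MeasurableSpace M] [BorelSpace M] {g : Metric M}

open scoped InnerProductSpace

section Finite
variable [IsFiniteMeasure (vol g)] {K A T : ℝ} {f : C^∞⟮𝓡 2, M; ℝ⟯} {u₀ : H1 g} {u : ℝ → H1 g}

lemma abs_le_supNorm (f : C^∞⟮𝓡 2, M; ℝ⟯) : ∀ᵐ x ∂(vol g), |f x| ≤ supNorm g f := by
  obtain ⟨S, hS⟩ := isCompact_univ.bddAbove_image f.contMDiff.continuous.norm.continuousOn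
  have hf : MemLp f ⊤ (vol g) := memLp_top_of_bound f.contMDiff.continuous.aestronglyMeasurable S
    (.of_forall fun x => hS ⟨x, trivial, rfl⟩)
  have h := ae_le_eLpNormEssSup (f := f) (μ := vol g)
  rw [← eLpNorm_exponent_top] at h
  filter_upwards [h] with x hx
  have := ENNReal.toReal_mono hf.eLpNorm_ne_top hx
  simpa [supNorm] using this

lemma supNorm_nonneg (f : C^∞⟮𝓡 2, M; ℝ⟯) : 0 ≤ supNorm g f := ENNReal.toReal_nonneg

lemma abs_integral_mul_exp_le (f : C^∞⟮𝓡 2, M; ℝ⟯) (u : H1 g) :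
    |∫ x, f x * Real.exp (2 * H1.fn g u x) ∂(vol g)|
      ≤ supNorm g f * ∫ x, Real.exp (2 * H1.fn g u x) ∂(vol g) := by
  rw [← integral_const_mul, ← Real.norm_eq_abs]
  refine norm_integral_le_of_norm_le ((integrable_exp_mul g 2 u).const_mul _) ?_
  filter_upwards [abs_le_supNorm (g := g) f] with x hx
  rw [norm_mul, Real.norm_eq_abs, Real.norm_eq_abs, Real.abs_exp]
  gcongr

/-- The flow equation multiplied by `e²ᵘ`, with `a` the function `u(t)` in `H²` and `w = ∂ₜu(t)`. -/
lemma IsFlowSolution.exists_hasDerivAt (h : IsFlowSolution g K A f u₀ T u) {t : ℝ}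
    (ht : t ∈ Set.Ioo 0 T) : ∃ (a : H2 g) (w : H1 g), H2.toH1 g a = u t ∧ HasDerivAt u w t ∧
      ∀ᵐ x ∂(vol g), Real.exp (2 * H1.fn g (u t) x) * H1.fn g w x
        = f x * Real.exp (2 * H1.fn g (u t) x) + H2.laplacian g a x - K
          - alpha g K A f (u t) * Real.exp (2 * H1.fn g (u t) x) := by
  obtain ⟨v, hv, hvu, heq⟩ := h.equation
  have hnhds : Set.Ioo 0 T ∈ nhds t := isOpen_Ioo.mem_nhds ht
  have hvd : HasDerivAt v (deriv v t) t :=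
    ((hv.contDiffAt hnhds).differentiableAt (by simp)).hasDerivAt
  refine ⟨v t, H2.toH1 g (deriv v t), hvu t ht, ?_, ?_⟩
  · refine ((H2.toH1 g).hasFDerivAt.comp_hasDerivAt t hvd).congr_of_eventuallyEq ?_
    filter_upwards [hnhds] with s hs
    exact (hvu s hs).symm
  · filter_upwards [heq t ht] with x hx
    rw [hx, conformalCurvature, hvu t ht]
    have : Real.exp (2 * H1.fn g (u t) x) * Real.exp (-2 * H1.fn g (u t) x) = 1 := by
      rw [← Real.exp_add]; simp
    linear_combination (-(-(H2.laplacian g (v t) : M → ℝ) x + K)) * this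

lemma hasDerivAt_volume {w : H1 g} {t : ℝ} (hu : HasDerivAt u w t) :
    HasDerivAt (fun t => ∫ x, Real.exp (2 * H1.fn g (u t) x) ∂(vol g))
      (2 * ∫ x, Real.exp (2 * H1.fn g (u t) x) * H1.fn g w x ∂(vol g)) t := by
  have h := (hasFDerivAt_expIntegral g (F := fun _ => 1) continuous_const
    (u t)).comp_hasDerivAt t hu
  rw [expIntegralDeriv_apply] at h
  simpa only [one_mul, Function.comp_def] using h

lemma continuous_volume :
    Continuous (fun z : H1 g => ∫ x, Real.exp (2 * H1.fn g z x) ∂(vol g)) := by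
  simpa using continuous_expIntegral g (F := fun _ => 1) continuous_const

lemma continuous_alpha : Continuous (alpha g K A f) :=
  continuous_const.mul ((continuous_expIntegral g f.contMDiff.continuous).sub continuous_const)

lemma integral_const_mul_fn (z : H1 g) :
    ∫ x, 2 * K * H1.fn g z x ∂(vol g) = 2 * K * mean g z := integral_const_mul _ _

lemma continuous_mean : Continuous (mean g) :=
  (continuous_integral_L2 g).comp (H1.toL2 g).continuous

lemma continuous_energy : Continuous (energy g K f) := by
  unfold energy
  simp only [integral_const_mul_fn]
  exact continuous_const.mul (((continuous_gradNormSq g).add (continuous_const.mul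
    continuous_mean)).sub (continuous_expIntegral g f.contMDiff.continuous))

lemma hasDerivAt_mean {w : H1 g} {t : ℝ} (hu : HasDerivAt u w t) :
    HasDerivAt (fun t => mean g (u t)) (∫ x, H1.fn g w x ∂(vol g)) t := by
  have h1 := (innerSL ℝ (smoothToL2 g (ContMDiffMap.const 1))).hasFDerivAt.comp_hasDerivAt t
    ((H1.toL2 g).hasFDerivAt.comp_hasDerivAt t hu)
  have h2 : ∀ z : H1 g, ∫ x, H1.fn g z x ∂(vol g)
      = ⟪smoothToL2 g (ContMDiffMap.const 1), H1.toL2 g z⟫_ℝ := fun z =>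
    integral_eq_inner_one g (H1.toL2 g z)
  simp only [mean, h2]
  exact h1

lemma hasDerivAt_gradNormSq {a : H2 g} {w : H1 g} {t : ℝ} (ha : H2.toH1 g a = u t)
    (hu : HasDerivAt u w t) : HasDerivAt (fun t => gradNormSq g (u t))
      (-2 * ∫ x, H2.laplacian g a x * H1.fn g w x ∂(vol g)) t := by
  have h1 := hu.norm_sq.sub ((H1.toL2 g).hasFDerivAt.comp_hasDerivAt t hu).norm_sq
  refine h1.congr_deriv ?_
  have h2 := inner_toH1_sub g a w
  rw [ha, inner_eq_integral g (H2.laplacian g a)] at h2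
  simp only [Function.comp_apply]
  unfold H1.fn
  linear_combination 2 * h2

lemma hasDerivAt_energy {a : H2 g} {w : H1 g} {t : ℝ} (ha : H2.toH1 g a = u t)
    (hu : HasDerivAt u w t) : HasDerivAt (fun t => energy g K f (u t))
      (-(∫ x, H2.laplacian g a x * H1.fn g w x ∂(vol g)) + K * ∫ x, H1.fn g w x ∂(vol g)
        - ∫ x, f x * Real.exp (2 * H1.fn g (u t) x) * H1.fn g w x ∂(vol g)) t := by
  have h1 := (hasFDerivAt_expIntegral g f.contMDiff.continuous (u t)).comp_hasDerivAt t hu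
  rw [expIntegralDeriv_apply] at h1
  have h2 := (((hasDerivAt_gradNormSq ha hu).add ((hasDerivAt_mean hu).const_mul (2 * K))).sub
    h1).const_mul (1 / 2)
  simp only [energy, integral_const_mul_fn]
  refine h2.congr_deriv ?_
  ring

end Finite

variable [IsProbabilityMeasure (vol g)] {K A T : ℝ} {f : C^∞⟮𝓡 2, M; ℝ⟯} {u₀ : H1 g}
  {u : ℝ → H1 g}

/-- `∫ e²ᵘ ∂ₜu = α (A - ∫ e²ᵘ)`. -/
lemma integral_exp_mul_eq (hA : 0 < A) (z w : H1 g) (a : H2 g)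
    (heq : ∀ᵐ x ∂(vol g), Real.exp (2 * H1.fn g z x) * H1.fn g w x
        = f x * Real.exp (2 * H1.fn g z x) + H2.laplacian g a x - K
          - alpha g K A f z * Real.exp (2 * H1.fn g z x)) :
    ∫ x, Real.exp (2 * H1.fn g z x) * H1.fn g w x ∂(vol g)
      = alpha g K A f z * (A - ∫ x, Real.exp (2 * H1.fn g z x) ∂(vol g)) := by
  have h1 := integrable_mul_exp g f.contMDiff.continuous 2 z
  have h2 := integrable_L2 g (H2.laplacian g a)
  have h3 := integrable_exp_mul g 2 z
  rw [integral_congr_ae heq, integral_sub, integral_sub, integral_add h1 h2, integral_laplacian,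
    integral_const_mul, integral_const]
  · have : alpha g K A f z * A = ∫ x, f x * Real.exp (2 * H1.fn g z x) ∂(vol g) - K := by
      rw [alpha]; field_simp
    simp only [probReal_univ, one_smul]
    linear_combination -this
  · exact h1.add h2
  · exact integrable_const _
  · exact (h1.add h2).sub (integrable_const _)
  · exact h3.const_mul _

/-- The volume `V` solves the linear equation `V' = 2α (A - V)`, so it stays at `A`. -/
theorem IsFlowSolution.integral_exp_eq (h : IsFlowSolution g K A f u₀ T u) (hA : 0 < A)
    (hu₀ : ∫ x, Real.exp (2 * H1.fn g u₀ x) ∂(vol g) = A) {t : ℝ} (ht : t ∈ Set.Ico 0 T) :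
    ∫ x, Real.exp (2 * H1.fn g (u t) x) ∂(vol g) = A := by
  set V : ℝ → ℝ := fun t => ∫ x, Real.exp (2 * H1.fn g (u t) x) ∂(vol g) with hV
  have hsub : Set.Icc 0 t ⊆ Set.Ico 0 T := fun s hs => ⟨hs.1, hs.2.trans_lt ht.2⟩
  have hcu : ContinuousOn u (Set.Icc 0 t) := h.continuousOn.mono hsub
  have hcV : ContinuousOn V (Set.Icc 0 t) := continuous_volume.comp_continuousOn hcu
  obtain ⟨m, hm⟩ := isCompact_Icc.bddAbove_image
    ((continuous_alpha (K := K) (A := A) (f := f)).comp_continuousOn hcu).neg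
  -- the weight `exp (-4 m s)` with `-α ≤ m` makes the squared deviation nonincreasing
  let z : ℝ → ℝ := fun s => (V s - A) ^ 2 * Real.exp (-4 * m * s)
  have hz : ∀ s ∈ Set.Ioo 0 t, ∃ d ≤ 0, HasDerivAt z d s := by
    intro s hs
    obtain ⟨a, w, -, hw, heq⟩ := h.exists_hasDerivAt ⟨hs.1, hs.2.trans ht.2⟩
    have hd := hasDerivAt_volume hw
    rw [integral_exp_mul_eq hA (u s) w a heq] at hd
    have hexp : HasDerivAt (fun s => Real.exp (-4 * m * s))
        (Real.exp (-4 * m * s) * (-4 * m * 1)) s :=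
      ((hasDerivAt_id s).const_mul (-4 * m)).exp
    refine ⟨_, ?_, ((hd.sub_const A).pow 2).mul hexp⟩
    have hα : -alpha g K A f (u s) ≤ m := hm ⟨s, ⟨hs.1.le, hs.2.le⟩, rfl⟩
    have hE := Real.exp_pos (-4 * m * s)
    have h0 : 0 ≤ (V s - A) ^ 2 * Real.exp (-4 * m * s) := by positivity
    have h1 := mul_le_mul_of_nonneg_right hα h0
    simp only [Pi.pow_apply]
    push_cast
    change 2 * (V s - A) ^ (2 - 1) * (2 * (alpha g K A f (u s) * (A - V s)))
      * Real.exp (-4 * m * s) + (V s - A) ^ 2 * (Real.exp (-4 * m * s) * (-4 * m * 1)) ≤ 0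
    have h2 : 2 * (V s - A) ^ (2 - 1) * (2 * (alpha g K A f (u s) * (A - V s)))
      * Real.exp (-4 * m * s) + (V s - A) ^ 2 * (Real.exp (-4 * m * s) * (-4 * m * 1))
      = 4 * (-alpha g K A f (u s) * ((V s - A) ^ 2 * Real.exp (-4 * m * s))
        - m * ((V s - A) ^ 2 * Real.exp (-4 * m * s))) := by
      norm_num
      ring
    rw [h2]
    linarith
  have hanti : AntitoneOn z (Set.Icc 0 t) := by
    refine antitoneOn_of_deriv_nonpos (convex_Icc 0 t)
      (((hcV.sub continuousOn_const).pow 2).mul (by fun_prop)) ?_ ?_ <;> rw [interior_Icc]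
    · intro s hs
      obtain ⟨d, -, hd⟩ := hz s hs
      exact hd.differentiableAt.differentiableWithinAt
    · intro s hs
      obtain ⟨d, hd0, hd⟩ := hz s hs
      rwa [hd.deriv]
  have h1 := hanti (Set.left_mem_Icc.2 ht.1) (Set.right_mem_Icc.2 ht.1) ht.1
  have h0 : z 0 = 0 := by
    simp only [z, hV, h.initial, hu₀]
    simp
  rw [h0] at h1
  have h2 : (V t - A) ^ 2 ≤ 0 := nonpos_of_mul_nonpos_left h1 (Real.exp_pos _)
  have h3 : V t - A = 0 := by
    have := le_antisymm h2 (sq_nonneg _)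
    exact pow_eq_zero_iff two_ne_zero |>.1 this
  linarith

/-- The energy decreases along the flow, at the rate `∫ e²ᵘ (∂ₜu)²`. -/
theorem IsFlowSolution.antitoneOn_energy (h : IsFlowSolution g K A f u₀ T u) (hA : 0 < A)
    (hu₀ : ∫ x, Real.exp (2 * H1.fn g u₀ x) ∂(vol g) = A) :
    AntitoneOn (fun t => energy g K f (u t)) (Set.Ico 0 T) := by
  have key : ∀ t ∈ Set.Ioo 0 T, ∃ d ≤ 0, HasDerivAt (fun t => energy g K f (u t)) d t := by
    intro t ht
    obtain ⟨a, w, ha, hw, heq⟩ := h.exists_hasDerivAt ht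
    refine ⟨_, ?_, hasDerivAt_energy ha hw⟩
    have hV := integral_exp_mul_eq hA (u t) w a heq
    rw [h.integral_exp_eq hA hu₀ ⟨ht.1.le, ht.2⟩, sub_self, mul_zero] at hV
    -- this integral is the rate of decrease
    have hnn : 0 ≤ ∫ x, Real.exp (2 * H1.fn g (u t) x) * H1.fn g w x * H1.fn g w x ∂(vol g) :=
      integral_nonneg fun x => by
        simp only [Pi.zero_apply, mul_assoc]
        exact mul_nonneg (Real.exp_pos _).le (mul_self_nonneg _)
    have hI1 : Integrable (fun x => f x * Real.exp (2 * H1.fn g (u t) x) * H1.fn g w x) (vol g) :=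
      (memLp_mul_exp g f.contMDiff.continuous 2 (u t)).integrable_mul (memLp_fn g w)
    have hI2 : Integrable (fun x => H2.laplacian g a x * H1.fn g w x) (vol g) :=
      (Lp.memLp (H2.laplacian g a)).integrable_mul (memLp_fn g w)
    have hI3 : Integrable (fun x => Real.exp (2 * H1.fn g (u t) x) * H1.fn g w x) (vol g) := by
      have := (memLp_mul_exp g (F := fun _ => 1) continuous_const 2 (u t)).integrable_mul
        (memLp_fn g w)
      refine this.congr (.of_forall fun x => ?_)
      simp
    have hI4 := integrable_fn g w
    have hid : ∫ x, Real.exp (2 * H1.fn g (u t) x) * H1.fn g w x * H1.fn g w x ∂(vol g)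
        = ∫ x, f x * Real.exp (2 * H1.fn g (u t) x) * H1.fn g w x ∂(vol g)
          + ∫ x, H2.laplacian g a x * H1.fn g w x ∂(vol g) - K * ∫ x, H1.fn g w x ∂(vol g)
          - alpha g K A f (u t) * ∫ x, Real.exp (2 * H1.fn g (u t) x) * H1.fn g w x ∂(vol g) := by
      rw [← integral_const_mul, ← integral_const_mul, ← integral_add hI1 hI2, ← integral_sub,
        ← integral_sub]
      · refine integral_congr_ae (heq.mono fun x hx => ?_)
        linear_combination H1.fn g w x * hx
      · exact (hI1.add hI2).sub (hI4.const_mul K)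
      · exact hI3.const_mul _
      · exact hI1.add hI2
      · exact hI4.const_mul K
    rw [hV] at hid
    linarith
  refine antitoneOn_of_deriv_nonpos (convex_Ico 0 T)
    (continuous_energy.comp_continuousOn h.continuousOn) ?_ ?_ <;> rw [interior_Ico]
  · intro s hs
    obtain ⟨d, -, hd⟩ := key s hs
    exact hd.differentiableAt.differentiableWithinAt
  · intro s hs
    obtain ⟨d, hd0, hd⟩ := key s hs
    rwa [hd.deriv]

/-- As `∫ e²ᵘ = A`, adding `c` to `f` adds `c` to `α`. -/
lemma IsFlowSolution.add_const (h : IsFlowSolution g K A f u₀ T u) (hA : 0 < A)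
    (hu₀ : ∫ x, Real.exp (2 * H1.fn g u₀ x) ∂(vol g) = A) (c : ℝ) :
    IsFlowSolution g K A (f + ContMDiffMap.const c) u₀ T u := by
  refine ⟨h.continuousOn, h.initial, ?_⟩
  obtain ⟨v, hv, hvu, heq⟩ := h.equation
  refine ⟨v, hv, hvu, fun t ht => ?_⟩
  have hα : alpha g K A (f + ContMDiffMap.const c) (u t) = alpha g K A f (u t) + c := by
    have h1 : ∫ x, (f + ContMDiffMap.const c : C^∞⟮𝓡 2, M; ℝ⟯) x
          * Real.exp (2 * H1.fn g (u t) x) ∂(vol g)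
        = ∫ x, f x * Real.exp (2 * H1.fn g (u t) x) ∂(vol g) + c * A := by
      rw [← h.integral_exp_eq hA hu₀ ⟨ht.1.le, ht.2⟩, ← integral_const_mul,
        ← integral_add (integrable_mul_exp g f.contMDiff.continuous 2 (u t))
          ((integrable_exp_mul g 2 (u t)).const_mul c)]
      refine integral_congr_ae (.of_forall fun x => ?_)
      exact add_mul (f x) c _
    rw [alpha, alpha, h1]
    field_simp
    ring
  filter_upwards [heq t ht] with x hx
  rw [hx, hα]
  change _ = f x + c - _ - _
  ring

/-- Jensen's inequality for the exponential function. -/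
lemma exp_mean_le (z : H1 g) :
    Real.exp (2 * mean g z) ≤ ∫ x, Real.exp (2 * H1.fn g z x) ∂(vol g) := by
  have h1 : ∫ x, Real.exp (2 * mean g z) * (2 * H1.fn g z x - 2 * mean g z + 1) ∂(vol g)
      = Real.exp (2 * mean g z) := by
    rw [integral_const_mul, integral_add, integral_sub, integral_const_mul]
    · simp [mean]
    · exact (integrable_fn g z).const_mul 2
    · exact integrable_const _
    · exact ((integrable_fn g z).const_mul 2).sub (integrable_const _)
    · exact integrable_const _
  rw [← h1]
  refine integral_mono (((((integrable_fn g z).const_mul 2).sub (integrable_const _)).add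
    (integrable_const _)).const_mul _) (integrable_exp_mul g 2 z) fun x => ?_
  have h2 : Real.exp (2 * H1.fn g z x) = Real.exp (2 * mean g z)
      * Real.exp (2 * H1.fn g z x - 2 * mean g z) := by
    rw [← Real.exp_add]; ring_nf
  beta_reduce
  rw [h2]
  gcongr
  exact Real.add_one_le_exp _

/-- The `L¹` norm is controlled by the volume and the mean, by `|y| ≤ e²ʸ - y`. -/
lemma integral_abs_fn_le (z : H1 g) : ∫ x, |H1.fn g z x| ∂(vol g)
    ≤ ∫ x, Real.exp (2 * H1.fn g z x) ∂(vol g) - mean g z := by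
  rw [mean, ← integral_sub (integrable_exp_mul g 2 z) (integrable_fn g z)]
  refine integral_mono (integrable_fn g z).abs
    ((integrable_exp_mul g 2 z).sub (integrable_fn g z)) fun x => ?_
  beta_reduce
  rcases abs_cases (H1.fn g z x) with ⟨h, -⟩ | ⟨h, -⟩ <;> rw [h]
  · linarith [Real.add_one_le_exp (2 * H1.fn g z x)]
  · linarith [Real.exp_pos (2 * H1.fn g z x)]

lemma energy_eq (z : H1 g) : energy g K f z = (1 / 2) * (gradNormSq g z + 2 * K * mean g z
    - ∫ x, f x * Real.exp (2 * H1.fn g z x) ∂(vol g)) := by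
  rw [energy, integral_const_mul_fn]

/-- The energy inequality `E_f(u(t)) ≤ E_f(u₀)` with the terms `∫ f e²ᵘ` estimated by the volume. -/
lemma IsFlowSolution.gradNormSq_add_le (h : IsFlowSolution g K A f u₀ T u) (hA : 0 < A)
    (hu₀ : ∫ x, Real.exp (2 * H1.fn g u₀ x) ∂(vol g) = A) {t : ℝ} (ht : t ∈ Set.Ico 0 T) :
    gradNormSq g (u t) + 2 * K * mean g (u t)
      ≤ gradNormSq g u₀ + 2 * K * mean g u₀ + 2 * A * supNorm g f := by
  have h1 := h.antitoneOn_energy hA hu₀ (Set.left_mem_Ico.2 (ht.1.trans_lt ht.2)) ht ht.1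
  simp only [h.initial, energy_eq] at h1
  have h2 := (abs_le.1 (abs_integral_mul_exp_le f (u t))).2
  have h3 := (abs_le.1 (abs_integral_mul_exp_le f u₀)).1
  rw [h.integral_exp_eq hA hu₀ ht] at h2
  rw [hu₀] at h3
  linarith

end Flow

end Surface
end

theorem mainTheorem7 {M : Type*} [TopologicalSpace M] [ChartedSpace Surface.Plane M]
    [IsManifold (𝓡 2) ∞ M] [CompactSpace M] [T2Space M] [ConnectedSpace M]
    [MeasurableSpace M] [BorelSpace M]
    (g : Surface.Metric M) [IsProbabilityMeasure (Surface.vol g)]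
    (K : ℝ) (hK : ∀ x : M, Surface.gaussCurvature g x = K) (hK_neg : K < 0)
    (A : ℝ) (hA : 0 < A) (u₀ : Surface.H1 g) (hu₀ : u₀ ∈ Surface.volumeClass g A) :
    ∃ (c₀ c₁ m₀ m₁ : ℝ) (ν₀ ν₁ : ℝ → ℝ),
      0 < c₀ ∧ 0 < c₁ ∧ 0 < m₁ ∧ (∀ p, 0 < ν₀ p ∧ 0 < ν₁ p) ∧
      ∀ (T : ℝ) (f : C^∞⟮𝓡 2, M; ℝ⟯) (u : ℝ → Surface.H1 g), 0 < T →
        Surface.IsFlowSolution g K A f u₀ T u →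
        -- the volume is preserved
        (∀ t ∈ Set.Ico 0 T, u t ∈ Surface.volumeClass g A) ∧
        -- `α` is bounded
        (∀ t ∈ Set.Ico 0 T,
          |Surface.alpha g K A f (u t)| ≤ Surface.supNorm g f + |K| / A) ∧
        -- the equation is invariant under adding constants to `f`
        (∀ c : ℝ, Surface.IsFlowSolution g K A (f + ContMDiffMap.const c) u₀ T u) ∧
        -- the energy is nonincreasing
        (AntitoneOn (fun t => Surface.energy g K f (u t)) (Set.Ico 0 T) ∧
          ∀ t ∈ Set.Ico 0 T, Surface.energy g K f (u t) ≤ Surface.energy g K f u₀) ∧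
        -- the gradient is bounded
        (∀ t ∈ Set.Ico 0 T,
          Surface.gradNormSq g (u t) ≤ c₀ + c₁ * Surface.supNorm g f) ∧
        -- the mean is bounded
        (∀ t ∈ Set.Ico 0 T,
          m₀ - m₁ * Surface.supNorm g f ≤ Surface.mean g (u t) ∧
            Surface.mean g (u t) ≤ (1 / 2) * Real.log A) ∧
        -- exponential integrals are bounded
        (∀ p : ℝ, ∀ t ∈ Set.Ico 0 T,
          Integrable (fun x => Real.exp (2 * p * Surface.H1.fn g (u t) x)) (Surface.vol g) ∧
            ∫ x, Real.exp (2 * p * Surface.H1.fn g (u t) x) ∂(Surface.vol g)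
              ≤ ν₀ p * Real.exp (ν₁ p * Surface.supNorm g f)) := by
  obtain ⟨C, hC, htr⟩ := Surface.exists_integral_exp_mul_le g
  set B := Surface.gradNormSq g u₀ + 2 * K * Surface.mean g u₀ with hB
  refine ⟨|B - K * Real.log A| + 1, 2 * A, B / (2 * K), -A / K,
    fun p => C * Real.exp (C * ((2 * p) ^ 2 * (|B - K * Real.log A| + 1)
      + |2 * p| * (A - B / (2 * K)))),
    fun p => |C * ((2 * p) ^ 2 * (2 * A) + |2 * p| * (-A / K))| + 1, by positivity, by positivity,
    div_pos_of_neg_of_neg (by linarith) hK_neg, fun p => ⟨by positivity, by positivity⟩, ?_⟩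
  intro T f u hT h
  have hvol := fun t ht => h.integral_exp_eq (t := t) hA hu₀.2 ht
  have hanti := h.antitoneOn_energy hA hu₀.2
  have hS := Surface.supNorm_nonneg (g := g) f
  set S := Surface.supNorm g f with hSdef
  have hupper : ∀ t ∈ Set.Ico 0 T, Surface.mean g (u t) ≤ (1 / 2) * Real.log A := by
    intro t ht
    have h1 := Surface.exp_mean_le (u t)
    rw [hvol t ht, ← Real.le_log_iff_exp_le hA] at h1
    linarith
  -- `-2Kū` is bounded above, as `K < 0`
  have hgrad : ∀ t ∈ Set.Ico 0 T,
      Surface.gradNormSq g (u t) ≤ |B - K * Real.log A| + 1 + 2 * A * S := by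
    intro t ht
    have h1 := h.gradNormSq_add_le hA hu₀.2 ht
    have h2 := mul_le_mul_of_nonpos_left (hupper t ht) hK_neg.le
    linarith [le_abs_self (B - K * Real.log A)]
  -- dropping the gradient term and dividing by `2K < 0`
  have hlower : ∀ t ∈ Set.Ico 0 T, B / (2 * K) - -A / K * S ≤ Surface.mean g (u t) := by
    intro t ht
    have h1 := h.gradNormSq_add_le hA hu₀.2 ht
    have h2 := Surface.gradNormSq_nonneg g (u t)
    have h3 : B / (2 * K) - -A / K * S = (B + 2 * A * S) / (2 * K) := by
      field_simp
      ring
    rw [h3, div_le_iff_of_neg (by linarith)]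
    linarith
  refine ⟨fun t ht => ⟨Surface.integrable_exp_mul g 2 (u t), hvol t ht⟩, ?_,
    h.add_const hA hu₀.2, ⟨hanti, ?_⟩, hgrad, fun t ht => ⟨hlower t ht, hupper t ht⟩, ?_⟩
  · intro t ht
    have h1 := Surface.abs_integral_mul_exp_le f (u t)
    rw [hvol t ht] at h1
    rw [Surface.alpha, one_div, ← div_eq_inv_mul, abs_div, abs_of_pos hA, div_le_iff₀ hA, add_mul,
      div_mul_cancel₀ _ hA.ne']
    exact (abs_sub _ _).trans (add_le_add_left h1 _)
  · intro t ht
    have h1 := hanti (Set.left_mem_Ico.2 hT) ht ht.1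
    simpa only [h.initial] using h1
  · intro p t ht
    refine ⟨Surface.integrable_exp_mul g (2 * p) (u t), ?_⟩
    have h1 : ∫ x, Real.exp (2 * p * Surface.H1.fn g (u t) x) ∂(Surface.vol g)
        ≤ ∫ x, Real.exp |2 * p * Surface.H1.fn g (u t) x| ∂(Surface.vol g) :=
      integral_mono (Surface.integrable_exp_mul g _ _) (Surface.integrable_exp_abs_mul g _ _)
        fun x => Real.exp_le_exp.2 (le_abs_self _)
    have h2 : ∫ x, |Surface.H1.fn g (u t) x| ∂(Surface.vol g) ≤ A - B / (2 * K) + -A / K * S := by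
      have h3 := Surface.integral_abs_fn_le (u t)
      rw [hvol t ht] at h3
      linarith [hlower t ht]
    refine (h1.trans (htr (2 * p) (u t))).trans ?_
    rw [mul_assoc, ← Real.exp_add]
    refine mul_le_mul_of_nonneg_left (Real.exp_le_exp.2 ?_) hC.le
    have h4 := mul_le_mul_of_nonneg_left (hgrad t ht) (sq_nonneg (2 * p))
    have h5 := mul_le_mul_of_nonneg_left h2 (abs_nonneg (2 * p))
    have h6 := mul_le_mul_of_nonneg_left (add_le_add h4 h5) hC.le
    have h7 := mul_le_mul_of_nonneg_right
      (le_abs_self (C * ((2 * p) ^ 2 * (2 * A) + |2 * p| * (-A / K)))) hS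
    linarith
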